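/- For integers $p,q\ge 0$, let $SU(p,q)$ be the group of complex matrices of determinant $1$ preserving the standard Hermitian form of signature $(p,q)$, and let $SO(p,q)$ be the group of real matrices of determinant $1$ preserving the standard quadratic form of signature $(p,q)$ on $\mathbb{R}^{p,q}=\mathbb{R}^{p+q}$, both with their usual Lie group topologies. There is an isogeny $\varphi: SU(2,2)\to SO(2,4)$, that is, a continuous homomorphism with finite kernel whose image is the identity component of $SO(2,4)$, such that the following hold. (1) If $q\ge 2$, $n\ge 0$, and there is a non-trivial continuous homomorphism $SU(2,q)\to SO(2,n)$, then $q=2$. (2) For every $n\ge 0$, a continuous homomorphism $\rho: SU(2,2)\to SO(2,n)$ is non-trivial if and only if it comes from $\varphi$: there is a linear isometric embedding $\iota:\mathbb{R}^{2,4}\to\mathbb{R}^{2,n}$ (so $n\ge 4$) such that, for every $g\in SU(2,2)$, $\rho(g)\,\iota(v)=\iota(\varphi(g)v)$ for all $v\in\mathbb{R}^{2,4}$, and $\rho(g)$ is the identity on the orthogonal complement of $\iota(\mathbb{R}^{2,4})$. -/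

import Mathlib

open scoped Matrix

/-- The diagonal matrix with `p` entries `1` followed by `q` entries `-1`. -/
abbrev sigMatrix (p q : ℕ) (R : Type*) [CommRing R] : Matrix (Fin p ⊕ Fin q) (Fin p ⊕ Fin q) R :=
  LieAlgebra.Orthogonal.indefiniteDiagonal (Fin p) (Fin q) R

/-- `SU(p,q)`: complex matrices of determinant one preserving the standard Hermitian form of
signature `(p,q)`. It carries the subspace topology. -/
def SUpq (p q : ℕ) : Subgroup (Matrix.SpecialLinearGroup (Fin p ⊕ Fin q) ℂ) where
  carrier := {g | (g : Matrix (Fin p ⊕ Fin q) (Fin p ⊕ Fin q) ℂ)ᴴ * sigMatrix p q ℂ *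
    (g : Matrix (Fin p ⊕ Fin q) (Fin p ⊕ Fin q) ℂ) = sigMatrix p q ℂ}
  one_mem' := by simp
  mul_mem' := by
    intro a b ha hb
    simp only [Set.mem_ofPred_eq, Matrix.SpecialLinearGroup.coe_mul,
      Matrix.conjTranspose_mul] at ha hb ⊢
    calc _ = (b : Matrix (Fin p ⊕ Fin q) (Fin p ⊕ Fin q) ℂ)ᴴ *
          ((a : Matrix (Fin p ⊕ Fin q) (Fin p ⊕ Fin q) ℂ)ᴴ * sigMatrix p q ℂ *
          (a : Matrix (Fin p ⊕ Fin q) (Fin p ⊕ Fin q) ℂ)) *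
          (b : Matrix (Fin p ⊕ Fin q) (Fin p ⊕ Fin q) ℂ) := by simp only [Matrix.mul_assoc]
      _ = _ := by rw [ha, hb]
  inv_mem' := by
    intro a ha
    simp only [Set.mem_ofPred_eq] at ha ⊢
    have h1 : (a : Matrix (Fin p ⊕ Fin q) (Fin p ⊕ Fin q) ℂ) *
        ((a⁻¹ : Matrix.SpecialLinearGroup (Fin p ⊕ Fin q) ℂ) :
          Matrix (Fin p ⊕ Fin q) (Fin p ⊕ Fin q) ℂ) = 1 := by
      rw [← Matrix.SpecialLinearGroup.coe_mul, mul_inv_cancel, Matrix.SpecialLinearGroup.coe_one]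
    have h2 := congrArg Matrix.conjTranspose h1
    rw [Matrix.conjTranspose_mul, Matrix.conjTranspose_one] at h2
    generalize ((a⁻¹ : Matrix.SpecialLinearGroup (Fin p ⊕ Fin q) ℂ) :
          Matrix (Fin p ⊕ Fin q) (Fin p ⊕ Fin q) ℂ) = b at h1 h2 ⊢
    calc bᴴ * sigMatrix p q ℂ * b
        = (bᴴ * (a : Matrix (Fin p ⊕ Fin q) (Fin p ⊕ Fin q) ℂ)ᴴ) * sigMatrix p q ℂ *
          ((a : Matrix (Fin p ⊕ Fin q) (Fin p ⊕ Fin q) ℂ) * b) := by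
          conv_lhs => rw [← ha]
          simp only [Matrix.mul_assoc]
      _ = sigMatrix p q ℂ := by rw [h1, h2, Matrix.one_mul, Matrix.mul_one]

/-- `SO(p,q)`: real matrices of determinant one preserving the standard quadratic form of
signature `(p,q)`. It carries the subspace topology. -/
def SOpq (p q : ℕ) : Subgroup (Matrix.SpecialLinearGroup (Fin p ⊕ Fin q) ℝ) where
  carrier := {g | (g : Matrix (Fin p ⊕ Fin q) (Fin p ⊕ Fin q) ℝ)ᵀ * sigMatrix p q ℝ *
    (g : Matrix (Fin p ⊕ Fin q) (Fin p ⊕ Fin q) ℝ) = sigMatrix p q ℝ}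
  one_mem' := by simp
  mul_mem' := by
    intro a b ha hb
    simp only [Set.mem_ofPred_eq, Matrix.SpecialLinearGroup.coe_mul,
      Matrix.transpose_mul] at ha hb ⊢
    calc _ = (b : Matrix (Fin p ⊕ Fin q) (Fin p ⊕ Fin q) ℝ)ᵀ *
          ((a : Matrix (Fin p ⊕ Fin q) (Fin p ⊕ Fin q) ℝ)ᵀ * sigMatrix p q ℝ *
          (a : Matrix (Fin p ⊕ Fin q) (Fin p ⊕ Fin q) ℝ)) *
          (b : Matrix (Fin p ⊕ Fin q) (Fin p ⊕ Fin q) ℝ) := by simp only [Matrix.mul_assoc]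
      _ = _ := by rw [ha, hb]
  inv_mem' := by
    intro a ha
    simp only [Set.mem_ofPred_eq] at ha ⊢
    have h1 : (a : Matrix (Fin p ⊕ Fin q) (Fin p ⊕ Fin q) ℝ) *
        ((a⁻¹ : Matrix.SpecialLinearGroup (Fin p ⊕ Fin q) ℝ) :
          Matrix (Fin p ⊕ Fin q) (Fin p ⊕ Fin q) ℝ) = 1 := by
      rw [← Matrix.SpecialLinearGroup.coe_mul, mul_inv_cancel, Matrix.SpecialLinearGroup.coe_one]
    have h2 := congrArg Matrix.transpose h1
    rw [Matrix.transpose_mul, Matrix.transpose_one] at h2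
    generalize ((a⁻¹ : Matrix.SpecialLinearGroup (Fin p ⊕ Fin q) ℝ) :
          Matrix (Fin p ⊕ Fin q) (Fin p ⊕ Fin q) ℝ) = b at h1 h2 ⊢
    calc bᵀ * sigMatrix p q ℝ * b
        = (bᵀ * (a : Matrix (Fin p ⊕ Fin q) (Fin p ⊕ Fin q) ℝ)ᵀ) * sigMatrix p q ℝ *
          ((a : Matrix (Fin p ⊕ Fin q) (Fin p ⊕ Fin q) ℝ) * b) := by
          conv_lhs => rw [← ha]
          simp only [Matrix.mul_assoc]
      _ = sigMatrix p q ℝ := by rw [h1, h2, Matrix.one_mul, Matrix.mul_one]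

/-- The standard symmetric bilinear form of signature `(p,q)` on `ℝ^{p+q}`. -/
def sigForm {p q : ℕ} (v w : Fin p ⊕ Fin q → ℝ) : ℝ := v ⬝ᵥ (sigMatrix p q ℝ *ᵥ w)

/-- The action of `SO(p,q)` on `ℝ^{p+q}`. -/
def soAct {p q : ℕ} (g : SOpq p q) (v : Fin p ⊕ Fin q → ℝ) : Fin p ⊕ Fin q → ℝ :=
  ((g : Matrix.SpecialLinearGroup (Fin p ⊕ Fin q) ℝ) :
    Matrix (Fin p ⊕ Fin q) (Fin p ⊕ Fin q) ℝ) *ᵥ v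

/-- An isogeny of a connected Lie group `G` to a Lie group `H`: a continuous homomorphism with
finite kernel whose image is the identity component of `H`. -/
structure IsIsogeny {G H : Type*} [Group G] [TopologicalSpace G] [Group H] [TopologicalSpace H]
    (φ : G →* H) : Prop where
  continuous : Continuous φ
  finite_ker : Finite φ.ker
  range_eq : Set.range φ = connectedComponent (1 : H)

/-- `ρ : G → SO(2,n)` is the composite of `φ : G → SO(2,m)` with the inclusion
`SO(2,m) → SO(2,n)` attached to an isometric embedding `ι : ℝ^{2,m} → ℝ^{2,n}`: the group
`SO(2,m)` acts in the given way on the image of `ι` and trivially on its orthogonal complement. -/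
def ComesFrom {G : Type*} [Group G] {m n : ℕ} (φ : G →* SOpq 2 m) (ρ : G →* SOpq 2 n) : Prop :=
  ∃ ι : (Fin 2 ⊕ Fin m → ℝ) →ₗ[ℝ] (Fin 2 ⊕ Fin n → ℝ),
    (∀ v w, sigForm (ι v) (ι w) = sigForm v w) ∧
    ∀ g : G, (∀ v, soAct (ρ g) (ι v) = ι (soAct (φ g) v)) ∧
      ∀ w, (∀ v, sigForm (ι v) w = 0) → soAct (ρ g) w = w

/-!
A continuous homomorphism `ρ : SU(p,q) → SO(m,n)` has a differential, a homomorphism of Lie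
algebras (`exists_differential`), and it is determined by this differential because `SU(p,q)` is
generated by exponentials (`closure_range_expSU`). So everything reduces to representations of
`su(2,q)` by operators skew-adjoint for a form of index two, and to one explicit isogeny.

View `su(2,2)` as the conformal algebra of Minkowski space. It is graded in degrees `-2, 0, 2` by
an element `H = lMat 1`; the outer parts `eMat`, `fMat` are copies of the Hermitian `2 × 2`
matrices, and the middle part is `sl(2,ℂ) ⊕ ℝ`. In a representation by skew-adjoint operators the
weight spaces of `H` of weight `≠ 0` are isotropic, hence of dimension at most two as the form has
index two; so `sl(2,ℂ)` acts on them by zero (`sl2C_eq_zero_of_finrank_le_two`). This forces all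
weights to be `0` or `±2` (`weightSpace_eq_bot`) and, in a nontrivial representation, the weight
spaces of weight `±2` to be lines. Applying the translations `eMat` to a vector of weight `-2`
produces a copy of `ℝ^{2,4}`, on which the action is given by explicit formulas
(`exists_conformalFrame`). The complement of this copy is definite, so the nilpotent operators
`eMat`, `fMat`, and with them `su(2,2)`, act there by zero. Hence two nontrivial representations,
one of them of dimension six, are related by an equivariant isometric embedding
(`exists_equivariant_isometry`).

For `q ≥ 3` the algebra `su(2,q)` contains a vector of weight `1` for the grading element of
`su(2,2)`; it acts by zero since weights are even, and as `su(2,q)` is simple the representation is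
zero (`IsOrthogonalSURep.eq_zero_of_three_le`).

The isogeny is the action `S ↦ g S gᵀ` of `SU(2,2)` on a real form of the alternating `4 × 4`
matrices, with the Pfaffian as quadratic form of signature `(2,4)`. That it is well defined and has
open image follows from the explicit inverse `soToSu` of its differential, which is an isomorphism
onto `so(2,4)`.
-/

/-! ### One-parameter groups and products of exponentials in a Banach algebra -/

section BanachAlgebra

open Filter Topology MeasureTheory

variable {𝔸 : Type*} [NormedRing 𝔸] [NormedAlgebra ℝ 𝔸] [CompleteSpace 𝔸]

theorem exp_add_smul (A : 𝔸) (s t : ℝ) :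
    NormedSpace.exp ((s + t) • A) = NormedSpace.exp (s • A) * NormedSpace.exp (t • A) := by
  let _ : NormedAlgebra ℚ 𝔸 := NormedAlgebra.restrictScalars ℚ ℝ 𝔸
  rw [add_smul]
  exact NormedSpace.exp_add_of_commute (((Commute.refl A).smul_left s).smul_right t)

theorem exp_mul_exp_neg (A : 𝔸) : NormedSpace.exp A * NormedSpace.exp (-A) = 1 := by
  have h := exp_add_smul A 1 (-1)
  simpa using h.symm

theorem hasDerivAt_exp_smul_zero (A : 𝔸) :
    HasDerivAt (fun t : ℝ => NormedSpace.exp (t • A)) A 0 := by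
  simpa using hasDerivAt_exp_smul_const (𝕂 := ℝ) A 0

theorem eq_of_exp_smul_eq {A B : 𝔸}
    (h : ∀ t : ℝ, NormedSpace.exp (t • A) = NormedSpace.exp (t • B)) : A = B :=
  (hasDerivAt_exp_smul_zero A).unique ((funext h : (fun t : ℝ => NormedSpace.exp (t • A)) = _) ▸
    hasDerivAt_exp_smul_zero B)

/-- A continuous one-parameter group `γ` in a Banach algebra is `t ↦ exp (t A)`. It is
differentiable because averaging it over a short interval gives an invertible element `c`, and
`γ t * c` is a difference of values of a primitive of `γ`. -/
theorem exists_eq_exp_smul_of_continuous {γ : ℝ → 𝔸} (hc : Continuous γ) (h0 : γ 0 = 1)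
    (hadd : ∀ s t, γ (s + t) = γ s * γ t) : ∃ A : 𝔸, ∀ t, γ t = NormedSpace.exp (t • A) := by
  set Φ : ℝ → 𝔸 := fun x => ∫ s in (0 : ℝ)..x, γ s with hΦ
  have hΦd : ∀ x, HasDerivAt Φ (γ x) x := fun x => (hc.integral_hasStrictDerivAt 0 x).hasDerivAt
  have hint : ∀ a b : ℝ, IntervalIntegrable γ volume a b := fun a b => hc.intervalIntegrable a b
  have hunit : ∃ a : ℝ, IsUnit (Φ a) := by
    have h1 := hasDerivAt_iff_tendsto_slope_zero.1 (hΦd 0)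
    have h2 : ∀ᶠ t in 𝓝[≠] (0 : ℝ), IsUnit (t⁻¹ • (Φ (0 + t) - Φ 0)) :=
      h1.eventually (by rw [h0]; exact Units.isOpen.mem_nhds isUnit_one)
    obtain ⟨t, ht, ht0⟩ := (h2.and self_mem_nhdsWithin).exists
    refine ⟨t, ?_⟩
    have ht0 : t ≠ 0 := ht0
    have h3 : Φ t = algebraMap ℝ 𝔸 t * (t⁻¹ • (Φ (0 + t) - Φ 0)) := by
      simp [hΦ, ← Algebra.smul_def, smul_smul, ht0]
    rw [h3]
    exact ((IsUnit.mk0 t ht0).map (algebraMap ℝ 𝔸)).mul ht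
  obtain ⟨a, c, hcu⟩ := hunit
  have hγ : ∀ t, γ t = (Φ (t + a) - Φ t) * ↑c⁻¹ := by
    intro t
    have h1 : γ t * c = Φ (t + a) - Φ t := by
      rw [hcu]
      simp only [hΦ]
      rw [intervalIntegral.integral_interval_sub_left (hint _ _) (hint _ _)]
      have h2 := intervalIntegral.integral_comp_add_left (a := 0) (b := a) γ t
      simp only [hadd, add_zero] at h2
      rw [← h2]
      exact ((ContinuousLinearMap.mul ℝ 𝔸 (γ t)).intervalIntegral_comp_comm (hint 0 a)).symm
    rw [← h1, mul_assoc, Units.mul_inv, mul_one]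
  set A : 𝔸 := (γ a - 1) * ↑c⁻¹ with hA
  have hd : ∀ t, HasDerivAt γ (γ t * A) t := by
    intro t
    have h1 : HasDerivAt (fun t => (Φ (t + a) - Φ t) * (↑c⁻¹ : 𝔸))
        ((γ (t + a) - γ t) * ↑c⁻¹) t :=
      (((hΦd (t + a)).comp_add_const t a).sub (hΦd t)).mul_const _
    have h2 : (γ (t + a) - γ t) * (↑c⁻¹ : 𝔸) = γ t * A := by
      rw [hA, hadd, ← mul_assoc, mul_sub, mul_one]
    rw [← h2]
    exact h1.congr_of_eventuallyEq (Eventually.of_forall hγ)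
  refine ⟨A, fun t => ?_⟩
  have hk : ∀ t, HasDerivAt (fun t => γ t * NormedSpace.exp (t • (-A))) 0 t := by
    intro t
    have h1 := (hd t).mul (hasDerivAt_exp_smul_const' (𝕂 := ℝ) (-A) t)
    rw [show γ t * A * NormedSpace.exp (t • -A) + γ t * (-A * NormedSpace.exp (t • -A)) = 0 by
      noncomm_ring] at h1
    exact h1
  have hconst := is_const_of_deriv_eq_zero (fun t => (hk t).differentiableAt)
    (fun t => (hk t).deriv) t 0
  simp only [h0, zero_smul, NormedSpace.exp_zero, mul_one] at hconst
  have h3 := exp_mul_exp_neg (-(t • A))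
  rw [neg_neg] at h3
  calc γ t = γ t * (NormedSpace.exp (-(t • A)) * NormedSpace.exp (t • A)) := by rw [h3, mul_one]
    _ = NormedSpace.exp (t • A) := by rw [← mul_assoc, ← smul_neg, hconst, one_mul]

/-- The product formula `u (1 / k) ^ k → exp (u' 0)`, for a curve `u` through `1`: near `1` the
curve is the exponential of a differentiable curve through `0`. -/
theorem tendsto_pow_exp_of_hasDerivAt {u : ℝ → 𝔸} {Z : 𝔸} (h0 : u 0 = 1) (hu : HasDerivAt u Z 0) :
    Tendsto (fun k : ℕ => u ((k : ℝ)⁻¹) ^ k) atTop (𝓝 (NormedSpace.exp Z)) := by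
  let _ : NormedAlgebra ℚ 𝔸 := NormedAlgebra.restrictScalars ℚ ℝ 𝔸
  have he : HasStrictFDerivAt (NormedSpace.exp : 𝔸 → 𝔸)
      ((ContinuousLinearEquiv.refl ℝ 𝔸 : 𝔸 ≃L[ℝ] 𝔸) : 𝔸 →L[ℝ] 𝔸) 0 :=
    hasStrictFDerivAt_exp_zero
  set lg := he.localInverse NormedSpace.exp _ 0 with hlg
  have hl1 : lg 1 = 0 := by
    have := he.eventually_left_inverse.self_of_nhds
    rwa [NormedSpace.exp_zero] at this
  have hld : HasFDerivAt lg (ContinuousLinearMap.id ℝ 𝔸) (u 0) := by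
    have := he.to_localInverse.hasFDerivAt
    rw [NormedSpace.exp_zero] at this
    rw [h0]; exact this
  have hL : HasDerivAt (fun t => lg (u t)) Z 0 := hld.comp_hasDerivAt 0 hu
  have hr : ∀ᶠ t in 𝓝 (0 : ℝ), NormedSpace.exp (lg (u t)) = u t := by
    have h1 := he.eventually_right_inverse
    rw [NormedSpace.exp_zero, ← h0] at h1
    exact hu.continuousAt.eventually h1
  have hk0 : Tendsto (fun k : ℕ => ((k : ℝ)⁻¹)) atTop (𝓝[≠] 0) := by
    refine tendsto_nhdsWithin_iff.2 ⟨tendsto_inv_atTop_nhds_zero_nat, ?_⟩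
    filter_upwards [eventually_gt_atTop 0] with k hk
    simpa using hk.ne'
  have h1 := (hasDerivAt_iff_tendsto_slope_zero.1 hL).comp hk0
  have h2 : Tendsto (fun k : ℕ => NormedSpace.exp (k • lg (u ((k : ℝ)⁻¹)))) atTop
      (𝓝 (NormedSpace.exp Z)) := by
    refine (NormedSpace.exp_continuous.tendsto Z).comp (h1.congr fun k => ?_)
    simp only [Function.comp_apply, inv_inv, zero_add, h0, hl1, sub_zero]
    exact Nat.cast_smul_eq_nsmul ℝ k (lg (u (k : ℝ)⁻¹))
  refine h2.congr' ?_
  filter_upwards [(hk0.mono_right nhdsWithin_le_nhds).eventually hr] with k hk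
  rw [NormedSpace.exp_nsmul, hk]

end BanachAlgebra

/-! ### Exponentials of matrices -/

section MatrixExp

open scoped Matrix.Norms.Operator
open Filter Topology

variable {m n : Type*} [Fintype m] [DecidableEq m] [Fintype n] [DecidableEq n]

theorem exp_mul_eq_mul_exp {𝕜 : Type*} [RCLike 𝕜] {A : Matrix m m 𝕜} {B : Matrix n n 𝕜}
    {Q : Matrix m n 𝕜}
    (h : A * Q = Q * B) : NormedSpace.exp A * Q = Q * NormedSpace.exp B := by
  have hpow : ∀ k : ℕ, A ^ k * Q = Q * B ^ k := by
    intro k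
    induction k with
    | zero => simp
    | succ k ih =>
      rw [pow_succ, pow_succ, Matrix.mul_assoc, h, ← Matrix.mul_assoc, ih, Matrix.mul_assoc]
  have h1 := (NormedSpace.exp_series_hasSum_exp' (𝕂 := 𝕜) A).map
    (Matrix.addMonoidHomMulRight Q) (by
      change Continuous fun M : Matrix m m 𝕜 => M * Q
      fun_prop)
  have h2 := (NormedSpace.exp_series_hasSum_exp' (𝕂 := 𝕜) B).map
    (Matrix.addMonoidHomMulLeft Q) (by
      change Continuous fun M : Matrix n n 𝕜 => Q * M
      fun_prop)
  refine h1.unique (h2.congr_fun ?_)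
  intro k
  simp [Matrix.addMonoidHomMulLeft, Matrix.addMonoidHomMulRight, hpow]

theorem exp_mulVec_linearMap {A : Matrix m m ℝ} {B : Matrix n n ℝ} (ι : (n → ℝ) →ₗ[ℝ] (m → ℝ))
    (h : ∀ v, A *ᵥ ι v = ι (B *ᵥ v)) (v : n → ℝ) :
    NormedSpace.exp A *ᵥ ι v = ι (NormedSpace.exp B *ᵥ v) := by
  have hQ : ∀ v, ι v = LinearMap.toMatrix' ι *ᵥ v := fun v => by
    rw [LinearMap.toMatrix'_mulVec]
  have h1 : A * LinearMap.toMatrix' ι = LinearMap.toMatrix' ι * B := by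
    refine Matrix.mulVec_injective (funext fun v => ?_)
    rw [← Matrix.mulVec_mulVec, ← Matrix.mulVec_mulVec, ← hQ, ← hQ, h]
  rw [hQ, hQ, Matrix.mulVec_mulVec, Matrix.mulVec_mulVec, exp_mul_eq_mul_exp h1]

theorem exp_mulVec_of_mulVec_eq_zero {A : Matrix m m ℝ} {w : m → ℝ} (h : A *ᵥ w = 0) :
    NormedSpace.exp A *ᵥ w = w := by
  have h1 := exp_mulVec_linearMap (A := A) (B := (0 : Matrix Unit Unit ℝ))
    (LinearMap.toSpanSingleton ℝ (m → ℝ) w ∘ₗ LinearMap.proj ()) (by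
      intro v
      simp [Matrix.mulVec_smul, h]) 1
  simpa using h1

theorem differentiable_det : Differentiable ℝ (fun M : Matrix n n ℂ => M.det) := by
  have h : ∀ i j, Differentiable ℝ (fun M : Matrix n n ℂ => M i j) := fun i j =>
    (LinearMap.toContinuousLinearMap
      (Matrix.entryLinearMap ℝ ℂ i j : Matrix n n ℂ →ₗ[ℝ] ℂ)).differentiable
  simp only [Matrix.det_apply]
  fun_prop

theorem hasDerivAt_det_exp (X : Matrix n n ℂ) :
    HasDerivAt (fun t : ℝ => (NormedSpace.exp (t • X)).det) X.trace 0 := by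
  obtain ⟨L, hd⟩ : ∃ L : Matrix n n ℂ →L[ℝ] ℂ, HasFDerivAt (fun M : Matrix n n ℂ => M.det) L 1 :=
    differentiable_det 1
  have hline : HasDerivAt (fun t : ℝ => (1 + t • X : Matrix n n ℂ)) X 0 := by
    have h := ((hasDerivAt_id (0 : ℝ)).smul_const X).const_add 1
    rw [one_smul] at h
    exact h
  have h1 : HasDerivAt (fun t : ℝ => (1 + t • X : Matrix n n ℂ).det)
      (L X) 0 := by
    have hd' := hd
    rw [show (1 : Matrix n n ℂ) = 1 + (0 : ℝ) • X by simp] at hd'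
    exact HasFDerivAt.comp_hasDerivAt (l := fun M : Matrix n n ℂ => M.det) (0 : ℝ) hd' hline
  have h2 : HasDerivAt (fun t : ℝ => (1 + t • X : Matrix n n ℂ).det) X.trace 0 := by
    set P := (1 + (Polynomial.X : Polynomial ℂ) • X.map Polynomial.C).det.divX.divX with hP
    have h3 : (fun t : ℝ => (1 + t • X : Matrix n n ℂ).det) =
        fun t : ℝ => 1 + X.trace * (t : ℂ) + P.eval (t : ℂ) * (t : ℂ) ^ 2 := by
      funext t
      rw [← Matrix.det_one_add_smul]
      congr 2
    rw [h3]
    have h4 : HasDerivAt (fun z : ℂ => 1 + X.trace * z + P.eval z * z ^ 2) X.trace 0 := by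
      have := (((hasDerivAt_id (0 : ℂ)).const_mul X.trace).const_add 1).add
        ((P.hasDerivAt 0).mul ((hasDerivAt_id (0 : ℂ)).pow 2))
      refine this.congr_deriv ?_
      simp
    have h5 := HasDerivAt.comp_ofReal (z := 0) (by simpa using h4)
    simpa using h5
  have h6 : HasDerivAt (fun t : ℝ => NormedSpace.exp (t • X)) X 0 := hasDerivAt_exp_smul_zero X
  rw [show (1 : Matrix n n ℂ) = NormedSpace.exp ((0 : ℝ) • X) by simp] at hd
  have h7 := HasFDerivAt.comp_hasDerivAt (l := fun M : Matrix n n ℂ => M.det) (0 : ℝ) hd h6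
  rw [← h1.unique h2]
  exact h7

theorem det_exp_eq_exp_trace (X : Matrix n n ℂ) :
    (NormedSpace.exp X).det = Complex.exp X.trace := by
  obtain ⟨A, hA⟩ := exists_eq_exp_smul_of_continuous
    (γ := fun t : ℝ => (NormedSpace.exp (t • X)).det)
    (by
      have : Continuous fun t : ℝ => NormedSpace.exp (t • X) :=
        NormedSpace.exp_continuous.comp (by fun_prop)
      exact this.matrix_det) (by simp)
    (fun s t => by
      rw [← Matrix.det_mul]
      exact congrArg Matrix.det (exp_add_smul X s t))
  have h1 := hasDerivAt_det_exp X
  rw [show (fun t : ℝ => (NormedSpace.exp (t • X)).det) = fun t : ℝ => NormedSpace.exp (t • A)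
    from funext hA] at h1
  have h2 := h1.unique (hasDerivAt_exp_smul_zero A)
  have h3 := hA 1
  simp only [one_smul] at h3
  rw [h3, h2, Complex.exp_eq_exp_ℂ]

end MatrixExp

/-! ### The Lie algebra of `SU(p,q)` and the differential of a continuous homomorphism -/

section Differential

open scoped Matrix.Norms.Operator
open Filter Topology

/-- The real Lie algebra `u(p,q)`: complex matrices which are skew-adjoint for the standard
Hermitian form of signature `(p,q)`. -/
noncomputable def uLie (p q : ℕ) : Submodule ℝ (Matrix (Fin p ⊕ Fin q) (Fin p ⊕ Fin q) ℂ) where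
  carrier := {X | Xᴴ * sigMatrix p q ℂ = -(sigMatrix p q ℂ * X)}
  zero_mem' := by simp
  add_mem' := by
    intro X Y hX hY
    simp only [Set.mem_ofPred_eq] at hX hY ⊢
    rw [Matrix.conjTranspose_add, Matrix.add_mul, hX, hY, Matrix.mul_add, neg_add]
  smul_mem' := by
    intro c X hX
    simp only [Set.mem_ofPred_eq] at hX ⊢
    rw [Matrix.conjTranspose_smul, Matrix.smul_mul, hX, Matrix.mul_smul, star_trivial, smul_neg]

/-- The real Lie algebra `su(p,q)`: the elements of `u(p,q)` of trace zero. -/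
noncomputable def suLie (p q : ℕ) : Submodule ℝ (Matrix (Fin p ⊕ Fin q) (Fin p ⊕ Fin q) ℂ) :=
  uLie p q ⊓ LinearMap.ker (Matrix.traceLinearMap (Fin p ⊕ Fin q) ℝ ℂ)

variable {p q : ℕ}

theorem mem_uLie {X : Matrix (Fin p ⊕ Fin q) (Fin p ⊕ Fin q) ℂ} :
    X ∈ uLie p q ↔ Xᴴ * sigMatrix p q ℂ = -(sigMatrix p q ℂ * X) := Iff.rfl

theorem mem_suLie {X : Matrix (Fin p ⊕ Fin q) (Fin p ⊕ Fin q) ℂ} :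
    X ∈ suLie p q ↔ X ∈ uLie p q ∧ X.trace = 0 := by
  simp [suLie]

theorem sigMatrix_mul_self (p q : ℕ) (R : Type*) [CommRing R] :
    sigMatrix p q R * sigMatrix p q R = 1 := by
  rw [sigMatrix, LieAlgebra.Orthogonal.indefiniteDiagonal, Matrix.diagonal_mul_diagonal,
    ← Matrix.diagonal_one]
  congr 1
  funext i
  rcases i with i | i <;> simp

theorem sigMatrix_conjTranspose (p q : ℕ) : (sigMatrix p q ℂ)ᴴ = sigMatrix p q ℂ := by
  rw [sigMatrix, LieAlgebra.Orthogonal.indefiniteDiagonal, Matrix.diagonal_conjTranspose]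
  congr 1
  funext i
  rcases i with i | i <;> simp

theorem sigMatrix_transpose (p q : ℕ) (R : Type*) [CommRing R] :
    (sigMatrix p q R)ᵀ = sigMatrix p q R := by
  rw [sigMatrix, LieAlgebra.Orthogonal.indefiniteDiagonal, Matrix.diagonal_transpose]

theorem commutator_mem_uLie {X Y : Matrix (Fin p ⊕ Fin q) (Fin p ⊕ Fin q) ℂ}
    (hX : X ∈ uLie p q) (hY : Y ∈ uLie p q) : X * Y - Y * X ∈ uLie p q := by
  rw [mem_uLie] at hX hY ⊢
  rw [Matrix.conjTranspose_sub, Matrix.conjTranspose_mul, Matrix.conjTranspose_mul, Matrix.sub_mul,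
    Matrix.mul_assoc, hX, Matrix.mul_assoc, hY, Matrix.mul_neg, ← Matrix.mul_assoc, hY,
    Matrix.mul_neg, ← Matrix.mul_assoc, hX]
  noncomm_ring

theorem commutator_mem_suLie {X Y : Matrix (Fin p ⊕ Fin q) (Fin p ⊕ Fin q) ℂ}
    (hX : X ∈ uLie p q) (hY : Y ∈ uLie p q) : X * Y - Y * X ∈ suLie p q := by
  refine mem_suLie.2 ⟨commutator_mem_uLie hX hY, ?_⟩
  rw [Matrix.trace_sub, Matrix.trace_mul_comm, sub_self]

theorem exp_mem_SUpq {X : Matrix (Fin p ⊕ Fin q) (Fin p ⊕ Fin q) ℂ} (hX : X ∈ suLie p q) :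
    (NormedSpace.exp X).det = 1 ∧
      (NormedSpace.exp X)ᴴ * sigMatrix p q ℂ * NormedSpace.exp X = sigMatrix p q ℂ := by
  obtain ⟨hX, ht⟩ := mem_suLie.1 hX
  refine ⟨by rw [det_exp_eq_exp_trace, ht, Complex.exp_zero], ?_⟩
  rw [← Matrix.exp_conjTranspose, exp_mul_eq_mul_exp (B := -X) (by rw [mem_uLie.1 hX]; simp),
    Matrix.mul_assoc]
  have h := exp_mul_exp_neg (-X)
  rw [neg_neg] at h
  exact (congrArg (sigMatrix p q ℂ * ·) h).trans (Matrix.mul_one _)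

/-- The underlying matrix of an element of `SU(p,q)`. -/
def suMat (g : SUpq p q) : Matrix (Fin p ⊕ Fin q) (Fin p ⊕ Fin q) ℂ :=
  ((g : Matrix.SpecialLinearGroup (Fin p ⊕ Fin q) ℂ) : Matrix (Fin p ⊕ Fin q) (Fin p ⊕ Fin q) ℂ)

theorem suMat_mul (g h : SUpq p q) : suMat (g * h) = suMat g * suMat h := rfl

theorem suMat_one : suMat (1 : SUpq p q) = 1 := rfl

theorem suMat_injective : Function.Injective (suMat : SUpq p q → _) := fun _ _ h =>
  Subtype.ext (Subtype.ext h)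

theorem suMat_pow (g : SUpq p q) (k : ℕ) : suMat (g ^ k) = suMat g ^ k := by
  induction k with
  | zero => rfl
  | succ k ih => rw [pow_succ, pow_succ, suMat_mul, ih]

theorem suMat_mul_inv (g : SUpq p q) : suMat g * suMat g⁻¹ = 1 := by
  rw [← suMat_mul, mul_inv_cancel, suMat_one]

theorem suMat_inv_mul (g : SUpq p q) : suMat g⁻¹ * suMat g = 1 := by
  rw [← suMat_mul, inv_mul_cancel, suMat_one]

theorem suMat_form (g : SUpq p q) : (suMat g)ᴴ * sigMatrix p q ℂ * suMat g = sigMatrix p q ℂ :=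
  g.2

theorem suMat_isInducing : IsInducing (suMat : SUpq p q → _) :=
  (IsInducing.subtypeVal (t := {M : Matrix (Fin p ⊕ Fin q) (Fin p ⊕ Fin q) ℂ | M.det = 1})).comp
    IsInducing.subtypeVal

/-- The exponential map `su(p,q) → SU(p,q)`. -/
noncomputable def expSU (X : suLie p q) : SUpq p q :=
  ⟨⟨NormedSpace.exp (X : Matrix (Fin p ⊕ Fin q) (Fin p ⊕ Fin q) ℂ), (exp_mem_SUpq X.2).1⟩,
    (exp_mem_SUpq X.2).2⟩

theorem suMat_expSU (X : suLie p q) :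
    suMat (expSU X) = NormedSpace.exp (X : Matrix (Fin p ⊕ Fin q) (Fin p ⊕ Fin q) ℂ) := rfl

theorem expSU_zero : expSU (0 : suLie p q) = 1 :=
  suMat_injective (by rw [suMat_expSU, suMat_one]; exact NormedSpace.exp_zero)

theorem expSU_add_smul (X : suLie p q) (s t : ℝ) :
    expSU ((s + t) • X) = expSU (s • X) * expSU (t • X) :=
  suMat_injective (by rw [suMat_mul]; exact exp_add_smul _ s t)

theorem continuous_expSU_smul (X : suLie p q) : Continuous fun t : ℝ => expSU (t • X) := by
  rw [suMat_isInducing.continuous_iff]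
  change Continuous fun t : ℝ =>
    NormedSpace.exp (t • (X : Matrix (Fin p ⊕ Fin q) (Fin p ⊕ Fin q) ℂ))
  exact NormedSpace.exp_continuous.comp (by fun_prop)

theorem conj_mem_suLie (g : SUpq p q) {X : Matrix (Fin p ⊕ Fin q) (Fin p ⊕ Fin q) ℂ}
    (hX : X ∈ suLie p q) : suMat g * X * suMat g⁻¹ ∈ suLie p q := by
  obtain ⟨hX, ht⟩ := mem_suLie.1 hX
  refine mem_suLie.2 ⟨mem_uLie.2 ?_, ?_⟩
  · have h1 : (suMat g)ᴴ * sigMatrix p q ℂ = sigMatrix p q ℂ * suMat g⁻¹ := by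
      calc (suMat g)ᴴ * sigMatrix p q ℂ
          = (suMat g)ᴴ * sigMatrix p q ℂ * (suMat g * suMat g⁻¹) := by
            rw [suMat_mul_inv, Matrix.mul_one]
        _ = _ := by rw [← Matrix.mul_assoc, suMat_form]
    have h2 : (suMat g⁻¹)ᴴ * sigMatrix p q ℂ = sigMatrix p q ℂ * suMat g := by
      calc (suMat g⁻¹)ᴴ * sigMatrix p q ℂ
          = (suMat g⁻¹)ᴴ * sigMatrix p q ℂ * (suMat g⁻¹ * suMat g) := by
            rw [suMat_inv_mul, Matrix.mul_one]
        _ = _ := by rw [← Matrix.mul_assoc, suMat_form]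
    rw [Matrix.conjTranspose_mul, Matrix.conjTranspose_mul]
    calc (suMat g⁻¹)ᴴ * (Xᴴ * (suMat g)ᴴ) * sigMatrix p q ℂ
        = (suMat g⁻¹)ᴴ * (Xᴴ * ((suMat g)ᴴ * sigMatrix p q ℂ)) := by simp only [Matrix.mul_assoc]
      _ = (suMat g⁻¹)ᴴ * (Xᴴ * sigMatrix p q ℂ) * suMat g⁻¹ := by
          rw [h1]; simp only [Matrix.mul_assoc]
      _ = -((suMat g⁻¹)ᴴ * sigMatrix p q ℂ * X * suMat g⁻¹) := by
          rw [mem_uLie.1 hX]; simp only [Matrix.mul_assoc, Matrix.mul_neg, Matrix.neg_mul]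
      _ = _ := by rw [h2]; simp only [Matrix.mul_assoc]
  · rw [Matrix.trace_mul_comm, ← Matrix.mul_assoc, suMat_inv_mul, Matrix.one_mul, ht]

theorem suMat_expSU_conj (g : SUpq p q) (X : suLie p q) :
    suMat (expSU ⟨_, conj_mem_suLie g X.2⟩) = suMat g * suMat (expSU X) * suMat g⁻¹ := by
  rw [suMat_expSU, suMat_expSU]
  have h : NormedSpace.exp (suMat g * (X : Matrix (Fin p ⊕ Fin q) (Fin p ⊕ Fin q) ℂ) *
      suMat g⁻¹) * suMat g = suMat g *
        NormedSpace.exp (X : Matrix (Fin p ⊕ Fin q) (Fin p ⊕ Fin q) ℂ) :=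
    exp_mul_eq_mul_exp (by rw [Matrix.mul_assoc, suMat_inv_mul, Matrix.mul_one])
  rw [← h]
  exact (by rw [Matrix.mul_assoc (NormedSpace.exp _), suMat_mul_inv, Matrix.mul_one] :
    NormedSpace.exp (suMat g * (X : Matrix (Fin p ⊕ Fin q) (Fin p ⊕ Fin q) ℂ) * suMat g⁻¹) =
      NormedSpace.exp (suMat g * (X : Matrix (Fin p ⊕ Fin q) (Fin p ⊕ Fin q) ℂ) * suMat g⁻¹) *
        suMat g * suMat g⁻¹)

/-- A continuous matrix representation of `SU(p,q)` is differentiable: it has a differential `D`,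
which is linear by the product formula and a Lie algebra homomorphism by equivariance for the
adjoint action. For convenience `D` is extended linearly from `su(p,q)` to all matrices; its values
outside `su(p,q)` carry no meaning. -/
theorem exists_differential {m : Type*} [Fintype m] [DecidableEq m]
    (r : SUpq p q →* Matrix m m ℝ) (hr : Continuous r) :
    ∃ D : Matrix (Fin p ⊕ Fin q) (Fin p ⊕ Fin q) ℂ →ₗ[ℝ] Matrix m m ℝ,
      (∀ X : suLie p q, r (expSU X) = NormedSpace.exp (D X)) ∧
      ∀ X ∈ suLie p q, ∀ Y ∈ suLie p q, D (X * Y - Y * X) = D X * D Y - D Y * D X := by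
  have hex : ∀ X : suLie p q, ∃ A : Matrix m m ℝ,
      ∀ t : ℝ, r (expSU (t • X)) = NormedSpace.exp (t • A) := fun X =>
    exists_eq_exp_smul_of_continuous (hr.comp (continuous_expSU_smul X))
      (by simp [expSU_zero]) (fun s t => by rw [expSU_add_smul, map_mul])
  choose A hA using hex
  have huniq : ∀ (X : suLie p q) (B : Matrix m m ℝ),
      (∀ t : ℝ, r (expSU (t • X)) = NormedSpace.exp (t • B)) → A X = B := fun X B h =>
    eq_of_exp_smul_eq fun t => (hA X t).symm.trans (h t)
  have hsmul : ∀ (c : ℝ) (X : suLie p q), A (c • X) = c • A X := fun c X =>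
    huniq _ _ fun t => by rw [smul_smul, hA, smul_smul]
  have hadd1 : ∀ X Y : suLie p q, r (expSU (X + Y)) = NormedSpace.exp (A X + A Y) := by
    intro X Y
    have h1 : HasDerivAt (fun s : ℝ => NormedSpace.exp
        (s • (X : Matrix (Fin p ⊕ Fin q) (Fin p ⊕ Fin q) ℂ)) * NormedSpace.exp
        (s • (Y : Matrix (Fin p ⊕ Fin q) (Fin p ⊕ Fin q) ℂ))) (X + Y) 0 := by
      have := (hasDerivAt_exp_smul_zero
        (X : Matrix (Fin p ⊕ Fin q) (Fin p ⊕ Fin q) ℂ)).mul (hasDerivAt_exp_smul_zero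
        (Y : Matrix (Fin p ⊕ Fin q) (Fin p ⊕ Fin q) ℂ))
      refine this.congr_deriv ?_
      simp
    have h2 : HasDerivAt (fun s : ℝ => NormedSpace.exp (s • A X) * NormedSpace.exp (s • A Y))
        (A X + A Y) 0 := by
      have := (hasDerivAt_exp_smul_zero (A X)).mul (hasDerivAt_exp_smul_zero (A Y))
      refine this.congr_deriv ?_
      simp
    have h3 := tendsto_pow_exp_of_hasDerivAt (by simp) h1
    have h4 := tendsto_pow_exp_of_hasDerivAt (by simp) h2
    have h5 : Tendsto (fun k : ℕ => (expSU ((k : ℝ)⁻¹ • X) * expSU ((k : ℝ)⁻¹ • Y)) ^ k) atTop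
        (𝓝 (expSU (X + Y))) := by
      rw [suMat_isInducing.tendsto_nhds_iff]
      refine h3.congr fun k => ?_
      simp only [Function.comp_apply, suMat_pow, suMat_mul]
      rfl
    refine tendsto_nhds_unique ((hr.tendsto _).comp h5) (h4.congr fun k => ?_)
    simp [hA]
  have hadd : ∀ X Y : suLie p q, A (X + Y) = A X + A Y := fun X Y =>
    huniq _ _ fun t => by rw [smul_add, hadd1, hsmul, hsmul, smul_add]
  let D₀ : suLie p q →ₗ[ℝ] Matrix m m ℝ := { toFun := A, map_add' := hadd, map_smul' := hsmul }
  obtain ⟨D, hD⟩ := D₀.exists_extend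
  have hDA : ∀ X : suLie p q, D X = A X := fun X => congrArg (fun f => f X) hD
  refine ⟨D, fun X => ?_, fun Y hY X hX => ?_⟩
  · have := hA X 1
    rwa [one_smul, one_smul, ← hDA] at this
  have hconj : ∀ (g : SUpq p q) (X : suLie p q),
      D (suMat g * X * suMat g⁻¹) = r g * D X * r g⁻¹ := by
    intro g X
    rw [hDA X]
    refine (hDA ⟨_, conj_mem_suLie g X.2⟩).trans (huniq _ _ fun t => ?_)
    have h1 : expSU (t • (⟨_, conj_mem_suLie g X.2⟩ : suLie p q)) = g * expSU (t • X) * g⁻¹ := by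
      refine suMat_injective ?_
      rw [suMat_mul, suMat_mul, ← suMat_expSU_conj]
      congr 2
      refine Subtype.ext ?_
      simp
    have hg : r g⁻¹ * r g = 1 := by rw [← map_mul, inv_mul_cancel, map_one]
    have hg' : r g * r g⁻¹ = 1 := by rw [← map_mul, mul_inv_cancel, map_one]
    have h2 : NormedSpace.exp (t • (r g * A X * r g⁻¹)) * r g =
        r g * NormedSpace.exp (t • A X) := exp_mul_eq_mul_exp (𝕜 := ℝ) (by
          rw [smul_mul_assoc, Matrix.mul_assoc, hg, Matrix.mul_one, mul_smul_comm])
    rw [h1, map_mul, map_mul, hA, ← h2, Matrix.mul_assoc, hg', Matrix.mul_one]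
  have hc : Continuous D := D.continuous_of_finiteDimensional
  have hl : HasDerivAt (fun s : ℝ => D (NormedSpace.exp (s • Y) * X * NormedSpace.exp (s • (-Y))))
      (D (Y * X - X * Y)) 0 := by
    have h1 := ((hasDerivAt_exp_smul_zero Y).mul_const X).mul (hasDerivAt_exp_smul_zero (-Y))
    have h2 : HasDerivAt (fun s : ℝ => NormedSpace.exp (s • Y) * X * NormedSpace.exp (s • (-Y)))
        (Y * X - X * Y) 0 := h1.congr_deriv (by simp [sub_eq_add_neg])
    exact ((⟨D, hc⟩ : _ →L[ℝ] Matrix m m ℝ).hasFDerivAt).comp_hasDerivAt (0 : ℝ) h2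
  have hrr : HasDerivAt (fun s : ℝ => NormedSpace.exp (s • D Y) * D X *
      NormedSpace.exp (s • (-D Y))) (D Y * D X - D X * D Y) 0 := by
    have h1 := ((hasDerivAt_exp_smul_zero (D Y)).mul_const (D X)).mul
      (hasDerivAt_exp_smul_zero (-D Y))
    exact h1.congr_deriv (by simp [sub_eq_add_neg])
  refine hl.unique (hrr.congr_of_eventuallyEq (Eventually.of_forall fun s => ?_))
  have h1 := hconj (expSU (s • (⟨Y, hY⟩ : suLie p q))) ⟨X, hX⟩
  have h2 : (expSU (s • (⟨Y, hY⟩ : suLie p q)))⁻¹ = expSU (s • (⟨-Y, neg_mem hY⟩ : suLie p q)) := by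
    rw [inv_eq_iff_mul_eq_one]
    refine suMat_injective ?_
    rw [suMat_mul, suMat_expSU, suMat_expSU, suMat_one]
    have := exp_mul_exp_neg (s • Y)
    rw [← smul_neg] at this
    exact this
  rw [h2, hA, hA, ← hDA, ← hDA] at h1
  simp only [map_neg] at h1
  exact h1

end Differential

/-! ### `SU(p,q)` is generated by exponentials -/

section Generation

open scoped Matrix.Norms.L2Operator ComplexOrder

variable {p q : ℕ}

theorem exists_skew_exp_eq {n : Type*} [Fintype n] [DecidableEq n] {u : Matrix n n ℂ}
    (hu : uᴴ * u = 1) : ∃ Y : Matrix n n ℂ, Yᴴ = -Y ∧ NormedSpace.exp Y = u ∧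
      ∀ J : Matrix n n ℂ, Jᴴ = J → Commute u J → Commute Y J := by
  have hu' : u * uᴴ = 1 := mul_eq_one_comm.1 hu
  have hun : IsStarNormal u := ⟨by
    rw [Matrix.star_eq_conjTranspose, Commute, SemiconjBy, hu, hu']⟩
  have hmem : u ∈ unitary (Matrix n n ℂ) := Unitary.mem_iff.2 ⟨hu, hu'⟩
  have hfin : (spectrum ℂ u).Finite := Matrix.finite_spectrum u
  set f : ℂ → ℂ := fun z => Complex.I * (Complex.arg z : ℂ) with hf
  have hfc : ContinuousOn f (spectrum ℂ u) := hfin.continuousOn f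
  have hnorm : ∀ z ∈ spectrum ℂ u, ‖z‖ = 1 := fun z hz => by
    simpa using spectrum.subset_circle_of_unitary hmem hz
  refine ⟨cfc f u, ?_, ?_, ?_⟩
  · rw [← Matrix.star_eq_conjTranspose, ← cfc_star, ← cfc_neg]
    congr 1
    funext z
    simp [hf]
  · have h1 : IsStarNormal (cfc f u) := cfc_predicate f u
    rw [← CFC.exp_eq_normedSpace_exp (𝕜 := ℂ), ← cfc_comp' _ f u]
    conv_rhs => rw [← cfc_id ℂ u]
    refine cfc_congr fun z hz => ?_
    have h2 := Complex.norm_mul_exp_arg_mul_I z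
    rw [hnorm z hz] at h2
    simp only [hf, id]
    rw [← Complex.exp_eq_exp_ℂ, mul_comm]
    simpa using h2
  · intro J hJ hc
    have h2 : Commute (star u) J := by
      have := hc.star_star
      rwa [Matrix.star_eq_conjTranspose J, hJ] at this
    exact hc.cfc h2 f

/-- The logarithm of the positive part of the polar decomposition of `g ∈ U(p,q)`. -/
theorem exists_hermitian_exp_sq_eq (g : SUpq p q) :
    ∃ X : Matrix (Fin p ⊕ Fin q) (Fin p ⊕ Fin q) ℂ, X.IsHermitian ∧
      NormedSpace.exp X * NormedSpace.exp X = (suMat g)ᴴ * suMat g ∧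
      X * sigMatrix p q ℂ = -(sigMatrix p q ℂ * X) := by
  set J := sigMatrix p q ℂ with hJ
  have hJJ : J * J = 1 := sigMatrix_mul_self p q ℂ
  set M := suMat g with hM
  have hform : Mᴴ * J * M = J := suMat_form g
  have hpd : (Mᴴ * M).PosDef := by
    refine Matrix.PosDef.conjTranspose_mul_self M ?_
    exact Matrix.mulVec_injective_of_isUnit
      ((Matrix.isUnit_iff_isUnit_det _).2 (by
        rw [show M.det = 1 from (g : Matrix.SpecialLinearGroup (Fin p ⊕ Fin q) ℂ).2]
        exact isUnit_one))
  have hMJ : M * J * Mᴴ = J := by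
    have h1 : (J * Mᴴ * J) * M = 1 := by
      rw [Matrix.mul_assoc, Matrix.mul_assoc, ← Matrix.mul_assoc Mᴴ, hform, hJJ]
    have h2 : M * (J * Mᴴ * J) = 1 := mul_eq_one_comm.1 h1
    calc M * J * Mᴴ = M * (J * Mᴴ * J) * J := by
          simp only [Matrix.mul_assoc, hJJ, Matrix.mul_one]
      _ = J := by rw [h2, Matrix.one_mul]
  have hhJ : (Mᴴ * M) * J * (Mᴴ * M) = J := by
    calc (Mᴴ * M) * J * (Mᴴ * M) = Mᴴ * (M * J * Mᴴ) * M := by simp only [Matrix.mul_assoc]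
      _ = J := by rw [hMJ, hform]
  have hH := hpd.1
  set U : Matrix (Fin p ⊕ Fin q) (Fin p ⊕ Fin q) ℂ := (hH.eigenvectorUnitary).1 with hU
  set d := hH.eigenvalues with hd
  have hdpos : ∀ i, 0 < d i := hpd.eigenvalues_pos
  have hUU : Uᴴ * U = 1 := (Unitary.mem_iff.1 hH.eigenvectorUnitary.2).1
  have hUU' : U * Uᴴ = 1 := (Unitary.mem_iff.1 hH.eigenvectorUnitary.2).2
  have hspec : Mᴴ * M = U * Matrix.diagonal (fun i => (d i : ℂ)) * Uᴴ := by
    conv_lhs => rw [hH.spectral_theorem, Unitary.conjStarAlgAut_apply]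
    rfl
  set ℓ : Fin p ⊕ Fin q → ℂ := fun i => ((Real.log (d i) / 2 : ℝ) : ℂ) with hℓ
  have hexp : ∀ i, Complex.exp (ℓ i) * Complex.exp (ℓ i) = d i := by
    intro i
    rw [← Complex.exp_add, hℓ]
    simp only
    rw [← Complex.ofReal_add, add_halves, ← Complex.ofReal_exp, Real.exp_log (hdpos i)]
  have hexpX : NormedSpace.exp (U * Matrix.diagonal ℓ * Uᴴ) =
      U * Matrix.diagonal (fun i => Complex.exp (ℓ i)) * Uᴴ := by
    have h1 : NormedSpace.exp (U * Matrix.diagonal ℓ * Uᴴ) * U =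
        U * NormedSpace.exp (Matrix.diagonal ℓ) :=
      exp_mul_eq_mul_exp (by rw [Matrix.mul_assoc, hUU, Matrix.mul_one])
    rw [Matrix.exp_diagonal] at h1
    have h2 : NormedSpace.exp ℓ = fun i => Complex.exp (ℓ i) := by
      funext i
      rw [Pi.coe_exp, Complex.exp_eq_exp_ℂ]
    rw [h2] at h1
    rw [← h1, Matrix.mul_assoc (NormedSpace.exp _), hUU', Matrix.mul_one]
  refine ⟨U * Matrix.diagonal ℓ * Uᴴ, ?_, ?_, ?_⟩
  · rw [Matrix.IsHermitian, Matrix.conjTranspose_mul, Matrix.conjTranspose_mul,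
      Matrix.conjTranspose_conjTranspose, Matrix.diagonal_conjTranspose, ← Matrix.mul_assoc]
    congr 3
    funext i
    simp [hℓ]
  · rw [hexpX, hspec]
    calc _ = U * Matrix.diagonal (fun i => Complex.exp (ℓ i)) * (Uᴴ * U) *
          Matrix.diagonal (fun i => Complex.exp (ℓ i)) * Uᴴ := by simp only [Matrix.mul_assoc]
      _ = U * (Matrix.diagonal (fun i => Complex.exp (ℓ i)) *
          Matrix.diagonal (fun i => Complex.exp (ℓ i))) * Uᴴ := by
          rw [hUU, Matrix.mul_one]; simp only [Matrix.mul_assoc]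
      _ = _ := by rw [Matrix.diagonal_mul_diagonal]; simp only [hexp]
  · -- in the eigenbasis, `h J h = J` says `d i * W i j * d j = W i j`
    set W := Uᴴ * J * U with hW
    have hJW : J = U * W * Uᴴ := by
      calc J = (U * Uᴴ) * J * (U * Uᴴ) := by rw [hUU', Matrix.one_mul, Matrix.mul_one]
        _ = _ := by simp only [hW, Matrix.mul_assoc]
    have h1 : Matrix.diagonal (fun i => (d i : ℂ)) * W * Matrix.diagonal (fun i => (d i : ℂ)) =
        W := by
      calc Matrix.diagonal (fun i => (d i : ℂ)) * W * Matrix.diagonal (fun i => (d i : ℂ))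
          = (Uᴴ * U) * Matrix.diagonal (fun i => (d i : ℂ)) * W *
            Matrix.diagonal (fun i => (d i : ℂ)) * (Uᴴ * U) := by
            rw [hUU, Matrix.one_mul, Matrix.mul_one]
        _ = Uᴴ * ((U * Matrix.diagonal (fun i => (d i : ℂ)) * Uᴴ) * J *
            (U * Matrix.diagonal (fun i => (d i : ℂ)) * Uᴴ)) * U := by
            simp only [hW, Matrix.mul_assoc]
        _ = W := by rw [← hspec, hhJ]
    have h2 : Matrix.diagonal ℓ * W = -(W * Matrix.diagonal ℓ) := by
      ext i j
      have h3 := congrFun (congrFun h1 i) j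
      rw [Matrix.mul_diagonal, Matrix.diagonal_mul] at h3
      rw [Matrix.neg_apply, Matrix.diagonal_mul, Matrix.mul_diagonal]
      by_cases hw : W i j = 0
      · simp [hw]
      · have h4 : (d i : ℂ) * d j = 1 := by
          have : ((d i : ℂ) * d j - 1) * W i j = 0 := by linear_combination h3
          have := (mul_eq_zero.1 this).resolve_right hw
          linear_combination this
        have h5 : d i * d j = 1 := by exact_mod_cast h4
        have h6 : Real.log (d i) + Real.log (d j) = 0 := by
          rw [← Real.log_mul (hdpos i).ne' (hdpos j).ne', h5, Real.log_one]
        have h7 : ℓ i + ℓ j = 0 := by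
          rw [hℓ]
          simp only
          rw [← Complex.ofReal_add]
          norm_cast
          linarith
        linear_combination W i j * h7
    rw [hJW]
    calc U * Matrix.diagonal ℓ * Uᴴ * (U * W * Uᴴ)
        = U * (Matrix.diagonal ℓ * (Uᴴ * U) * W) * Uᴴ := by simp only [Matrix.mul_assoc]
      _ = -(U * W * (Uᴴ * U) * Matrix.diagonal ℓ * Uᴴ) := by
          rw [hUU, Matrix.mul_one, h2, Matrix.mul_one, Matrix.mul_neg, Matrix.neg_mul]
          simp only [Matrix.mul_assoc]
      _ = _ := by simp only [Matrix.mul_assoc]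

/-- Every element of `SU(p,q)` is a product of exponentials. In the polar decomposition `g = k e^X`
the factor `e^X` is the exponential of an element of `su(p,q)`, and `k` is unitary and commutes with
the form, so `k = e^Y` with `Y ∈ u(p,q)`. As `det k = 1`, the trace of `Y` lies in `2πi ℤ`; a
diagonal element of `su(p,q)` corrects it to zero. -/
theorem closure_range_expSU (i₀ : Fin p ⊕ Fin q) :
    Subgroup.closure (Set.range (expSU : suLie p q → SUpq p q)) = ⊤ := by
  rw [Subgroup.eq_top_iff']
  intro g
  have hJJ := sigMatrix_mul_self p q ℂ
  obtain ⟨X, hXH, hXX, hXJ⟩ := exists_hermitian_exp_sq_eq g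
  have hX : X ∈ suLie p q := by
    refine mem_suLie.2 ⟨mem_uLie.2 (by rw [hXH.eq, hXJ]), ?_⟩
    have h1 : X.trace = -X.trace := by
      calc X.trace = (X * sigMatrix p q ℂ * sigMatrix p q ℂ).trace := by
            rw [Matrix.mul_assoc, hJJ, Matrix.mul_one]
        _ = -(sigMatrix p q ℂ * X * sigMatrix p q ℂ).trace := by
            rw [hXJ, Matrix.neg_mul, Matrix.trace_neg]
        _ = -X.trace := by
            rw [Matrix.trace_mul_comm, ← Matrix.mul_assoc, hJJ, Matrix.one_mul]
    linear_combination h1 / 2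
  have hmem : ∀ Z : suLie p q, expSU Z ∈ Subgroup.closure (Set.range (expSU : suLie p q → _)) :=
    fun Z => Subgroup.subset_closure ⟨Z, rfl⟩
  set x : suLie p q := ⟨X, hX⟩ with hx
  suffices hk : g * (expSU x)⁻¹ ∈ Subgroup.closure (Set.range (expSU : suLie p q → _)) by
    have := mul_mem hk (hmem x)
    rwa [inv_mul_cancel_right] at this
  set k := g * (expSU x)⁻¹ with hk
  set K := suMat k with hK
  have hEN : NormedSpace.exp X * suMat (expSU x)⁻¹ = 1 := suMat_mul_inv (expSU x)
  have hNE : suMat (expSU x)⁻¹ * NormedSpace.exp X = 1 := suMat_inv_mul (expSU x)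
  have hNH : (suMat (expSU x)⁻¹)ᴴ = suMat (expSU x)⁻¹ := by
    have h1 := congrArg Matrix.conjTranspose hNE
    rw [Matrix.conjTranspose_mul, (hXH.exp).eq, Matrix.conjTranspose_one] at h1
    exact (left_inv_eq_right_inv hNE h1).symm
  have hKK : Kᴴ * K = 1 := by
    rw [hK, hk, suMat_mul, Matrix.conjTranspose_mul, hNH]
    calc _ = suMat (expSU x)⁻¹ * ((suMat g)ᴴ * suMat g) * suMat (expSU x)⁻¹ := by
          simp only [Matrix.mul_assoc]
      _ = (suMat (expSU x)⁻¹ * NormedSpace.exp X) * (NormedSpace.exp X * suMat (expSU x)⁻¹) := by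
          rw [← hXX]; simp only [Matrix.mul_assoc]
      _ = 1 := by rw [hEN, hNE, Matrix.one_mul]
  have hKJ : Commute K (sigMatrix p q ℂ) := by
    have h1 : K * Kᴴ = 1 := mul_eq_one_comm.1 hKK
    have h2 : Kᴴ * sigMatrix p q ℂ * K = sigMatrix p q ℂ := suMat_form k
    calc K * sigMatrix p q ℂ = K * (Kᴴ * sigMatrix p q ℂ * K) := by rw [h2]
      _ = (K * Kᴴ) * sigMatrix p q ℂ * K := by simp only [Matrix.mul_assoc]
      _ = sigMatrix p q ℂ * K := by rw [h1, Matrix.one_mul]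
  obtain ⟨Y, hYH, hYK, hYJ⟩ := exists_skew_exp_eq hKK
  have hYJ := hYJ _ (sigMatrix_conjTranspose p q) hKJ
  have hdet : Complex.exp Y.trace = 1 := by
    rw [← det_exp_eq_exp_trace, hYK]
    exact (k : Matrix.SpecialLinearGroup (Fin p ⊕ Fin q) ℂ).2
  obtain ⟨a, ha⟩ := Complex.exp_eq_one_iff.1 hdet
  set N : ℂ := (Fintype.card (Fin p ⊕ Fin q) : ℂ) with hN
  have hN0 : N ≠ 0 := by
    rw [hN, Nat.cast_ne_zero]
    have : Nonempty (Fin p ⊕ Fin q) := ⟨i₀⟩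
    exact Fintype.card_ne_zero
  set b : ℂ := a * (2 * Real.pi * Complex.I) with hb
  have hstarb : star b = -b := by simp [hb]
  set c : ℂ := b / N with hc
  have hstarc : star c = -c := by
    rw [hc, star_div₀, hstarb, hN, star_natCast, neg_div]
  have hDu : ∀ v : Fin p ⊕ Fin q → ℂ, (∀ i, star (v i) = -v i) →
      Matrix.diagonal v ∈ uLie p q := by
    intro v hv
    rw [mem_uLie, Matrix.diagonal_conjTranspose, sigMatrix,
      LieAlgebra.Orthogonal.indefiniteDiagonal, Matrix.diagonal_mul_diagonal,
      Matrix.diagonal_mul_diagonal, Matrix.diagonal_neg]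
    congr 1
    funext i
    simp only [Pi.star_apply, hv]
    ring
  have hY1 : Y - Matrix.diagonal (fun _ => c) ∈ suLie p q := by
    refine mem_suLie.2 ⟨sub_mem ?_ (hDu _ fun _ => hstarc), ?_⟩
    · rw [mem_uLie, hYH, Matrix.neg_mul, hYJ.eq]
    · rw [Matrix.trace_sub, Matrix.trace_diagonal, Finset.sum_const, ha, nsmul_eq_mul,
        Finset.card_univ, ← hN, hc, mul_div_cancel₀ _ hN0, sub_self]
  have hW1 : Matrix.diagonal (fun i => c - if i = i₀ then b else 0) ∈ suLie p q := by
    refine mem_suLie.2 ⟨hDu _ fun i => ?_, ?_⟩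
    · rw [star_sub, hstarc]
      split_ifs
      · rw [hstarb]; ring
      · simp
    · rw [Matrix.trace_diagonal, Finset.sum_sub_distrib, Finset.sum_const, nsmul_eq_mul,
        Finset.card_univ, ← hN, hc, mul_div_cancel₀ _ hN0]
      simp
  have hfac : k = expSU ⟨_, hY1⟩ * expSU ⟨_, hW1⟩ := by
    refine suMat_injective ?_
    change K = NormedSpace.exp (Y - Matrix.diagonal fun _ => c) *
      NormedSpace.exp (Matrix.diagonal fun i => c - if i = i₀ then b else 0)
    rw [← hYK]
    have h1 : NormedSpace.exp (Matrix.diagonal (fun i => c - if i = i₀ then b else 0)) =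
        NormedSpace.exp (Matrix.diagonal (fun _ : Fin p ⊕ Fin q => c)) := by
      rw [Matrix.exp_diagonal, Matrix.exp_diagonal]
      congr 1
      funext i
      rw [Pi.coe_exp, Pi.coe_exp, ← Complex.exp_eq_exp_ℂ]
      split_ifs
      · rw [Complex.exp_sub, hb, Complex.exp_int_mul_two_pi_mul_I, div_one]
      · rw [sub_zero]
    have h2 : Commute (Y - Matrix.diagonal (fun _ => c)) (Matrix.diagonal (fun _ => c)) := by
      rw [show Matrix.diagonal (fun _ : Fin p ⊕ Fin q => c) = c • (1 : Matrix _ _ ℂ) by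
        rw [Matrix.smul_one_eq_diagonal]]
      exact (Commute.one_right _).smul_right c
    rw [h1, ← Matrix.exp_add_of_commute _ _ h2, sub_add_cancel]
  rw [hfac]
  exact mul_mem (hmem _) (hmem _)

end Generation

/-! ### Weight spaces of a semisimple element of an `sl₂`-triple -/

section Sl2

open Module

variable {V : Type*} [AddCommGroup V] [Module ℝ V]

theorem mem_maxGenEigenspace_shift {H T : End ℝ V} {c k : ℝ} (h : H * T - T * H = k • T) {v : V}
    (hv : v ∈ H.maxGenEigenspace c) : T v ∈ H.maxGenEigenspace (c + k) := by
  rw [End.mem_maxGenEigenspace] at hv ⊢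
  obtain ⟨m, hm⟩ := hv
  refine ⟨m, ?_⟩
  have h1 : (H - (c + k) • 1) * T = T * (H - c • 1) := by
    have h2 : H * T = T * H + k • T := by rw [← h]; abel
    rw [sub_mul, mul_sub, h2, smul_mul_assoc, mul_smul_comm, one_mul, mul_one, add_smul]
    abel
  have h2 : ∀ m : ℕ, (H - (c + k) • 1) ^ m * T = T * (H - c • 1) ^ m := by
    intro m
    induction m with
    | zero => simp
    | succ m ih => rw [pow_succ, mul_assoc, h1, ← mul_assoc, ih, mul_assoc, ← pow_succ]
  have h3 := congrArg (fun f : End ℝ V => f v) (h2 m)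
  simp only [End.mul_apply] at h3
  rw [h3, hm, map_zero]

/-- A nilpotent skew-adjoint operator vanishes on an invariant subspace where the form is
definite. -/
theorem skew_nilpotent_eq_zero {β : LinearMap.BilinForm ℝ V} {T : End ℝ V} (hT : IsNilpotent T)
    (hskew : ∀ v w, β (T v) w = -β v (T w)) {W : Submodule ℝ V} (hW : ∀ w ∈ W, T w ∈ W)
    (hdef : ∀ w ∈ W, β w w = 0 → w = 0) : ∀ w ∈ W, T w = 0 := by
  obtain ⟨N, hN⟩ := hT
  have key : ∀ k : ℕ, ∀ w ∈ W, (T ^ k) w = 0 → T w = 0 := by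
    intro k
    induction k with
    | zero => intro w _ h; simp_all
    | succ k ih =>
      intro w hw h
      rw [pow_succ, End.mul_apply] at h
      have h1 := ih _ (hW w hw) h
      refine hdef _ (hW w hw) ?_
      rw [hskew, h1, map_zero, neg_zero]
  exact fun w hw => key N w hw (by simp [hN])

theorem sl2_commutator_pow {H E F : End ℝ V} (hF : H * F - F * H = (-2 : ℝ) • F)
    (hEF : E * F - F * E = H) (m : ℕ) :
    E * F ^ (m + 1) = F ^ (m + 1) * E + ((m : ℝ) + 1) • (F ^ m * (H - (m : ℝ) • 1)) := by
  have hF' : H * F = F * H - (2 : ℝ) • F := by rw [sub_eq_iff_eq_add.1 hF]; module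
  have hEF' : E * F = F * E + H := by rw [← hEF]; abel
  induction m with
  | zero => simp [hEF']
  | succ m ih =>
    rw [pow_succ F (m + 1), ← mul_assoc, ih, add_mul, mul_assoc, hEF', smul_mul_assoc, mul_assoc,
      sub_mul, hF', smul_mul_assoc, one_mul]
    have h1 : F ^ m * (F * H - (2 : ℝ) • F - (m : ℝ) • F) =
        F ^ (m + 1) * (H - ((m : ℝ) + 2) • 1) := by
      rw [pow_succ, mul_assoc]
      congr 1
      rw [mul_sub, mul_smul_comm, mul_one]
      module
    rw [h1]
    push_cast
    simp only [mul_add, mul_sub, mul_smul_comm, mul_one, smul_sub, ← mul_assoc, ← pow_succ]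
    module

variable [FiniteDimensional ℝ V]

/-- Powers of `T` are eigenvectors of `ad H` with distinct eigenvalues, so only finitely many of
them are nonzero. -/
theorem isNilpotent_of_commutator_eq_smul {H T : End ℝ V} {c : ℝ} (hc : c ≠ 0)
    (h : H * T - T * H = c • T) : IsNilpotent T := by
  by_contra hT
  have hT : ∀ k : ℕ, T ^ k ≠ 0 := fun k hk => hT ⟨k, hk⟩
  have hk : ∀ k : ℕ, H * T ^ k - T ^ k * H = ((k : ℝ) * c) • T ^ k := by
    intro k
    induction k with
    | zero => simp
    | succ k ih =>
      have h1 : H * T ^ (k + 1) - T ^ (k + 1) * H =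
          (H * T ^ k - T ^ k * H) * T + T ^ k * (H * T - T * H) := by
        rw [pow_succ]; noncomm_ring
      rw [h1, ih, h, smul_mul_assoc, mul_smul_comm, ← pow_succ, ← add_smul]
      congr 1
      push_cast
      ring
  have hli : LinearIndependent ℝ (fun k : ℕ => T ^ k) :=
    End.eigenvectors_linearIndependent' (LinearMap.mulLeft ℝ H - LinearMap.mulRight ℝ H)
      (fun k : ℕ => (k : ℝ) * c) (fun a b hab => by
        have := mul_right_cancel₀ hc hab
        exact_mod_cast this) _ fun k => End.hasEigenvector_iff.2 ⟨by
          rw [End.mem_eigenspace_iff]; simpa using hk k, hT k⟩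
  have := hli.finite
  exact not_finite ℕ

theorem exists_mem_maxGenEigenspace_sub_smul {H : End ℝ V} {b c : ℝ} (hbc : c ≠ b) {v : V}
    (hv : v ∈ H.maxGenEigenspace b) : ∃ w ∈ H.maxGenEigenspace b, (H - c • 1) w = v := by
  set G := H.maxGenEigenspace b
  have hmaps : ∀ w ∈ G, (H - c • 1) w ∈ G := by
    intro w hw
    have h0 : H w ∈ G := by
      have := mem_maxGenEigenspace_shift (H := H) (T := H) (k := 0) (by simp) hw
      rwa [add_zero] at this
    simpa using sub_mem h0 (G.smul_mem c hw)
  have hinj : Function.Injective ((H - c • 1).restrict hmaps) := by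
    rw [← LinearMap.ker_eq_bot, LinearMap.ker_eq_bot']
    rintro ⟨w, hw⟩ h
    have h1 : (H - c • 1) w = 0 := congrArg Subtype.val h
    have h2 : w ∈ H.maxGenEigenspace c := End.mem_maxGenEigenspace _ _ _ |>.2 ⟨1, by simpa using h1⟩
    have h3 := (End.disjoint_genEigenspace H hbc ⊤ ⊤).le_bot ⟨h2, hw⟩
    exact Subtype.ext h3
  obtain ⟨⟨w, hw⟩, h⟩ := LinearMap.surjective_of_injective hinj ⟨v, hv⟩
  exact ⟨w, hw, congrArg Subtype.val h⟩

theorem mem_iSup_maxGenEigenspace_of_sub_smul {H : End ℝ V} (c : ℝ) {v : V}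
    (hv : (H - c • 1) v ∈ ⨆ a, H.maxGenEigenspace a) : v ∈ ⨆ a, H.maxGenEigenspace a := by
  have key : ∀ y ∈ ⨆ a, H.maxGenEigenspace a, ∃ t ∈ ⨆ a, H.maxGenEigenspace a,
      ∃ z ∈ H.maxGenEigenspace c, y = (H - c • 1) t + z := by
    intro y hy
    induction hy using Submodule.iSup_induction' with
    | mem b x hx =>
      by_cases hbc : c = b
      · subst hbc
        exact ⟨0, zero_mem _, x, hx, by simp⟩
      · obtain ⟨t, ht, h⟩ := exists_mem_maxGenEigenspace_sub_smul hbc hx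
        exact ⟨t, Submodule.mem_iSup_of_mem b ht, 0, zero_mem _, by simp [← h]⟩
    | zero => exact ⟨0, zero_mem _, 0, zero_mem _, by simp⟩
    | add x y _ _ hx hy =>
      obtain ⟨t, ht, z, hz, h⟩ := hx
      obtain ⟨t', ht', z', hz', h'⟩ := hy
      exact ⟨t + t', add_mem ht ht', z + z', add_mem hz hz', by rw [h, h', map_add]; abel⟩
  obtain ⟨t, ht, z, hz, h⟩ := key _ hv
  have h1 : (H - c • 1) (v - t) = z := by rw [map_sub, h]; abel
  have h2 : v - t ∈ H.maxGenEigenspace c := by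
    rw [End.mem_maxGenEigenspace] at hz ⊢
    obtain ⟨m, hm⟩ := hz
    exact ⟨m + 1, by rw [pow_succ, End.mul_apply, h1, hm]⟩
  have := add_mem (Submodule.mem_iSup_of_mem c h2) ht
  rwa [sub_add_cancel] at this

/-- In a finite-dimensional real representation of `sl₂`, the operator `H` is triangularizable over
`ℝ`. A vector outside the sum `S` of the generalized eigenspaces could be chosen to be killed by
`E` and by a minimal power `F ^ (m + 1)` modulo `S`, and then `(H - m) v` would contradict
minimality. -/
theorem sl2_iSup_maxGenEigenspace {H E F : End ℝ V} (hE : H * E - E * H = (2 : ℝ) • E)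
    (hF : H * F - F * H = (-2 : ℝ) • F) (hEF : E * F - F * E = H) :
    ⨆ a, H.maxGenEigenspace a = ⊤ := by
  set S := ⨆ a, H.maxGenEigenspace a with hS
  have hstab : ∀ (T : End ℝ V) (k : ℝ), H * T - T * H = k • T → ∀ v ∈ S, T v ∈ S := by
    intro T k hT v hv
    have : S ≤ S.comap T := iSup_le fun a x hx =>
      Submodule.mem_iSup_of_mem (a + k) (mem_maxGenEigenspace_shift hT hx)
    exact this hv
  have hSE := hstab E 2 hE
  have hSF := hstab F (-2) hF
  have hSH := hstab H 0 (by simp)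
  obtain ⟨N, hN⟩ := isNilpotent_of_commutator_eq_smul (by norm_num) hF
  obtain ⟨M, hM⟩ := isNilpotent_of_commutator_eq_smul (by norm_num) hE
  have key : ∀ m : ℕ, ∀ v, E v ∈ S → (F ^ m) v ∈ S → v ∈ S := by
    intro m
    induction m with
    | zero => intro v _ h; simpa using h
    | succ m ih =>
      intro v hv h
      have h1 := congrArg (fun f : End ℝ V => f v) (sl2_commutator_pow hF hEF m)
      simp only [End.mul_apply, LinearMap.add_apply, LinearMap.smul_apply] at h1
      have hFE : ∀ k, (F ^ k) (E v) ∈ S := by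
        intro k
        induction k with
        | zero => simpa using hv
        | succ k ihk => rw [pow_succ', End.mul_apply]; exact hSF _ ihk
      have h2 : ((m : ℝ) + 1) • (F ^ m) ((H - (m : ℝ) • 1) v) ∈ S := by
        have h3 := hSE _ h
        rw [h1] at h3
        exact (Submodule.add_mem_iff_right _ (hFE _)).1 h3
      have h3 : (F ^ m) ((H - (m : ℝ) • 1) v) ∈ S :=
        (Submodule.smul_mem_iff _ (by positivity)).1 h2
      refine mem_iSup_maxGenEigenspace_of_sub_smul (m : ℝ) (ih _ ?_ h3)
      have h4 : E ((H - (m : ℝ) • 1) v) = H (E v) - ((m : ℝ) + 2) • E v := by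
        have h5 := congrArg (fun f : End ℝ V => f v) hE
        simp only [End.mul_apply, LinearMap.sub_apply, LinearMap.smul_apply] at h5
        simp only [LinearMap.sub_apply, LinearMap.smul_apply, map_sub, map_smul, End.one_apply,
          add_smul, ← h5]
        abel
      rw [h4]
      exact sub_mem (hSH _ hv) (S.smul_mem _ hv)
  have hEk : ∀ k : ℕ, ∀ v, (E ^ k) v ∈ S → v ∈ S := by
    intro k
    induction k with
    | zero => intro v h; simpa using h
    | succ k ih =>
      intro v h
      rw [pow_succ, End.mul_apply] at h
      exact key N v (ih _ h) (by simp [hN])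
  rw [Submodule.eq_top_iff']
  exact fun v => hEk M v (by simp [hM])

/-- Generalized eigenspaces of a skew-adjoint operator are orthogonal unless the eigenvalues are
opposite. -/
theorem maxGenEigenspace_orthogonal {β : LinearMap.BilinForm ℝ V} {H : End ℝ V}
    (hH : ∀ v w, β (H v) w = -β v (H w)) {a b : ℝ} (hab : a + b ≠ 0) {v w : V}
    (hv : v ∈ H.maxGenEigenspace a) (hw : w ∈ H.maxGenEigenspace b) : β v w = 0 := by
  rw [End.mem_maxGenEigenspace] at hv
  obtain ⟨k, hk⟩ := hv
  induction k generalizing v w with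
  | zero => simp_all
  | succ k ih =>
    obtain ⟨w', hw', h⟩ := exists_mem_maxGenEigenspace_sub_smul (c := -a)
      (fun h => hab (by rw [← h]; ring)) hw
    have h1 := ih hw' (v := (H - a • 1) v) (by rwa [pow_succ, End.mul_apply] at hk)
    rw [← h]
    simp only [LinearMap.sub_apply, LinearMap.smul_apply, End.one_apply, map_sub, map_smul,
      smul_eq_mul, hH] at h1 ⊢
    linarith

end Sl2

/-! ### The grading of `u(2,2)` by its conformal structure -/

section Grading

/-- `B ↦ ½ [[iB, -iB], [iB, -iB]]`: for Hermitian `B`, the part of degree `2` of `u(2,2)`, i.e. the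
translations when `U(2,2)` is viewed as the conformal group of the Minkowski space of Hermitian
`2 × 2` matrices. -/
noncomputable def eMat :
    Matrix (Fin 2) (Fin 2) ℂ →ₗ[ℝ] Matrix (Fin 2 ⊕ Fin 2) (Fin 2 ⊕ Fin 2) ℂ where
  toFun B := (Complex.I / 2) • Matrix.fromBlocks B (-B) B (-B)
  map_add' B C := by
    rw [← smul_add, Matrix.fromBlocks_add, neg_add]
  map_smul' c B := by
    rw [RingHom.id_apply, smul_comm c (Complex.I / 2) (Matrix.fromBlocks _ _ _ _),
      Matrix.fromBlocks_smul c, smul_neg]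

/-- `C ↦ ½ [[-iC, -iC], [iC, iC]]`: for Hermitian `C`, the part of degree `-2` of `u(2,2)`. -/
noncomputable def fMat :
    Matrix (Fin 2) (Fin 2) ℂ →ₗ[ℝ] Matrix (Fin 2 ⊕ Fin 2) (Fin 2 ⊕ Fin 2) ℂ where
  toFun C := (Complex.I / 2) • Matrix.fromBlocks (-C) (-C) C C
  map_add' B C := by
    rw [← smul_add, Matrix.fromBlocks_add, neg_add]
  map_smul' c B := by
    rw [RingHom.id_apply, smul_comm c (Complex.I / 2) (Matrix.fromBlocks _ _ _ _),
      Matrix.fromBlocks_smul c, smul_neg]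

/-- `A ↦ ½ [[A - A*, A + A*], [A + A*, A - A*]]`: the part of degree `0` of `u(2,2)`, a copy of
`gl(2,ℂ)`. -/
noncomputable def lMat :
    Matrix (Fin 2) (Fin 2) ℂ →ₗ[ℝ] Matrix (Fin 2 ⊕ Fin 2) (Fin 2 ⊕ Fin 2) ℂ where
  toFun A := (1 / 2 : ℂ) • Matrix.fromBlocks (A - Aᴴ) (A + Aᴴ) (A + Aᴴ) (A - Aᴴ)
  map_add' B C := by
    rw [← smul_add, Matrix.fromBlocks_add, Matrix.conjTranspose_add]
    congr 2 <;> abel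
  map_smul' c B := by
    rw [RingHom.id_apply, smul_comm c (1 / 2 : ℂ) (Matrix.fromBlocks _ _ _ _),
      Matrix.fromBlocks_smul c, Matrix.conjTranspose_smul, star_trivial, smul_sub, smul_add]

theorem sigMatrix_eq_fromBlocks (p q : ℕ) (R : Type*) [CommRing R] :
    sigMatrix p q R = Matrix.fromBlocks 1 0 0 (-1) := by
  ext i j
  rcases i with i | i <;> rcases j with j | j <;>
    simp [LieAlgebra.Orthogonal.indefiniteDiagonal, Matrix.diagonal_apply, Matrix.one_apply, neg_ite]

theorem eMat_mem {B : Matrix (Fin 2) (Fin 2) ℂ} (hB : B.IsHermitian) : eMat B ∈ suLie 2 2 := by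
  refine mem_suLie.2 ⟨mem_uLie.2 ?_, ?_⟩
  · simp [eMat, sigMatrix_eq_fromBlocks, Matrix.fromBlocks_conjTranspose,
      Matrix.fromBlocks_multiply, hB.eq, ← smul_neg, Matrix.fromBlocks_neg]
    rw [neg_div, neg_smul, ← smul_neg, Matrix.fromBlocks_neg]
    simp
  · simp [eMat, Matrix.trace, Fintype.sum_sum_type]

theorem fMat_mem {C : Matrix (Fin 2) (Fin 2) ℂ} (hC : C.IsHermitian) : fMat C ∈ suLie 2 2 := by
  refine mem_suLie.2 ⟨mem_uLie.2 ?_, ?_⟩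
  · simp [fMat, sigMatrix_eq_fromBlocks, Matrix.fromBlocks_conjTranspose,
      Matrix.fromBlocks_multiply, hC.eq, ← smul_neg, Matrix.fromBlocks_neg]
    rw [neg_div, neg_smul, ← smul_neg, Matrix.fromBlocks_neg]
    simp
  · simp [fMat, Matrix.trace, Fintype.sum_sum_type]

theorem lMat_mem (A : Matrix (Fin 2) (Fin 2) ℂ) : lMat A ∈ uLie 2 2 := by
  rw [mem_uLie]
  simp [lMat, sigMatrix_eq_fromBlocks, Matrix.fromBlocks_conjTranspose,
      Matrix.fromBlocks_multiply, ← smul_neg, Matrix.fromBlocks_neg, add_comm]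

theorem lMat_I : lMat (Complex.I • 1) = Complex.I • 1 := by
  rw [← Matrix.fromBlocks_one]
  simp only [lMat, LinearMap.coe_mk, AddHom.coe_mk, Matrix.fromBlocks_smul, Matrix.conjTranspose_smul,
    Matrix.conjTranspose_one, smul_zero]
  congr 1 <;> simp <;> module

variable {B C : Matrix (Fin 2) (Fin 2) ℂ}

theorem eMat_fMat_commutator (hB : B.IsHermitian) (hC : C.IsHermitian) :
    eMat B * fMat C - fMat C * eMat B = lMat (B * C) := by
  simp only [eMat, fMat, lMat, LinearMap.coe_mk, AddHom.coe_mk, smul_mul_assoc, mul_smul_comm,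
    smul_smul, Matrix.fromBlocks_multiply, Matrix.conjTranspose_mul, hB.eq, hC.eq]
  rw [← smul_sub, sub_eq_add_neg, Matrix.fromBlocks_neg, Matrix.fromBlocks_add]
  rw [show Complex.I / 2 * (Complex.I / 2) = (1 / 2 : ℂ) * (-(1 / 2)) by
    linear_combination Complex.I_mul_I / 4, ← smul_smul, Matrix.fromBlocks_smul]
  congr 2 <;> simp only [Matrix.mul_neg, Matrix.neg_mul] <;> module

theorem lMat_eMat_commutator (A B : Matrix (Fin 2) (Fin 2) ℂ) :
    lMat A * eMat B - eMat B * lMat A = eMat (A * B + B * Aᴴ) := by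
  simp only [eMat, lMat, LinearMap.coe_mk, AddHom.coe_mk, smul_mul_assoc, mul_smul_comm,
    smul_smul, Matrix.fromBlocks_multiply]
  rw [mul_comm (1 / 2 : ℂ), ← smul_sub, sub_eq_add_neg, Matrix.fromBlocks_neg,
    Matrix.fromBlocks_add, ← smul_smul, Matrix.fromBlocks_smul]
  congr 2 <;> simp only [Matrix.mul_neg, Matrix.neg_mul, Matrix.add_mul, Matrix.mul_add,
    Matrix.sub_mul, Matrix.mul_sub] <;> module

theorem lMat_fMat_commutator (A C : Matrix (Fin 2) (Fin 2) ℂ) :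
    lMat A * fMat C - fMat C * lMat A = -fMat (Aᴴ * C + C * A) := by
  simp only [fMat, lMat, LinearMap.coe_mk, AddHom.coe_mk, smul_mul_assoc, mul_smul_comm,
    smul_smul, Matrix.fromBlocks_multiply]
  rw [mul_comm (1 / 2 : ℂ), ← smul_sub, sub_eq_add_neg, Matrix.fromBlocks_neg,
    Matrix.fromBlocks_add, ← smul_smul, Matrix.fromBlocks_smul, ← smul_neg, Matrix.fromBlocks_neg]
  congr 2 <;> simp only [Matrix.mul_neg, Matrix.neg_mul, Matrix.add_mul, Matrix.mul_add,
    Matrix.sub_mul, Matrix.mul_sub] <;> module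

theorem lMat_lMat_commutator (A B : Matrix (Fin 2) (Fin 2) ℂ) :
    lMat A * lMat B - lMat B * lMat A = lMat (A * B - B * A) := by
  simp only [lMat, LinearMap.coe_mk, AddHom.coe_mk, smul_mul_assoc, mul_smul_comm,
    smul_smul, Matrix.fromBlocks_multiply, Matrix.conjTranspose_sub, Matrix.conjTranspose_mul]
  rw [← smul_sub, sub_eq_add_neg, Matrix.fromBlocks_neg,
    Matrix.fromBlocks_add, ← smul_smul, Matrix.fromBlocks_smul]
  congr 2 <;> simp only [Matrix.add_mul, Matrix.mul_add, Matrix.sub_mul, Matrix.mul_sub] <;> module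

/-- A real subspace containing the parts of degree `±2` and closed under commutators of elements of
`u(2,2)` contains `su(2,2)`. -/
theorem suLie_le_of_eMat_fMat_mem {S : Submodule ℝ (Matrix (Fin 2 ⊕ Fin 2) (Fin 2 ⊕ Fin 2) ℂ)}
    (he : ∀ B : Matrix (Fin 2) (Fin 2) ℂ, B.IsHermitian → eMat B ∈ S)
    (hf : ∀ C : Matrix (Fin 2) (Fin 2) ℂ, C.IsHermitian → fMat C ∈ S)
    (hS : ∀ X ∈ uLie 2 2, ∀ Y ∈ uLie 2 2, X ∈ S → Y ∈ S → X * Y - Y * X ∈ S) :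
    suLie 2 2 ≤ S := by
  have hl : ∀ B C : Matrix (Fin 2) (Fin 2) ℂ, B.IsHermitian → C.IsHermitian → lMat (B * C) ∈ S :=
    fun B C hB hC => by
      rw [← eMat_fMat_commutator hB hC]
      exact hS _ (mem_suLie.1 (eMat_mem hB)).1 _ (mem_suLie.1 (fMat_mem hC)).1 (he B hB) (hf C hC)
  have hlA : ∀ A : Matrix (Fin 2) (Fin 2) ℂ, A.trace.im = 0 → lMat A ∈ S := by
    intro A hA
    have h1 : A = Matrix.of ![![0, A 0 1], ![star (A 0 1), 0]] * Matrix.of ![![0, 0], ![0, 1]] +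
        Matrix.of ![![0, star (A 1 0)], ![A 1 0, 0]] * Matrix.of ![![1, 0], ![0, 0]] +
        Matrix.of ![![((A 0 0).re : ℂ), 0], ![0, ((A 1 1).re : ℂ)]] * 1 +
        (A 0 0).im • (Matrix.of ![![0, 1], ![1, 0]] *
          Matrix.of ![![0, -Complex.I], ![Complex.I, 0]]) := by
      rw [Matrix.trace_fin_two, Complex.add_im] at hA
      ext i j
      fin_cases i <;> fin_cases j <;> apply Complex.ext <;>
        simp
      linarith
    rw [h1, map_add, map_add, map_add, map_smul]
    have herm : ∀ (a d : ℝ) (z : ℂ),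
        (Matrix.of ![![(a : ℂ), z], ![star z, (d : ℂ)]]).IsHermitian := by
      intro a d z
      ext i j
      fin_cases i <;> fin_cases j <;> simp
    refine add_mem (add_mem (add_mem (hl _ _ ?_ ?_) (hl _ _ ?_ ?_)) (hl _ _ ?_ ?_))
      (S.smul_mem _ (hl _ _ ?_ ?_))
    · simpa using herm 0 0 (A 0 1)
    · simpa using herm 0 1 0
    · simpa using herm 0 0 (star (A 1 0))
    · simpa using herm 1 0 0
    · simpa using herm (A 0 0).re (A 1 1).re 0
    · exact Matrix.isHermitian_one
    · simpa using herm 0 0 1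
    · simpa using herm 0 0 (-Complex.I)
  intro X hX
  obtain ⟨hX, ht⟩ := mem_suLie.1 hX
  obtain ⟨a, b, c, d, rfl⟩ : ∃ a b c d, X = Matrix.fromBlocks a b c d :=
    ⟨_, _, _, _, (Matrix.fromBlocks_toBlocks X).symm⟩
  rw [mem_uLie, sigMatrix_eq_fromBlocks, Matrix.fromBlocks_conjTranspose,
    Matrix.fromBlocks_multiply, Matrix.fromBlocks_multiply, Matrix.fromBlocks_neg,
    Matrix.fromBlocks_inj] at hX
  simp only [Matrix.mul_one, Matrix.mul_zero, Matrix.one_mul, Matrix.zero_mul, add_zero, zero_add,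
    Matrix.mul_neg, Matrix.neg_mul, neg_neg, neg_inj] at hX
  obtain ⟨ha, hcb, hbc, hd⟩ := hX
  have hd : dᴴ = -d := by rw [← neg_eq_iff_eq_neg, hd]
  have hT : (a + d).trace = 0 := by
    rw [Matrix.trace_add]
    simpa [Matrix.trace, Fintype.sum_sum_type] using ht
  set A : Matrix (Fin 2) (Fin 2) ℂ := (1 / 2 : ℂ) • (a + d + (b + bᴴ)) with hA
  set B : Matrix (Fin 2) (Fin 2) ℂ := (Complex.I / 2) • (d - a + (b - bᴴ)) with hB
  set C : Matrix (Fin 2) (Fin 2) ℂ := (Complex.I / 2) • (a - d + (b - bᴴ)) with hC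
  have hBh : B.IsHermitian := by
    rw [Matrix.IsHermitian, hB]
    simp only [Matrix.conjTranspose_smul, Matrix.conjTranspose_add, Matrix.conjTranspose_sub, ha,
      hd, Matrix.conjTranspose_conjTranspose, star_div₀, Complex.star_def, Complex.conj_I, map_ofNat]
    module
  have hCh : C.IsHermitian := by
    rw [Matrix.IsHermitian, hC]
    simp only [Matrix.conjTranspose_smul, Matrix.conjTranspose_add, Matrix.conjTranspose_sub, ha,
      hd, Matrix.conjTranspose_conjTranspose, star_div₀, Complex.star_def, Complex.conj_I, map_ofNat]
    module
  have hAt : A.trace.im = 0 := by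
    rw [hA, Matrix.trace_smul, Matrix.trace_add, hT, zero_add, Matrix.trace_add,
      Matrix.trace_conjTranspose]
    simp
  have hsum : Matrix.fromBlocks a b c d = lMat A + eMat B + fMat C := by
    simp only [lMat, eMat, fMat, LinearMap.coe_mk, AddHom.coe_mk, Matrix.fromBlocks_smul,
      Matrix.fromBlocks_add]
    have hI : Complex.I / 2 * (Complex.I / 2) = -(1 / 4) := by
      linear_combination Complex.I_mul_I / 4
    congr 1 <;> simp only [hA, hB, hC, Matrix.conjTranspose_smul, Matrix.conjTranspose_add, ha, hd,
      Matrix.conjTranspose_conjTranspose, star_div₀, star_one, star_ofNat, smul_neg, smul_smul, hI,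
      ← hbc] <;> module
  rw [hsum]
  exact add_mem (add_mem (hlA A hAt) (he B hBh)) (hf C hCh)

end Grading

/-! ### Orthogonal representations of `su(2,2)` on a space of signature `(2,n)` -/

section SmallRepresentations

open Module

/-- In dimension at most two the commuting nilpotent operators `x`, `x'` are proportional, and an
operator `h'` rotating the plane they span forces both to vanish. -/
theorem eq_zero_of_rotated_nilpotents {M : Type*} [AddCommGroup M] [Module ℝ M]
    [FiniteDimensional ℝ M] (hM : finrank ℝ M ≤ 2) {x x' h h' : End ℝ M}
    (hx : h * x - x * h = (2 : ℝ) • x) (hx' : h * x' - x' * h = (2 : ℝ) • x')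
    (hr : h' * x - x * h' = (2 : ℝ) • x') (hr' : h' * x' - x' * h' = (-2 : ℝ) • x)
    (hc : x * x' = x' * x) : x = 0 := by
  obtain ⟨N', hN'⟩ := isNilpotent_of_commutator_eq_smul two_ne_zero hx'
  have hsq : x ^ 2 = 0 := by
    have h1 := (isNilpotent_of_commutator_eq_smul two_ne_zero hx).charpoly_eq_X_pow_finrank
    have h2 := x.aeval_self_charpoly
    rw [h1, map_pow, Polynomial.aeval_X] at h2
    exact pow_eq_zero_of_le hM h2
  by_contra hx0
  obtain ⟨v, hv⟩ : ∃ v, x v ≠ 0 := by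
    by_contra! hcon
    exact hx0 (LinearMap.ext hcon)
  have hxx : x (x v) = 0 := by
    have := LinearMap.congr_fun hsq v
    rwa [pow_two, End.mul_apply] at this
  have hli : LinearIndependent ℝ ![v, x v] := by
    rw [LinearIndependent.pair_iff]
    intro s t hst
    have h1 := congrArg x hst
    rw [map_add, map_smul, map_smul, hxx, smul_zero, add_zero, map_zero] at h1
    have hs := (smul_eq_zero.1 h1).resolve_right hv
    rw [hs, zero_smul, zero_add] at hst
    exact ⟨hs, (smul_eq_zero.1 hst).resolve_right hv⟩
  have hspan : ∀ u, ∃ a b : ℝ, a • v + b • x v = u := by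
    intro u
    have h1 := hli.span_eq_top_of_card_eq_finrank'
      (le_antisymm (by simpa using hli.fintype_card_le_finrank) (by simpa using hM))
    have h2 : u ∈ Submodule.span ℝ (Set.range ![v, x v]) := h1 ▸ Submodule.mem_top
    rw [Matrix.range_cons, Matrix.range_cons, Matrix.range_empty, Set.union_empty,
      Set.singleton_union] at h2
    exact Submodule.mem_span_pair.1 h2
  obtain ⟨a, b, hab⟩ := hspan (x' v)
  have hxx' : x' (x v) = a • x v := by
    rw [← End.mul_apply, ← hc, End.mul_apply, ← hab, map_add, map_smul, map_smul, hxx, smul_zero,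
      add_zero]
  have ha : a = 0 := by
    have h1 : ∀ k : ℕ, (x' ^ k) (x v) = a ^ k • x v := by
      intro k
      induction k with
      | zero => simp
      | succ k ih => rw [pow_succ, End.mul_apply, hxx', map_smul, ih, smul_smul, pow_succ']
    have h2 := h1 N'
    rw [hN', LinearMap.zero_apply] at h2
    exact eq_zero_of_pow_eq_zero ((smul_eq_zero.1 h2.symm).resolve_right hv)
  have hb : x' = b • x := by
    refine LinearMap.ext fun u => ?_
    obtain ⟨c, d, rfl⟩ := hspan u
    simp only [map_add, map_smul, LinearMap.smul_apply, hxx', hxx, ← hab, ha, zero_smul, zero_add,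
      smul_zero, add_zero]
  have h3 : (b ^ 2 + 1) • x = 0 := by
    have h4 : h' * x' - x' * h' = b • (h' * x - x * h') := by
      rw [hb, mul_smul_comm, smul_mul_assoc, smul_sub]
    rw [hr', hr, hb, smul_smul, smul_smul] at h4
    have h5 : (2 * (b ^ 2 + 1)) • x = 0 := by
      rw [show 2 * (b ^ 2 + 1) = b * 2 * b - (-2) by ring, sub_smul, ← h4, sub_self]
    rw [mul_smul] at h5
    exact (smul_eq_zero.1 h5).resolve_left two_ne_zero
  exact hx0 ((smul_eq_zero.1 h3).resolve_left (by positivity))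

/-- The upper triangular elementary matrix of `sl(2,ℂ)`, with a complex scalar. -/
def upMat (z : ℂ) : Matrix (Fin 2) (Fin 2) ℂ := Matrix.of ![![0, z], ![0, 0]]

/-- The lower triangular elementary matrix of `sl(2,ℂ)`, with a complex scalar. -/
def downMat (z : ℂ) : Matrix (Fin 2) (Fin 2) ℂ := Matrix.of ![![0, 0], ![z, 0]]

/-- The diagonal element `diag(1, -1)` of `sl(2,ℂ)`, with a complex scalar. -/
def diagMat (z : ℂ) : Matrix (Fin 2) (Fin 2) ℂ := Matrix.of ![![z, 0], ![0, -z]]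

theorem isHermitian_diagMat_one : (diagMat 1).IsHermitian := by
  ext i j
  fin_cases i <;> fin_cases j <;> simp [diagMat]

theorem diagMat_one_mul_self : diagMat 1 * diagMat 1 = 1 := by
  ext i j
  fin_cases i <;> fin_cases j <;> simp [diagMat]

theorem trace_diagMat (z : ℂ) : (diagMat z).trace = 0 := by
  simp [diagMat, Matrix.trace_fin_two]

/-- The simple real Lie algebra `sl(2,ℂ)` acts trivially on a real space of dimension at most
two. -/
theorem sl2C_eq_zero_of_finrank_le_two {M : Type*} [AddCommGroup M] [Module ℝ M]
    [FiniteDimensional ℝ M] (hM : finrank ℝ M ≤ 2)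
    (L : Matrix (Fin 2) (Fin 2) ℂ →ₗ[ℝ] End ℝ M)
    (hL : ∀ A B, L A * L B - L B * L A = L (A * B - B * A)) (A : Matrix (Fin 2) (Fin 2) ℂ)
    (hA : A.trace = 0) : L A = 0 := by
  have hdu : ∀ z w, diagMat z * upMat w - upMat w * diagMat z = (2 : ℝ) • upMat (z * w) := by
    intro z w
    ext i j
    fin_cases i <;> fin_cases j <;> simp [diagMat, upMat]; ring
  have hdd : ∀ z w, diagMat z * downMat w - downMat w * diagMat z =
      (2 : ℝ) • downMat (-(z * w)) := by
    intro z w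
    ext i j
    fin_cases i <;> fin_cases j <;> simp [diagMat, downMat]; ring
  have hud : ∀ z w, upMat z * downMat w - downMat w * upMat z = diagMat (z * w) := by
    intro z w
    ext i j
    fin_cases i <;> fin_cases j <;> simp [diagMat, downMat, upMat]; ring
  have huu : ∀ z w, upMat z * upMat w = 0 := by
    intro z w
    ext i j
    fin_cases i <;> fin_cases j <;> simp [upMat]
  have hdd' : ∀ z w, downMat z * downMat w = 0 := by
    intro z w
    ext i j
    fin_cases i <;> fin_cases j <;> simp [downMat]
  have hupneg : upMat (-1) = -upMat 1 := by
    ext i j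
    fin_cases i <;> fin_cases j <;> simp [upMat]
  have hdownneg : downMat (-1) = -downMat 1 := by
    ext i j
    fin_cases i <;> fin_cases j <;> simp [downMat]
  have hu : ∀ z, L (upMat z) = 0 := by
    have h1 : L (upMat 1) = 0 := by
      refine eq_zero_of_rotated_nilpotents hM (x' := L (upMat Complex.I)) (h := L (diagMat 1))
        (h' := L (diagMat Complex.I)) ?_ ?_ ?_ ?_ ?_
      · rw [hL, hdu, map_smul, mul_one]
      · rw [hL, hdu, map_smul, one_mul]
      · rw [hL, hdu, map_smul, mul_one]
      · rw [hL, hdu, map_smul, Complex.I_mul_I, hupneg, map_neg, smul_neg, neg_smul]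
      · rw [← sub_eq_zero, hL, huu, huu, sub_self, map_zero]
    intro z
    have h2 := hdu (z / 2) 1
    rw [mul_one] at h2
    have h3 : upMat z = (2 : ℝ) • upMat (z / 2) := by
      ext i j
      fin_cases i <;> fin_cases j <;> simp [upMat]
      ring
    rw [h3, ← h2, ← hL, h1, mul_zero, zero_mul, sub_self]
  have hd : ∀ z, L (downMat z) = 0 := by
    have h1 : L (downMat 1) = 0 := by
      refine eq_zero_of_rotated_nilpotents hM (x' := L (downMat Complex.I)) (h := L (diagMat (-1)))
        (h' := L (diagMat (-Complex.I))) ?_ ?_ ?_ ?_ ?_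
      · rw [hL, hdd, map_smul, mul_one, neg_neg]
      · rw [hL, hdd, map_smul, neg_one_mul, neg_neg]
      · rw [hL, hdd, map_smul, mul_one, neg_neg]
      · rw [hL, hdd, map_smul, neg_mul, neg_neg, Complex.I_mul_I, hdownneg, map_neg, smul_neg,
          neg_smul]
      · rw [← sub_eq_zero, hL, hdd', hdd', sub_self, map_zero]
    intro z
    have h2 := hdd (-z / 2) 1
    rw [mul_one] at h2
    have h3 : downMat z = (2 : ℝ) • downMat (-(-z / 2)) := by
      ext i j
      fin_cases i <;> fin_cases j <;> simp [downMat]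
      ring
    rw [h3, ← h2, ← hL, h1, mul_zero, zero_mul, sub_self]
  have hA' : A = upMat (A 0 1) + downMat (A 1 0) + (upMat (A 0 0) * downMat 1 -
      downMat 1 * upMat (A 0 0)) := by
    rw [hud, mul_one]
    rw [Matrix.trace_fin_two] at hA
    ext i j
    fin_cases i <;> fin_cases j <;> simp [upMat, downMat, diagMat]
    linear_combination hA
  rw [hA', map_add, map_add, hu, hd, ← hL, hu, hd]
  simp

end SmallRepresentations

section OrthogonalRepresentations

open Module

variable {V : Type*} [AddCommGroup V] [Module ℝ V]

/-- A nondegenerate symmetric bilinear form with positive index at most two. -/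
structure IsIndexTwoForm (β : LinearMap.BilinForm ℝ V) : Prop where
  symm : ∀ v w, β v w = β w v
  nondeg : ∀ v, (∀ w, β v w = 0) → v = 0
  index : ∀ P : Submodule ℝ V, (∀ v ∈ P, 0 ≤ β v v) → finrank ℝ P ≤ 2

/-- A representation of `u(2,2)` by operators skew-adjoint for `β`, trivial on the scalars `iℝ`.
Representations of `su(2,2)` are extended trivially to the scalars, so that the degree `0` part of
`u(2,2)` is all of `gl(2,ℂ)`. -/
structure IsOrthogonalRep (β : LinearMap.BilinForm ℝ V)
    (D : Matrix (Fin 2 ⊕ Fin 2) (Fin 2 ⊕ Fin 2) ℂ →ₗ[ℝ] End ℝ V) : Prop where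
  bracket : ∀ X ∈ uLie 2 2, ∀ Y ∈ uLie 2 2, D (X * Y - Y * X) = D X * D Y - D Y * D X
  skew : ∀ X ∈ uLie 2 2, ∀ v w, β (D X v) w = -β v (D X w)
  scalar : D (Complex.I • 1) = 0

namespace IsOrthogonalRep

variable {β : LinearMap.BilinForm ℝ V} {D : Matrix (Fin 2 ⊕ Fin 2) (Fin 2 ⊕ Fin 2) ℂ →ₗ[ℝ] End ℝ V}

theorem bracket_ef (hD : IsOrthogonalRep β D) {B C : Matrix (Fin 2) (Fin 2) ℂ}
    (hB : B.IsHermitian) (hC : C.IsHermitian) :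
    D (eMat B) * D (fMat C) - D (fMat C) * D (eMat B) = D (lMat (B * C)) := by
  rw [← hD.bracket _ (mem_suLie.1 (eMat_mem hB)).1 _ (mem_suLie.1 (fMat_mem hC)).1,
    eMat_fMat_commutator hB hC]

theorem bracket_le (hD : IsOrthogonalRep β D) (A : Matrix (Fin 2) (Fin 2) ℂ)
    {B : Matrix (Fin 2) (Fin 2) ℂ} (hB : B.IsHermitian) :
    D (lMat A) * D (eMat B) - D (eMat B) * D (lMat A) = D (eMat (A * B + B * Aᴴ)) := by
  rw [← hD.bracket _ (lMat_mem A) _ (mem_suLie.1 (eMat_mem hB)).1, lMat_eMat_commutator]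

theorem bracket_lf (hD : IsOrthogonalRep β D) (A : Matrix (Fin 2) (Fin 2) ℂ)
    {C : Matrix (Fin 2) (Fin 2) ℂ} (hC : C.IsHermitian) :
    D (lMat A) * D (fMat C) - D (fMat C) * D (lMat A) = -D (fMat (Aᴴ * C + C * A)) := by
  rw [← hD.bracket _ (lMat_mem A) _ (mem_suLie.1 (fMat_mem hC)).1, lMat_fMat_commutator, map_neg]

theorem bracket_ll (hD : IsOrthogonalRep β D) (A B : Matrix (Fin 2) (Fin 2) ℂ) :
    D (lMat A) * D (lMat B) - D (lMat B) * D (lMat A) = D (lMat (A * B - B * A)) := by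
  rw [← hD.bracket _ (lMat_mem A) _ (lMat_mem B), lMat_lMat_commutator]

/-- The operators `e 1` and `f 1` are commutators with `l σ` for `σ = diag(1,-1)`. -/
theorem two_smul_e_one (hD : IsOrthogonalRep β D) :
    (2 : ℝ) • D (eMat 1) = D (lMat (diagMat 1)) * D (eMat (diagMat 1)) -
      D (eMat (diagMat 1)) * D (lMat (diagMat 1)) := by
  rw [hD.bracket_le _ isHermitian_diagMat_one, isHermitian_diagMat_one.eq, diagMat_one_mul_self,
    ← two_smul ℝ, map_smul, map_smul]

theorem two_smul_f_one (hD : IsOrthogonalRep β D) :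
    -((2 : ℝ) • D (fMat 1)) = D (lMat (diagMat 1)) * D (fMat (diagMat 1)) -
      D (fMat (diagMat 1)) * D (lMat (diagMat 1)) := by
  rw [hD.bracket_lf _ isHermitian_diagMat_one, isHermitian_diagMat_one.eq, diagMat_one_mul_self,
    ← two_smul ℝ, map_smul, map_smul]

/-- The weight spaces of a representation: generalized eigenspaces of the grading element. -/
noncomputable def weightSpace (D : Matrix (Fin 2 ⊕ Fin 2) (Fin 2 ⊕ Fin 2) ℂ →ₗ[ℝ] End ℝ V) (c : ℝ) :
    Submodule ℝ V := (D (lMat 1)).maxGenEigenspace c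

theorem e_mem (hD : IsOrthogonalRep β D) {B : Matrix (Fin 2) (Fin 2) ℂ} (hB : B.IsHermitian)
    {c : ℝ} {v : V} (hv : v ∈ weightSpace D c) : D (eMat B) v ∈ weightSpace D (c + 2) :=
  mem_maxGenEigenspace_shift (by
    rw [hD.bracket_le 1 hB, Matrix.conjTranspose_one, Matrix.one_mul, Matrix.mul_one, ← two_smul ℝ,
      map_smul, map_smul]) hv

theorem f_mem (hD : IsOrthogonalRep β D) {C : Matrix (Fin 2) (Fin 2) ℂ} (hC : C.IsHermitian)
    {c : ℝ} {v : V} (hv : v ∈ weightSpace D c) : D (fMat C) v ∈ weightSpace D (c - 2) := by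
  rw [sub_eq_add_neg]
  exact mem_maxGenEigenspace_shift (by
    rw [hD.bracket_lf 1 hC, Matrix.conjTranspose_one, Matrix.one_mul, Matrix.mul_one, ← two_smul ℝ,
      map_smul, map_smul, neg_smul]) hv

theorem l_mem (hD : IsOrthogonalRep β D) (A : Matrix (Fin 2) (Fin 2) ℂ)
    {c : ℝ} {v : V} (hv : v ∈ weightSpace D c) : D (lMat A) v ∈ weightSpace D c := by
  have := mem_maxGenEigenspace_shift (H := D (lMat 1)) (T := D (lMat A)) (k := 0) (by
    rw [hD.bracket_ll, Matrix.one_mul, Matrix.mul_one, sub_self, map_zero, map_zero, zero_smul]) hv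
  rwa [add_zero] at this

variable [FiniteDimensional ℝ V]

theorem weightSpace_orthogonal (hD : IsOrthogonalRep β D) {a b : ℝ} (hab : a + b ≠ 0) {v w : V}
    (hv : v ∈ weightSpace D a) (hw : w ∈ weightSpace D b) : β v w = 0 :=
  maxGenEigenspace_orthogonal (hD.skew _ (lMat_mem 1)) hab hv hw

theorem iSup_weightSpace (hD : IsOrthogonalRep β D) : ⨆ c, weightSpace D c = ⊤ := by
  have h1 := Matrix.isHermitian_one (n := Fin 2) (α := ℂ)
  refine sl2_iSup_maxGenEigenspace (E := D (eMat 1)) (F := D (fMat 1)) ?_ ?_ ?_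
  · rw [hD.bracket_le 1 h1, Matrix.conjTranspose_one, Matrix.one_mul, ← two_smul ℝ, map_smul,
      map_smul]
  · rw [hD.bracket_lf 1 h1, Matrix.conjTranspose_one, Matrix.one_mul, ← two_smul ℝ, map_smul,
      map_smul, neg_smul]
  · rw [hD.bracket_ef h1 h1, Matrix.one_mul]

/-- A weight space of nonzero weight is isotropic, hence of dimension at most two. -/
theorem finrank_weightSpace_le (hD : IsOrthogonalRep β D) (hβ : IsIndexTwoForm β) {c : ℝ}
    (hc : c ≠ 0) : finrank ℝ (weightSpace D c) ≤ 2 :=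
  hβ.index _ fun v hv => by
    rw [hD.weightSpace_orthogonal (by simpa using hc) hv hv]

theorem l_apply_eq_zero (hD : IsOrthogonalRep β D) (hβ : IsIndexTwoForm β) {c : ℝ} (hc : c ≠ 0)
    {A : Matrix (Fin 2) (Fin 2) ℂ} (hA : A.trace = 0) {v : V} (hv : v ∈ weightSpace D c) :
    D (lMat A) v = 0 := by
  let L : Matrix (Fin 2) (Fin 2) ℂ →ₗ[ℝ] End ℝ (weightSpace D c) :=
    { toFun := fun A => (D (lMat A)).restrict fun v hv => hD.l_mem A hv
      map_add' := fun A B => by ext v; simp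
      map_smul' := fun r A => by ext v; simp }
  have h1 := sl2C_eq_zero_of_finrank_le_two (hD.finrank_weightSpace_le hβ hc) L (fun A B => by
    ext v
    have := LinearMap.congr_fun (hD.bracket_ll A B) v
    simpa [L] using this) A hA
  exact congrArg Subtype.val (LinearMap.congr_fun h1 ⟨v, hv⟩)

/-- The only weights are `0` and `±2`: elsewhere `sl(2,ℂ)` acts trivially on the three weight spaces
of weights `c` and `c ± 2`, hence `e 1`, `f 1` and their commutator vanish. -/
theorem weightSpace_eq_bot (hD : IsOrthogonalRep β D) (hβ : IsIndexTwoForm β) {c : ℝ}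
    (h0 : c ≠ 0) (h2 : c ≠ 2) (h2' : c ≠ -2) : weightSpace D c = ⊥ := by
  have hs := isHermitian_diagMat_one
  have hE : ∀ v ∈ weightSpace D c, D (eMat 1) v = 0 := by
    intro v hv
    have h := LinearMap.congr_fun hD.two_smul_e_one v
    rw [LinearMap.sub_apply, End.mul_apply, End.mul_apply,
      hD.l_apply_eq_zero hβ h0 (trace_diagMat 1) hv,
      hD.l_apply_eq_zero hβ (fun h => h2' (by linarith)) (trace_diagMat 1) (hD.e_mem hs hv),
      map_zero, sub_zero] at h
    exact (smul_eq_zero.1 h).resolve_left two_ne_zero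
  have hF : ∀ v ∈ weightSpace D c, D (fMat 1) v = 0 := by
    intro v hv
    have h := LinearMap.congr_fun hD.two_smul_f_one v
    rw [LinearMap.sub_apply, End.mul_apply, End.mul_apply,
      hD.l_apply_eq_zero hβ h0 (trace_diagMat 1) hv,
      hD.l_apply_eq_zero hβ (fun h => h2 (by linarith)) (trace_diagMat 1) (hD.f_mem hs hv),
      map_zero, sub_zero, LinearMap.neg_apply, neg_eq_zero] at h
    exact (smul_eq_zero.1 h).resolve_left two_ne_zero
  rw [Submodule.eq_bot_iff]
  intro v hv
  have h1 := Matrix.isHermitian_one (n := Fin 2) (α := ℂ)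
  have hH : D (lMat 1) v = 0 := by
    have h := LinearMap.congr_fun (hD.bracket_ef h1 h1) v
    rw [LinearMap.sub_apply, End.mul_apply, End.mul_apply, hE v hv, hF v hv, map_zero, map_zero,
      sub_zero, Matrix.one_mul] at h
    exact h.symm
  have hv0 : v ∈ weightSpace D 0 := End.mem_maxGenEigenspace _ _ _ |>.2 ⟨1, by simpa using hH⟩
  exact (End.disjoint_genEigenspace (D (lMat 1)) h0 ⊤ ⊤).le_bot ⟨hv, hv0⟩

theorem exists_weight_decomposition (hD : IsOrthogonalRep β D) (hβ : IsIndexTwoForm β) (v : V) :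
    ∃ a ∈ weightSpace D (-2), ∃ b ∈ weightSpace D 0, ∃ c ∈ weightSpace D 2, v = a + b + c := by
  have h1 : ⨆ c, weightSpace D c ≤ weightSpace D (-2) ⊔ weightSpace D 0 ⊔ weightSpace D 2 := by
    refine iSup_le fun c => ?_
    by_cases h0 : c = 0
    · subst h0; exact le_sup_of_le_left le_sup_right
    by_cases h2 : c = 2
    · subst h2; exact le_sup_right
    by_cases h2' : c = -2
    · subst h2'; exact le_sup_of_le_left le_sup_left
    rw [hD.weightSpace_eq_bot hβ h0 h2 h2']
    exact bot_le
  have h2 := h1 (hD.iSup_weightSpace ▸ Submodule.mem_top : v ∈ _)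
  obtain ⟨x, hx, c, hc, rfl⟩ := Submodule.mem_sup.1 h2
  obtain ⟨a, ha, b, hb, rfl⟩ := Submodule.mem_sup.1 hx
  exact ⟨a, ha, b, hb, c, hc, rfl⟩

/-- A vector of weight `-2` orthogonal to the vectors of weight `2` vanishes. -/
theorem eq_zero_of_mem_weightSpace_neg_two (hD : IsOrthogonalRep β D) (hβ : IsIndexTwoForm β)
    {v : V} (hv : v ∈ weightSpace D (-2)) (h : ∀ w ∈ weightSpace D 2, β v w = 0) : v = 0 := by
  refine hβ.nondeg v fun w => ?_
  obtain ⟨a, ha, b, hb, c, hc, rfl⟩ := hD.exists_weight_decomposition hβ w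
  rw [map_add, map_add, hD.weightSpace_orthogonal (by norm_num) hv ha,
    hD.weightSpace_orthogonal (by norm_num) hv hb, h c hc]
  simp

theorem weightSpace_neg_two_ne_bot (hD : IsOrthogonalRep β D) (hβ : IsIndexTwoForm β)
    (hne : D (eMat 1) ≠ 0) : weightSpace D (-2) ≠ ⊥ := by
  intro hbot
  have h2 : weightSpace D 2 = ⊥ := by
    rw [Submodule.eq_bot_iff]
    intro v hv
    refine hβ.nondeg v fun w => ?_
    obtain ⟨a, ha, b, hb, c, hc, rfl⟩ := hD.exists_weight_decomposition hβ w
    rw [hbot, Submodule.mem_bot] at ha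
    rw [map_add, map_add, ha, hD.weightSpace_orthogonal (by norm_num) hv hb,
      hD.weightSpace_orthogonal (by norm_num) hv hc]
    simp
  refine hne (LinearMap.ext fun v => ?_)
  obtain ⟨a, ha, b, hb, c, hc, rfl⟩ := hD.exists_weight_decomposition hβ v
  rw [hbot, Submodule.mem_bot] at ha
  rw [h2, Submodule.mem_bot] at hc
  have h3 := hD.e_mem Matrix.isHermitian_one hb
  rw [zero_add, h2, Submodule.mem_bot] at h3
  rw [ha, hc, zero_add, add_zero, h3, LinearMap.zero_apply]

/-- If the isotropic weight space of weight `2` were a plane, the form would be negative definite on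
the weight space of weight `0`; then `sl(2,ℂ)`, and with it everything, would act trivially. -/
theorem finrank_weightSpace_two_le (hD : IsOrthogonalRep β D) (hβ : IsIndexTwoForm β)
    (hne : D (eMat 1) ≠ 0) : finrank ℝ (weightSpace D 2) ≤ 1 := by
  by_contra hcon
  have hdef : ∀ v ∈ weightSpace D 0, 0 ≤ β v v → v = 0 := by
    intro v hv hvv
    have h1 : finrank ℝ (weightSpace D 2 ⊔ Submodule.span ℝ {v} : Submodule ℝ V) ≤ 2 := by
      refine hβ.index _ fun u hu => ?_
      obtain ⟨a, ha, w, hw, rfl⟩ := Submodule.mem_sup.1 hu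
      obtain ⟨t, rfl⟩ := Submodule.mem_span_singleton.1 hw
      have h2 : β a a = 0 := hD.weightSpace_orthogonal (by norm_num) ha ha
      have h3 : β a v = 0 := hD.weightSpace_orthogonal (by norm_num) ha hv
      have h4 : β v a = 0 := hD.weightSpace_orthogonal (by norm_num) hv ha
      simp only [map_add, map_smul, LinearMap.add_apply, LinearMap.smul_apply, smul_eq_mul, h2, h3,
        h4]
      nlinarith [mul_nonneg (mul_self_nonneg t) hvv]
    have h2 := Submodule.eq_of_le_of_finrank_le
      (le_sup_left : weightSpace D 2 ≤ weightSpace D 2 ⊔ Submodule.span ℝ {v}) (by omega)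
    have h3 : v ∈ weightSpace D 2 := by
      rw [h2]
      exact le_sup_right (a := weightSpace D 2) (Submodule.mem_span_singleton_self v)
    exact (End.disjoint_genEigenspace (D (lMat 1)) (two_ne_zero : (2 : ℝ) ≠ 0) ⊤ ⊤).le_bot ⟨h3, hv⟩
  have hzero : ∀ (A S : Matrix (Fin 2) (Fin 2) ℂ) (c : ℝ), c ≠ 0 → A.trace = 0 →
      S * A - A * S = c • A → D (lMat A) = 0 := by
    intro A S c hc hA hSA
    have hn : IsNilpotent (D (lMat A)) := isNilpotent_of_commutator_eq_smul (H := D (lMat S)) hc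
      (by rw [hD.bracket_ll, hSA, map_smul, map_smul])
    have h0 := skew_nilpotent_eq_zero hn (hD.skew _ (lMat_mem A)) (W := weightSpace D 0)
      (fun w hw => hD.l_mem A hw) (fun w hw h => hdef w hw h.ge)
    refine LinearMap.ext fun v => ?_
    obtain ⟨a, ha, b, hb, c, hc, rfl⟩ := hD.exists_weight_decomposition hβ v
    rw [map_add, map_add, h0 b hb, hD.l_apply_eq_zero hβ (by norm_num) hA ha,
      hD.l_apply_eq_zero hβ (by norm_num) hA hc]
    simp
  have hup : D (lMat (upMat 1)) = 0 := by
    refine hzero _ (diagMat 1) 2 two_ne_zero (by simp [upMat, Matrix.trace_fin_two]) ?_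
    ext i j
    fin_cases i <;> fin_cases j <;> simp [diagMat, upMat]; ring
  have hdown : D (lMat (downMat 1)) = 0 := by
    refine hzero _ (diagMat 1) (-2) (by norm_num) (by simp [downMat, Matrix.trace_fin_two]) ?_
    ext i j
    fin_cases i <;> fin_cases j <;> simp [diagMat, downMat]; ring
  have hdiag : D (lMat (diagMat 1)) = 0 := by
    have h1 : diagMat 1 = upMat 1 * downMat 1 - downMat 1 * upMat 1 := by
      ext i j
      fin_cases i <;> fin_cases j <;> simp [diagMat, downMat, upMat]
    rw [h1, ← hD.bracket_ll, hup, hdown, mul_zero, sub_self]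
  have h1 := hD.two_smul_e_one
  rw [hdiag, zero_mul, mul_zero, sub_self] at h1
  exact hne ((smul_eq_zero.1 h1).resolve_left two_ne_zero)

end IsOrthogonalRep

end OrthogonalRepresentations

/-! ### The vector representation of `su(2,2)` inside an orthogonal representation -/

section ConformalFrame

open Module

/-- The Minkowski form on Hermitian `2 × 2` matrices: twice the polarization of the determinant. -/
noncomputable def mink (B C : Matrix (Fin 2) (Fin 2) ℂ) : ℝ :=
  (B.trace * C.trace - (B * C).trace).re

theorem ofReal_trace_mul_re {B C : Matrix (Fin 2) (Fin 2) ℂ} (hB : B.IsHermitian)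
    (hC : C.IsHermitian) : (((B * C).trace.re : ℝ) : ℂ) = (B * C).trace := by
  rw [← Complex.conj_eq_iff_re, ← Complex.star_def, ← Matrix.trace_conjTranspose,
    Matrix.conjTranspose_mul, hB.eq, hC.eq, Matrix.trace_mul_comm]

theorem ofReal_mink {B C : Matrix (Fin 2) (Fin 2) ℂ} (hB : B.IsHermitian)
    (hC : C.IsHermitian) : ((mink B C : ℝ) : ℂ) = B.trace * C.trace - (B * C).trace := by
  have h1 := ofReal_trace_mul_re hB Matrix.isHermitian_one
  have h2 := ofReal_trace_mul_re hC Matrix.isHermitian_one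
  rw [Matrix.mul_one] at h1 h2
  rw [mink, Complex.sub_re, Complex.ofReal_sub, ofReal_trace_mul_re hB hC, ← h1, ← h2,
    ← Complex.ofReal_mul, Complex.ofReal_re]

theorem mink_comm (B C : Matrix (Fin 2) (Fin 2) ℂ) : mink B C = mink C B := by
  rw [mink, mink, mul_comm, Matrix.trace_mul_comm]

theorem mul_mul_add_mul_mul (B B' C : Matrix (Fin 2) (Fin 2) ℂ) :
    B' * C * B + B * C * B' = (B * C).trace • B' + (B' * C).trace • B -
      (B.trace * B'.trace - (B * B').trace) • C.adjugate := by
  ext i j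
  rw [Matrix.adjugate_fin_two]
  fin_cases i <;> fin_cases j <;>
    simp [Matrix.trace_fin_two, Matrix.mul_apply, Fin.sum_univ_two] <;> ring

/-- The identity behind the Minkowski geometry of the representation. -/
theorem mul_mul_add_mul_mul_real {B B' C : Matrix (Fin 2) (Fin 2) ℂ} (hB : B.IsHermitian)
    (hB' : B'.IsHermitian) (hC : C.IsHermitian) :
    B' * C * B + B * C * B' = (B * C).trace.re • B' + (B' * C).trace.re • B -
      mink B B' • C.adjugate := by
  rw [mul_mul_add_mul_mul, ← ofReal_mink hB hB', ← ofReal_trace_mul_re hB hC,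
    ← ofReal_trace_mul_re hB' hC]
  rfl

/-- The Hermitian matrix with Minkowski coordinates `x`. -/
noncomputable def hermMat : (Fin 4 → ℝ) →ₗ[ℝ] Matrix (Fin 2) (Fin 2) ℂ where
  toFun x := Matrix.of ![![((x 0 + x 3 : ℝ) : ℂ), x 1 - x 2 * Complex.I],
    ![x 1 + x 2 * Complex.I, ((x 0 - x 3 : ℝ) : ℂ)]]
  map_add' x y := by
    ext i j
    fin_cases i <;> fin_cases j <;> simp <;> ring
  map_smul' c x := by
    ext i j
    fin_cases i <;> fin_cases j <;> simp <;> ring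

theorem isHermitian_hermMat (x : Fin 4 → ℝ) : (hermMat x).IsHermitian := by
  ext i j
  fin_cases i <;> fin_cases j <;> simp [hermMat, sub_eq_add_neg]

theorem exists_eq_hermMat {B : Matrix (Fin 2) (Fin 2) ℂ} (hB : B.IsHermitian) :
    ∃ x, B = hermMat x := by
  refine ⟨![((B 0 0).re + (B 1 1).re) / 2, (B 1 0).re, (B 1 0).im,
    ((B 0 0).re - (B 1 1).re) / 2], ?_⟩
  have h00 := hB.apply 0 0
  have h11 := hB.apply 1 1
  have h01 := hB.apply 0 1
  rw [Complex.star_def, Complex.conj_eq_iff_im] at h00 h11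
  ext i j
  fin_cases i <;> fin_cases j <;> apply Complex.ext <;> simp [hermMat, h00, h11, ← h01] <;> ring

theorem mink_hermMat (x y : Fin 4 → ℝ) :
    mink (hermMat x) (hermMat y) = 2 * (x 0 * y 0 - x 1 * y 1 - x 2 * y 2 - x 3 * y 3) := by
  simp [mink, hermMat, Matrix.trace_fin_two]
  ring

theorem adjugate_hermMat (x : Fin 4 → ℝ) :
    (hermMat x).adjugate = hermMat ![x 0, -x 1, -x 2, -x 3] := by
  rw [Matrix.adjugate_fin_two]
  ext i j
  fin_cases i <;> fin_cases j <;> simp [hermMat] <;> ring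

theorem mink_one_one : mink 1 1 = 2 := by
  simp [mink]
  norm_num

variable {V : Type*} [AddCommGroup V] [Module ℝ V]
  {β : LinearMap.BilinForm ℝ V} {D : Matrix (Fin 2 ⊕ Fin 2) (Fin 2 ⊕ Fin 2) ℂ →ₗ[ℝ] End ℝ V}

/-- Vectors `vm`, `vp` of weights `∓2` such that the span of `vm`, `vp` and the vectors
`e B vm`, for `B` Hermitian, is a copy of the vector representation `ℝ^{2,4}`: the sum of the
hyperbolic plane spanned by `vm`, `vp` and of the Minkowski space of Hermitian matrices. -/
structure IsConformalFrame (β : LinearMap.BilinForm ℝ V)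
    (D : Matrix (Fin 2 ⊕ Fin 2) (Fin 2 ⊕ Fin 2) ℂ →ₗ[ℝ] End ℝ V) (vm vp : V) : Prop where
  f_vm : ∀ C : Matrix (Fin 2) (Fin 2) ℂ, C.IsHermitian → D (fMat C) vm = 0
  e_vp : ∀ B : Matrix (Fin 2) (Fin 2) ℂ, B.IsHermitian → D (eMat B) vp = 0
  e_e_vm : ∀ B B' : Matrix (Fin 2) (Fin 2) ℂ, B.IsHermitian → B'.IsHermitian →
    D (eMat B) (D (eMat B') vm) = mink B B' • vp
  f_e_vm : ∀ B C : Matrix (Fin 2) (Fin 2) ℂ, B.IsHermitian → C.IsHermitian →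
    D (fMat C) (D (eMat B) vm) = (B * C).trace.re • vm
  f_vp : ∀ C : Matrix (Fin 2) (Fin 2) ℂ, C.IsHermitian →
    D (fMat C) vp = D (eMat C.adjugate) vm
  vm_vm : β vm vm = 0
  vp_vp : β vp vp = 0
  vm_vp : β vm vp = -1
  vm_e : ∀ B : Matrix (Fin 2) (Fin 2) ℂ, B.IsHermitian → β vm (D (eMat B) vm) = 0
  vp_e : ∀ B : Matrix (Fin 2) (Fin 2) ℂ, B.IsHermitian → β vp (D (eMat B) vm) = 0

namespace IsOrthogonalRep

variable [FiniteDimensional ℝ V]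

theorem l_apply_of_eigenvector (hD : IsOrthogonalRep β D) (hβ : IsIndexTwoForm β) {vm : V}
    (hvm : D (lMat 1) vm = (-2 : ℝ) • vm) (A : Matrix (Fin 2) (Fin 2) ℂ) :
    D (lMat A) vm = -A.trace.re • vm := by
  have hmem : vm ∈ weightSpace D (-2) :=
    End.mem_maxGenEigenspace _ _ _ |>.2 ⟨1, by simp [hvm]⟩
  have hA : A = (A - (A.trace / 2) • 1) + (A.trace.re / 2) • 1 +
      (A.trace.im / 2) • (Complex.I • 1) := by
    have h1 : (A.trace / 2) • (1 : Matrix (Fin 2) (Fin 2) ℂ) =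
        (A.trace.re / 2) • 1 + (A.trace.im / 2) • (Complex.I • 1) := by
      ext i j
      simp only [Matrix.smul_apply, Matrix.add_apply, smul_eq_mul, Complex.real_smul,
        Complex.ofReal_div, Complex.ofReal_ofNat]
      linear_combination (-(1 : Matrix (Fin 2) (Fin 2) ℂ) i j / 2) * Complex.re_add_im A.trace
    rw [h1]
    abel
  have htr : (A - (A.trace / 2) • 1).trace = 0 := by
    rw [Matrix.trace_sub, Matrix.trace_smul, Matrix.trace_one]
    simp
  conv_lhs => rw [hA]
  rw [map_add, map_add, map_add, map_add, LinearMap.add_apply, LinearMap.add_apply,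
    hD.l_apply_eq_zero hβ (by norm_num) htr hmem, map_smul, map_smul, map_smul, map_smul, lMat_I,
    hD.scalar, LinearMap.smul_apply, hvm, smul_zero, LinearMap.zero_apply, add_zero, zero_add,
    smul_smul]
  congr 1
  ring

/-- The relations of a conformal frame hold for any vector of weight `-2`, up to the normalization
`β vm vp = -1`. The sign of `β vm vp` is imposed by the signature: otherwise the traceless Hermitian
matrices would give a positive definite subspace of dimension three. -/
theorem exists_frame_of_eigenvector (hD : IsOrthogonalRep β D) (hβ : IsIndexTwoForm β)
    (hne : D (eMat 1) ≠ 0) {vm : V} (hvm0 : vm ≠ 0) (hvm : D (lMat 1) vm = (-2 : ℝ) • vm) :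
    β vm ((1 / 2 : ℝ) • D (eMat 1) (D (eMat 1) vm)) < 0 ∧
    (β vm ((1 / 2 : ℝ) • D (eMat 1) (D (eMat 1) vm)) = -1 →
      IsConformalFrame β D vm ((1 / 2 : ℝ) • D (eMat 1) (D (eMat 1) vm))) := by
  have h1 := Matrix.isHermitian_one (n := Fin 2) (α := ℂ)
  have hmem : vm ∈ weightSpace D (-2) :=
    End.mem_maxGenEigenspace _ _ _ |>.2 ⟨1, by simp [hvm]⟩
  have hl := hD.l_apply_of_eigenvector hβ hvm
  have hf : ∀ C : Matrix (Fin 2) (Fin 2) ℂ, C.IsHermitian → D (fMat C) vm = 0 := by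
    intro C hC
    have := hD.f_mem hC hmem
    rwa [hD.weightSpace_eq_bot hβ (by norm_num) (by norm_num) (by norm_num), Submodule.mem_bot]
      at this
  have he0 : ∀ B : Matrix (Fin 2) (Fin 2) ℂ, B.IsHermitian → D (eMat B) vm ∈ weightSpace D 0 := by
    intro B hB
    have := hD.e_mem hB hmem
    norm_num at this
    exact this
  have he2 : ∀ B B' : Matrix (Fin 2) (Fin 2) ℂ, B.IsHermitian → B'.IsHermitian →
      D (eMat B) (D (eMat B') vm) ∈ weightSpace D 2 := by
    intro B B' hB hB'
    have := hD.e_mem hB (he0 B' hB')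
    rwa [zero_add] at this
  have hfe : ∀ B C : Matrix (Fin 2) (Fin 2) ℂ, B.IsHermitian → C.IsHermitian →
      D (fMat C) (D (eMat B) vm) = (B * C).trace.re • vm := by
    intro B C hB hC
    have h := LinearMap.congr_fun (hD.bracket_ef hB hC) vm
    rw [LinearMap.sub_apply, End.mul_apply, End.mul_apply, hf C hC, map_zero, zero_sub, hl,
      neg_smul, neg_inj] at h
    exact h
  have hfee : ∀ B B' C : Matrix (Fin 2) (Fin 2) ℂ, B.IsHermitian → B'.IsHermitian →
      C.IsHermitian → D (fMat C) (D (eMat B') (D (eMat B) vm)) =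
        mink B B' • D (eMat C.adjugate) vm := by
    intro B B' C hB hB' hC
    have h2 := LinearMap.congr_fun (hD.bracket_ef hB' hC) (D (eMat B) vm)
    have h3 := LinearMap.congr_fun (hD.bracket_le (B' * C) hB) vm
    rw [LinearMap.sub_apply, End.mul_apply, End.mul_apply, hl, Matrix.conjTranspose_mul, hB'.eq,
      hC.eq, ← Matrix.mul_assoc, mul_mul_add_mul_mul_real hB hB' hC] at h3
    rw [LinearMap.sub_apply, End.mul_apply, End.mul_apply, hfe B C hB hC] at h2
    simp only [map_add, map_sub, map_smul, LinearMap.add_apply, LinearMap.sub_apply,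
      LinearMap.smul_apply] at h2 h3
    rw [sub_eq_iff_eq_add] at h2 h3
    rw [h3] at h2
    rw [← sub_eq_zero] at h2 ⊢
    rw [← neg_zero, ← h2]
    module
  set vp : V := (1 / 2 : ℝ) • D (eMat 1) (D (eMat 1) vm) with hvp
  have hfvp : ∀ C : Matrix (Fin 2) (Fin 2) ℂ, C.IsHermitian →
      D (fMat C) vp = D (eMat C.adjugate) vm := by
    intro C hC
    rw [hvp, map_smul, hfee 1 1 C h1 h1 hC, mink_one_one, smul_smul]
    norm_num
  have hvp2 : vp ∈ weightSpace D 2 := Submodule.smul_mem _ _ (he2 1 1 h1 h1)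
  have he1 : D (eMat 1) vm ≠ 0 := by
    intro h
    have h2 := hfe 1 1 h1 h1
    rw [h, map_zero] at h2
    exact hvm0 ((smul_eq_zero.1 h2.symm).resolve_left (by simp))
  have hvp0 : vp ≠ 0 := by
    intro h
    have h2 := hfvp 1 h1
    rw [h, map_zero, Matrix.adjugate_one] at h2
    exact he1 h2.symm
  have hspan : ∀ w ∈ weightSpace D 2, ∃ c : ℝ, w = c • vp := by
    intro w hw
    have h2 : Submodule.span ℝ {vp} = weightSpace D 2 :=
      Submodule.eq_of_le_of_finrank_le ((Submodule.span_singleton_le_iff_mem _ _).2 hvp2)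
        (by rw [finrank_span_singleton hvp0]; exact hD.finrank_weightSpace_two_le hβ hne)
    rw [← h2] at hw
    obtain ⟨c, hc⟩ := Submodule.mem_span_singleton.1 hw
    exact ⟨c, hc.symm⟩
  have hee : ∀ B B' : Matrix (Fin 2) (Fin 2) ℂ, B.IsHermitian → B'.IsHermitian →
      D (eMat B) (D (eMat B') vm) = mink B B' • vp := by
    intro B B' hB hB'
    obtain ⟨c, hc⟩ := hspan _ (he2 B B' hB hB')
    have h2 := hfee B' B 1 hB' hB h1
    rw [hc, map_smul, hfvp 1 h1, Matrix.adjugate_one] at h2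
    rw [hc, smul_left_injective ℝ he1 h2, mink_comm]
  have hevp : ∀ B : Matrix (Fin 2) (Fin 2) ℂ, B.IsHermitian → D (eMat B) vp = 0 := by
    intro B hB
    have := hD.e_mem hB hvp2
    rwa [hD.weightSpace_eq_bot hβ (by norm_num) (by norm_num) (by norm_num), Submodule.mem_bot]
      at this
  have hb0 : β vm vp ≠ 0 := by
    intro h
    refine hvm0 (hD.eq_zero_of_mem_weightSpace_neg_two hβ hmem fun w hw => ?_)
    obtain ⟨c, rfl⟩ := hspan w hw
    rw [map_smul, h, smul_zero]
  have hbe : ∀ B B' : Matrix (Fin 2) (Fin 2) ℂ, B.IsHermitian → B'.IsHermitian →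
      β (D (eMat B) vm) (D (eMat B') vm) = -(mink B B' * β vm vp) := by
    intro B B' hB hB'
    rw [hD.skew _ (mem_suLie.1 (eMat_mem hB)).1, hee B B' hB hB', map_smul, smul_eq_mul]
  refine ⟨lt_of_le_of_ne (not_lt.1 fun hpos => ?_) hb0, fun hb => ?_⟩
  · -- the Pauli matrices span a positive definite subspace
    let T : (Fin 3 → ℝ) →ₗ[ℝ] V :=
      { toFun := fun x => D (eMat (hermMat ![0, x 0, x 1, x 2])) vm
        map_add' := fun x y => by
          rw [← LinearMap.add_apply, ← map_add, ← map_add, ← map_add]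
          simp
        map_smul' := fun c x => by
          rw [RingHom.id_apply, ← LinearMap.smul_apply, ← map_smul, ← map_smul, ← map_smul]
          simp }
    have hT : ∀ x, β (T x) (T x) = 2 * (x 0 ^ 2 + x 1 ^ 2 + x 2 ^ 2) * β vm vp := by
      intro x
      change β (D (eMat _) vm) (D (eMat _) vm) = _
      rw [hbe _ _ (isHermitian_hermMat _) (isHermitian_hermMat _), mink_hermMat]
      simp
      ring
    have hinj : Function.Injective T := by
      rw [← LinearMap.ker_eq_bot, LinearMap.ker_eq_bot']
      intro x hx
      have h2 := hT x
      rw [hx, map_zero, eq_comm, mul_eq_zero, or_iff_left hpos.ne'] at h2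
      funext i
      fin_cases i <;> simp <;> nlinarith [sq_nonneg (x 0), sq_nonneg (x 1), sq_nonneg (x 2)]
    have h3 := hβ.index (LinearMap.range T) (by
      rintro _ ⟨x, rfl⟩
      rw [hT]
      positivity)
    rw [LinearMap.finrank_range_of_inj hinj] at h3
    simp at h3
  · exact
      { f_vm := hf
        e_vp := hevp
        e_e_vm := hee
        f_e_vm := hfe
        f_vp := hfvp
        vm_vm := hD.weightSpace_orthogonal (by norm_num) hmem hmem
        vp_vp := hD.weightSpace_orthogonal (by norm_num) hvp2 hvp2
        vm_vp := hb
        vm_e := fun B hB => hD.weightSpace_orthogonal (by norm_num) hmem (he0 B hB)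
        vp_e := fun B hB => hD.weightSpace_orthogonal (by norm_num) hvp2 (he0 B hB) }

theorem exists_conformalFrame (hD : IsOrthogonalRep β D) (hβ : IsIndexTwoForm β)
    (hne : D (eMat 1) ≠ 0) : ∃ vm vp, IsConformalFrame β D vm vp := by
  have h1 : (D (lMat 1)).HasEigenvalue (-2) :=
    (End.hasUnifEigenvalue_iff_hasUnifEigenvalue_one (k := ⊤) (by simp)).1
      (hD.weightSpace_neg_two_ne_bot hβ hne)
  obtain ⟨v, hv⟩ := h1.exists_hasEigenvector
  have hb := (hD.exists_frame_of_eigenvector hβ hne hv.2 hv.apply_eq_smul).1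
  set b := β v ((1 / 2 : ℝ) • D (eMat 1) (D (eMat 1) v)) with hbdef
  have hs : Real.sqrt (-b) ≠ 0 := (Real.sqrt_pos.2 (by linarith)).ne'
  refine ⟨_, _, (hD.exists_frame_of_eigenvector hβ hne (vm := (Real.sqrt (-b))⁻¹ • v)
    (smul_ne_zero (inv_ne_zero hs) hv.2) ?_).2 ?_⟩
  · rw [map_smul, hv.apply_eq_smul, smul_comm]
  · have hss : Real.sqrt (-b) * Real.sqrt (-b) = -b := Real.mul_self_sqrt (by linarith)
    rw [map_smul, smul_eq_mul] at hbdef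
    simp only [map_smul, LinearMap.smul_apply, smul_eq_mul]
    field_simp
    linarith

end IsOrthogonalRep

end ConformalFrame

section ConformalEmbedding

open Module

variable {V : Type*} [AddCommGroup V] [Module ℝ V]
  {β : LinearMap.BilinForm ℝ V} {D : Matrix (Fin 2 ⊕ Fin 2) (Fin 2 ⊕ Fin 2) ℂ →ₗ[ℝ] End ℝ V}

/-- The map `(a, b, x) ↦ a vm + b vp + e (hermMat x) vm` attached to a conformal frame, from a model
`ℝ × ℝ × ℝ⁴` of `ℝ^{2,4}`. -/
noncomputable def frameMap (D : Matrix (Fin 2 ⊕ Fin 2) (Fin 2 ⊕ Fin 2) ℂ →ₗ[ℝ] End ℝ V)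
    (vm vp : V) : (ℝ × ℝ × (Fin 4 → ℝ)) →ₗ[ℝ] V where
  toFun m := m.1 • vm + m.2.1 • vp + D (eMat (hermMat m.2.2)) vm
  map_add' m m' := by
    simp only [Prod.fst_add, Prod.snd_add, map_add, LinearMap.add_apply, add_smul]
    abel
  map_smul' c m := by
    simp only [Prod.smul_fst, Prod.smul_snd, map_smul, LinearMap.smul_apply, smul_add, smul_smul,
      smul_eq_mul, RingHom.id_apply]

theorem frameMap_apply (vm vp : V) (m : ℝ × ℝ × (Fin 4 → ℝ)) :
    frameMap D vm vp m = m.1 • vm + m.2.1 • vp + D (eMat (hermMat m.2.2)) vm := rfl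

namespace IsConformalFrame

variable {vm vp : V}

theorem e_frameMap (h : IsConformalFrame β D vm vp) (y : Fin 4 → ℝ) (m : ℝ × ℝ × (Fin 4 → ℝ)) :
    D (eMat (hermMat y)) (frameMap D vm vp m) =
      frameMap D vm vp (0, mink (hermMat y) (hermMat m.2.2), m.1 • y) := by
  rw [frameMap_apply, frameMap_apply, map_add, map_add, map_smul, map_smul,
    h.e_vp _ (isHermitian_hermMat y),
    h.e_e_vm _ _ (isHermitian_hermMat y) (isHermitian_hermMat m.2.2), map_smul, map_smul, map_smul]
  simp only [LinearMap.smul_apply]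
  module

theorem f_frameMap (h : IsConformalFrame β D vm vp) (y : Fin 4 → ℝ) (m : ℝ × ℝ × (Fin 4 → ℝ)) :
    D (fMat (hermMat y)) (frameMap D vm vp m) =
      frameMap D vm vp ((hermMat m.2.2 * hermMat y).trace.re, 0,
        m.2.1 • ![y 0, -y 1, -y 2, -y 3]) := by
  rw [frameMap_apply, frameMap_apply, map_add, map_add, map_smul, map_smul,
    h.f_vm _ (isHermitian_hermMat y), h.f_vp _ (isHermitian_hermMat y), adjugate_hermMat,
    h.f_e_vm _ _ (isHermitian_hermMat m.2.2) (isHermitian_hermMat y), map_smul, map_smul, map_smul]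
  simp only [LinearMap.smul_apply]
  module

theorem e_e (h : IsConformalFrame β D vm vp) (hD : IsOrthogonalRep β D)
    {B B' : Matrix (Fin 2) (Fin 2) ℂ} (hB : B.IsHermitian) (hB' : B'.IsHermitian) :
    β (D (eMat B) vm) (D (eMat B') vm) = mink B B' := by
  rw [hD.skew _ (mem_suLie.1 (eMat_mem hB)).1, h.e_e_vm B B' hB hB', map_smul, h.vm_vp]
  simp

theorem form_frameMap (h : IsConformalFrame β D vm vp) (hD : IsOrthogonalRep β D)
    (hβ : IsIndexTwoForm β) (m m' : ℝ × ℝ × (Fin 4 → ℝ)) :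
    β (frameMap D vm vp m) (frameMap D vm vp m') =
      mink (hermMat m.2.2) (hermMat m'.2.2) - m.1 * m'.2.1 - m.2.1 * m'.1 := by
  have h1 := isHermitian_hermMat m.2.2
  have h2 := isHermitian_hermMat m'.2.2
  simp only [frameMap_apply, map_add, map_smul, LinearMap.add_apply, LinearMap.smul_apply,
    h.vm_vm, h.vp_vp, h.vm_vp, hβ.symm vp vm, h.vm_e _ h2, h.vp_e _ h2, h.e_e hD h1 h2,
    hβ.symm _ vm, hβ.symm _ vp, h.vm_e _ h1, h.vp_e _ h1, smul_eq_mul]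
  ring

theorem frameMap_injective (h : IsConformalFrame β D vm vp) (hD : IsOrthogonalRep β D)
    (hβ : IsIndexTwoForm β) : Function.Injective (frameMap D vm vp) := by
  rw [← LinearMap.ker_eq_bot, LinearMap.ker_eq_bot']
  rintro ⟨a, b, x⟩ hm
  have key : ∀ m' : ℝ × ℝ × (Fin 4 → ℝ), mink (hermMat x) (hermMat m'.2.2) - a * m'.2.1 - b * m'.1 = 0 := by
    intro m'
    rw [← h.form_frameMap hD hβ (a, b, x) m', hm, map_zero, LinearMap.zero_apply]
  have ha : a = 0 := by
    have := key (0, 1, 0)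
    rw [mink_hermMat] at this
    simpa using this
  have hb : b = 0 := by
    have := key (1, 0, 0)
    rw [mink_hermMat] at this
    simpa using this
  have hx := key (0, 0, ![x 0, -x 1, -x 2, -x 3])
  simp [mink_hermMat] at hx
  have hx0 : x = 0 := by
    funext i
    fin_cases i <;> simp <;>
      nlinarith [mul_self_nonneg (x 0), mul_self_nonneg (x 1), mul_self_nonneg (x 2),
        mul_self_nonneg (x 3)]
  rw [ha, hb, hx0]
  rfl

/-- The orthogonal complement of the span of a frame is negative definite, as the span already has
positive index two. -/
theorem eq_zero_of_orthogonal (h : IsConformalFrame β D vm vp) (hD : IsOrthogonalRep β D)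
    (hβ : IsIndexTwoForm β) {w : V} (hw : ∀ m, β (frameMap D vm vp m) w = 0) (hww : 0 ≤ β w w) :
    w = 0 := by
  by_contra hw0
  let T : (ℝ × ℝ × ℝ) →ₗ[ℝ] V :=
    { toFun := fun s => frameMap D vm vp (s.1, -s.1, ![s.2.1, 0, 0, 0]) + s.2.2 • w
      map_add' := fun s t => by
        have : (((s + t).1, -(s + t).1, ![(s + t).2.1, 0, 0, 0]) : ℝ × ℝ × (Fin 4 → ℝ)) =
            (s.1, -s.1, ![s.2.1, 0, 0, 0]) + (t.1, -t.1, ![t.2.1, 0, 0, 0]) := by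
          simp [add_comm]
        rw [this, map_add, Prod.snd_add, Prod.snd_add, add_smul]
        abel
      map_smul' := fun c s => by
        have : (((c • s).1, -(c • s).1, ![(c • s).2.1, 0, 0, 0]) : ℝ × ℝ × (Fin 4 → ℝ)) =
            c • (s.1, -s.1, ![s.2.1, 0, 0, 0]) := by
          simp
        rw [this, map_smul, Prod.smul_snd, Prod.smul_snd, smul_eq_mul, RingHom.id_apply, smul_add,
          smul_smul] }
  have hT : ∀ s, β (T s) (T s) = 2 * s.1 ^ 2 + 2 * s.2.1 ^ 2 + s.2.2 ^ 2 * β w w := by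
    intro s
    change β (frameMap D vm vp _ + s.2.2 • w) (frameMap D vm vp _ + s.2.2 • w) = _
    simp only [map_add, map_smul, LinearMap.add_apply, LinearMap.smul_apply, hw, hβ.symm w,
      h.form_frameMap hD hβ, mink_hermMat, smul_eq_mul]
    simp
    ring
  have hinj : Function.Injective T := by
    rw [← LinearMap.ker_eq_bot, LinearMap.ker_eq_bot']
    rintro ⟨s, t, r⟩ hs
    have h2 := hT (s, t, r)
    rw [hs, map_zero] at h2
    simp only at h2
    have h3 := mul_nonneg (sq_nonneg r) hww
    have hs0 : s = 0 := by nlinarith [sq_nonneg s, sq_nonneg t]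
    have ht0 : t = 0 := by nlinarith [sq_nonneg s, sq_nonneg t]
    subst hs0 ht0
    have h4 : frameMap D vm vp (0, -0, ![0, 0, 0, 0]) + r • w = 0 := hs
    have h5 : ((0, -0, ![0, 0, 0, 0]) : ℝ × ℝ × (Fin 4 → ℝ)) = 0 := by simp
    rw [h5, map_zero, zero_add] at h4
    rw [(smul_eq_zero.1 h4).resolve_right hw0]
    rfl
  have h3 := hβ.index (LinearMap.range T) (by
    rintro _ ⟨x, rfl⟩
    rw [hT]
    positivity)
  rw [LinearMap.finrank_range_of_inj hinj] at h3
  simp at h3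

end IsConformalFrame

/-- The complement of the span of a frame is definite, so the nilpotent operators `e B` and `f C`
vanish there, and `su(2,2)` is generated by these. -/
theorem IsConformalFrame.apply_eq_zero_of_orthogonal [FiniteDimensional ℝ V] {vm vp : V}
    (h : IsConformalFrame β D vm vp) (hD : IsOrthogonalRep β D) (hβ : IsIndexTwoForm β) {w : V}
    (hw : ∀ m, β (frameMap D vm vp m) w = 0)
    {X : Matrix (Fin 2 ⊕ Fin 2) (Fin 2 ⊕ Fin 2) ℂ} (hX : X ∈ suLie 2 2) : D X w = 0 := by
  let W : Submodule ℝ V :=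
    { carrier := {w | ∀ m, β (frameMap D vm vp m) w = 0}
      zero_mem' := fun m => by simp
      add_mem' := fun {a b} ha hb m => by rw [map_add, ha m, hb m, add_zero]
      smul_mem' := fun c a ha m => by rw [map_smul, ha m, smul_zero] }
  have hW : ∀ {T : Matrix (Fin 2 ⊕ Fin 2) (Fin 2 ⊕ Fin 2) ℂ}, T ∈ suLie 2 2 →
      (∀ m, ∃ m', D T (frameMap D vm vp m) = frameMap D vm vp m') → IsNilpotent (D T) →
      ∀ w ∈ W, D T w = 0 := by
    intro T hT hm hn
    refine skew_nilpotent_eq_zero hn (hD.skew _ (mem_suLie.1 hT).1) (fun w hw m => ?_)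
      (fun w hw hww => h.eq_zero_of_orthogonal hD hβ hw hww.ge)
    obtain ⟨m', hm'⟩ := hm m
    have h1 := hD.skew _ (mem_suLie.1 hT).1 (frameMap D vm vp m) w
    rw [hm', hw m'] at h1
    linarith
  let S : Submodule ℝ (Matrix (Fin 2 ⊕ Fin 2) (Fin 2 ⊕ Fin 2) ℂ) :=
    { carrier := {X | ∀ w ∈ W, D X w = 0}
      zero_mem' := fun w _ => by simp
      add_mem' := fun {a b} ha hb w hw => by
        rw [map_add, LinearMap.add_apply, ha w hw, hb w hw, add_zero]
      smul_mem' := fun c a ha w hw => by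
        rw [map_smul, LinearMap.smul_apply, ha w hw, smul_zero] }
  have hS : suLie 2 2 ≤ S := by
    refine suLie_le_of_eMat_fMat_mem (fun B hB => ?_) (fun C hC => ?_)
      fun X hX Y hY hXS hYS w hw => ?_
    · obtain ⟨y, rfl⟩ := exists_eq_hermMat hB
      exact hW (eMat_mem hB) (fun m => ⟨_, h.e_frameMap y m⟩)
        (isNilpotent_of_commutator_eq_smul (H := D (lMat 1)) (c := 2) two_ne_zero (by
          rw [hD.bracket_le 1 hB, Matrix.conjTranspose_one, Matrix.one_mul, Matrix.mul_one,
            ← two_smul ℝ, map_smul, map_smul]))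
    · obtain ⟨y, rfl⟩ := exists_eq_hermMat hC
      exact hW (fMat_mem hC) (fun m => ⟨_, h.f_frameMap y m⟩)
        (isNilpotent_of_commutator_eq_smul (H := D (lMat 1)) (c := -2) (by norm_num) (by
          rw [hD.bracket_lf 1 hC, Matrix.conjTranspose_one, Matrix.one_mul, Matrix.mul_one,
            ← two_smul ℝ, map_smul, map_smul, neg_smul]))
    · rw [hD.bracket X hX Y hY, LinearMap.sub_apply, End.mul_apply, End.mul_apply, hXS w hw,
        hYS w hw, map_zero, map_zero, sub_zero]
  exact hS hX w hw

/-- A nontrivial orthogonal representation of `su(2,2)` of index two is the sum of any given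
six-dimensional one and of a trivial representation. -/
theorem exists_equivariant_isometry [FiniteDimensional ℝ V] {V' : Type*} [AddCommGroup V']
    [Module ℝ V'] [FiniteDimensional ℝ V'] {β' : LinearMap.BilinForm ℝ V'}
    {D' : Matrix (Fin 2 ⊕ Fin 2) (Fin 2 ⊕ Fin 2) ℂ →ₗ[ℝ] End ℝ V'} (hD : IsOrthogonalRep β D)
    (hβ : IsIndexTwoForm β) (hne : D (eMat 1) ≠ 0) (hD' : IsOrthogonalRep β' D')
    (hβ' : IsIndexTwoForm β') (hne' : D' (eMat 1) ≠ 0) (hV' : finrank ℝ V' = 6) :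
    ∃ ι : V' →ₗ[ℝ] V, (∀ v w, β (ι v) (ι w) = β' v w) ∧
      ∀ X ∈ suLie 2 2, (∀ v, D X (ι v) = ι (D' X v)) ∧
        ∀ w, (∀ v, β (ι v) w = 0) → D X w = 0 := by
  obtain ⟨vm, vp, h⟩ := hD.exists_conformalFrame hβ hne
  obtain ⟨vm', vp', h'⟩ := hD'.exists_conformalFrame hβ' hne'
  let j' := LinearEquiv.ofInjectiveOfFinrankEq (frameMap D' vm' vp') (h'.frameMap_injective hD' hβ')
    (by rw [hV']; simp)
  have hj' : ∀ m, j' m = frameMap D' vm' vp' m := fun m => rfl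
  have hι : ∀ m, (frameMap D vm vp ∘ₗ j'.symm.toLinearMap) (frameMap D' vm' vp' m) =
      frameMap D vm vp m := fun m => by
    rw [← hj', LinearMap.comp_apply, LinearEquiv.coe_coe, LinearEquiv.symm_apply_apply]
  have hsurj : ∀ v, ∃ m, v = frameMap D' vm' vp' m := fun v => ⟨j'.symm v, by
    rw [← hj', LinearEquiv.apply_symm_apply]⟩
  refine ⟨frameMap D vm vp ∘ₗ j'.symm.toLinearMap, fun v w => ?_, fun X hX => ⟨?_, fun w hw => ?_⟩⟩
  · obtain ⟨m, rfl⟩ := hsurj v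
    obtain ⟨m', rfl⟩ := hsurj w
    rw [hι, hι, h.form_frameMap hD hβ, h'.form_frameMap hD' hβ']
  · set ι := frameMap D vm vp ∘ₗ j'.symm.toLinearMap
    let S : Submodule ℝ (Matrix (Fin 2 ⊕ Fin 2) (Fin 2 ⊕ Fin 2) ℂ) :=
      { carrier := {X | ∀ v, D X (ι v) = ι (D' X v)}
        zero_mem' := fun v => by simp
        add_mem' := fun {a b} ha hb v => by
          rw [map_add, LinearMap.add_apply, ha v, hb v, map_add, LinearMap.add_apply, map_add]
        smul_mem' := fun c a ha v => by
          rw [map_smul, LinearMap.smul_apply, ha v, map_smul, LinearMap.smul_apply, map_smul] }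
    have hS : suLie 2 2 ≤ S := by
      refine suLie_le_of_eMat_fMat_mem (fun B hB v => ?_) (fun C hC v => ?_)
        fun X hX Y hY hXS hYS v => ?_
      · obtain ⟨y, rfl⟩ := exists_eq_hermMat hB
        obtain ⟨m, rfl⟩ := hsurj v
        rw [hι, h.e_frameMap, h'.e_frameMap, hι]
      · obtain ⟨y, rfl⟩ := exists_eq_hermMat hC
        obtain ⟨m, rfl⟩ := hsurj v
        rw [hι, h.f_frameMap, h'.f_frameMap, hι]
      · rw [hD.bracket X hX Y hY, hD'.bracket X hX Y hY, LinearMap.sub_apply, LinearMap.sub_apply,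
          End.mul_apply, End.mul_apply, End.mul_apply, End.mul_apply, hXS v, hYS v, hXS, hYS,
          map_sub]
    exact hS hX
  · refine h.apply_eq_zero_of_orthogonal hD hβ (fun m => ?_) hX
    rw [← hι]
    exact hw _

end ConformalEmbedding

/-! ### Simplicity of `su(p,q)` -/

section Simplicity

variable {p q : ℕ}

/-- The diagonal entries `±1` of the standard Hermitian form. -/
def sigSign : Fin p ⊕ Fin q → ℂ := Sum.elim (fun _ => 1) (fun _ => -1)

theorem sigMatrix_eq_diagonal : sigMatrix p q ℂ = Matrix.diagonal sigSign := rfl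

theorem sigSign_mul_self (j : Fin p ⊕ Fin q) : sigSign j * sigSign j = 1 := by
  rcases j with j | j <;> simp [sigSign]

theorem sigSign_eq_or (j : Fin p ⊕ Fin q) : sigSign j = 1 ∨ sigSign j = -1 := by
  rcases j with j | j <;> simp [sigSign]

theorem star_sigSign (j : Fin p ⊕ Fin q) : star (sigSign j) = sigSign j := by
  rcases j with j | j <;> simp [sigSign]

/-- The element of `u(p,q)` with entry `z` at the place `(j, k)`, the entry at `(k, j)` that this
forces, and no other entries. -/
noncomputable def rootMat (j k : Fin p ⊕ Fin q) :
    ℂ →ₗ[ℝ] Matrix (Fin p ⊕ Fin q) (Fin p ⊕ Fin q) ℂ where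
  toFun z := Matrix.single j k z - Matrix.single k j (sigSign j * sigSign k * star z)
  map_add' z w := by
    rw [star_add, mul_add, Matrix.single_add, Matrix.single_add]
    abel
  map_smul' c z := by
    rw [star_smul, star_trivial, mul_smul_comm, RingHom.id_apply, smul_sub, Matrix.smul_single,
      Matrix.smul_single]

/-- The diagonal element `i (E_jj - E_kk)` of `su(p,q)`. -/
noncomputable def torusMat (j k : Fin p ⊕ Fin q) : Matrix (Fin p ⊕ Fin q) (Fin p ⊕ Fin q) ℂ :=
  Matrix.single j j Complex.I - Matrix.single k k Complex.I

theorem rootMat_apply (j k : Fin p ⊕ Fin q) (z : ℂ) : rootMat j k z =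
    Matrix.single j k z - Matrix.single k j (sigSign j * sigSign k * star z) := rfl

theorem rootMat_mem_uLie (j k : Fin p ⊕ Fin q) (z : ℂ) : rootMat j k z ∈ uLie p q := by
  rw [mem_uLie, rootMat_apply, sigMatrix_eq_diagonal]
  ext a b
  simp only [Matrix.conjTranspose_sub, Matrix.conjTranspose_single, Matrix.mul_diagonal,
    Matrix.neg_apply, Matrix.diagonal_mul, Matrix.sub_apply, Matrix.single_apply, star_mul',
    star_sigSign, star_star]
  by_cases h1 : k = a ∧ j = b
  · by_cases h2 : j = a ∧ k = b
    · obtain ⟨rfl, rfl⟩ := h1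
      obtain ⟨rfl, -⟩ := h2
      rcases sigSign_eq_or j with h | h <;> simp [h]
    · obtain ⟨rfl, rfl⟩ := h1
      rcases sigSign_eq_or k with h | h <;> simp [h, h2, mul_comm]
  · by_cases h2 : j = a ∧ k = b
    · obtain ⟨rfl, rfl⟩ := h2
      rcases sigSign_eq_or k with h | h <;> simp [h, h1]
    · simp [h1, h2]

theorem rootMat_mem {j k : Fin p ⊕ Fin q} (h : j ≠ k) (z : ℂ) : rootMat j k z ∈ suLie p q := by
  refine mem_suLie.2 ⟨rootMat_mem_uLie j k z, ?_⟩
  rw [rootMat_apply, Matrix.trace_sub, Matrix.trace_single_eq_of_ne _ _ _ h,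
    Matrix.trace_single_eq_of_ne _ _ _ h.symm, sub_zero]

theorem torusMat_mem (j k : Fin p ⊕ Fin q) : torusMat j k ∈ suLie p q := by
  have h : torusMat j k = (1 / 2 : ℝ) • (rootMat j j Complex.I - rootMat k k Complex.I) := by
    simp only [torusMat, rootMat_apply, sigSign_mul_self, Complex.star_def, Complex.conj_I, mul_neg,
      one_mul,
      ← Matrix.single_neg]
    module
  rw [h]
  refine mem_suLie.2 ⟨(uLie p q).smul_mem _ (sub_mem (rootMat_mem_uLie _ _ _)
    (rootMat_mem_uLie _ _ _)), ?_⟩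
  rw [← h, torusMat]
  simp

theorem torusMat_rootMat_commutator {j k : Fin p ⊕ Fin q} (h : j ≠ k) (z : ℂ) :
    torusMat j k * rootMat j k z - rootMat j k z * torusMat j k =
      rootMat j k (2 * Complex.I * z) := by
  simp [torusMat, rootMat_apply, Matrix.sub_mul, Matrix.mul_sub, h, h.symm]
  ext a b
  simp only [Matrix.add_apply, Matrix.sub_apply, Matrix.neg_apply, Matrix.single_apply]
  split_ifs <;> ring

theorem torusMat_rootMat_commutator' {j k l : Fin p ⊕ Fin q} (h : j ≠ k) (hl : j ≠ l) (hk : k ≠ l)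
    (z : ℂ) :
    torusMat j k * rootMat j l z - rootMat j l z * torusMat j k = rootMat j l (Complex.I * z) := by
  simp [torusMat, rootMat_apply, Matrix.sub_mul, Matrix.mul_sub, h, h.symm, hl, hl.symm, hk, hk.symm]
  ext a b
  simp only [Matrix.add_apply, Matrix.sub_apply, Matrix.single_apply]
  split_ifs <;> ring

theorem rootMat_rootMat_commutator {j k l : Fin p ⊕ Fin q} (h : j ≠ k) (hl : j ≠ l) (hk : k ≠ l)
    (z w : ℂ) :
    rootMat j k z * rootMat k l w - rootMat k l w * rootMat j k z = rootMat j l (z * w) := by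
  simp [rootMat_apply, Matrix.sub_mul, Matrix.mul_sub, h, h.symm, hl, hl.symm, hk, hk.symm]
  have h2 := sigSign_mul_self k
  congr 1
  linear_combination sigSign l * sigSign j * (starRingEnd ℂ) z * (starRingEnd ℂ) w * h2

theorem torusMat_rootMat_commutator_of_disjoint {j k l m : Fin p ⊕ Fin q} (hjl : j ≠ l)
    (hjm : j ≠ m) (hkl : k ≠ l) (hkm : k ≠ m) (z : ℂ) :
    torusMat j k * rootMat l m z - rootMat l m z * torusMat j k = 0 := by
  simp [torusMat, rootMat_apply, Matrix.sub_mul, Matrix.mul_sub, hjl, hjl.symm, hjm, hjm.symm, hkl,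
    hkl.symm, hkm, hkm.symm]

theorem rootMat_rootMat_commutator_of_disjoint {j k l m : Fin p ⊕ Fin q} (hjl : j ≠ l)
    (hjm : j ≠ m) (hkl : k ≠ l) (hkm : k ≠ m) (z w : ℂ) :
    rootMat j k z * rootMat l m w - rootMat l m w * rootMat j k z = 0 := by
  simp [rootMat_apply, Matrix.sub_mul, Matrix.mul_sub, hjl, hjl.symm, hjm, hjm.symm, hkl,
    hkl.symm, hkm, hkm.symm]

theorem rootMat_rootMat_commutator_self {j k : Fin p ⊕ Fin q} (h : j ≠ k) :
    rootMat j k (sigSign j * sigSign k) * rootMat j k Complex.I -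
      rootMat j k Complex.I * rootMat j k (sigSign j * sigSign k) = (2 : ℝ) • torusMat j k := by
  rcases sigSign_eq_or j with hj | hj <;> rcases sigSign_eq_or k with hk | hk <;>
    simp [torusMat, rootMat_apply, Matrix.sub_mul, Matrix.mul_sub, h, h.symm, hj, hk,
      Matrix.add_mul, Matrix.mul_add, ← Matrix.single_neg] <;> module

theorem rootMat_swap (j k : Fin p ⊕ Fin q) (z : ℂ) :
    rootMat j k z = rootMat k j (-(sigSign j * sigSign k * star z)) := by
  rw [rootMat_apply, rootMat_apply, star_neg, star_mul', star_mul', star_star, star_sigSign,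
    star_sigSign, mul_neg, ← Matrix.single_neg, ← Matrix.single_neg,
    show sigSign k * sigSign j * (sigSign j * sigSign k * z) = z by
      linear_combination (sigSign k * sigSign k * z) * sigSign_mul_self j +
        z * sigSign_mul_self k]
  abel

/-- The Lie algebra `su(p,q)` is spanned by the matrices `rootMat j k z` and their commutators. -/
theorem suLie_le_of_rootMat_mem {K : Submodule ℝ (Matrix (Fin p ⊕ Fin q) (Fin p ⊕ Fin q) ℂ)}
    (hK : ∀ X ∈ suLie p q, ∀ Y ∈ suLie p q, Y ∈ K → X * Y - Y * X ∈ K) (j₀ : Fin p ⊕ Fin q)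
    (h : ∀ j k, j ≠ k → ∀ z, rootMat j k z ∈ K) : suLie p q ≤ K := by
  have hT : ∀ j k, torusMat j k ∈ K := by
    intro j k
    by_cases hjk : j = k
    · rw [hjk, torusMat, sub_self]
      exact K.zero_mem
    · have h1 := hK _ (rootMat_mem hjk (sigSign j * sigSign k)) _ (rootMat_mem hjk Complex.I)
        (h j k hjk _)
      rw [rootMat_rootMat_commutator_self hjk] at h1
      simpa using K.smul_mem (1 / 2) h1
  intro X hX
  obtain ⟨hX, ht⟩ := mem_suLie.1 hX
  have hent : ∀ j k, star (X k j) = -(sigSign j * sigSign k * X j k) := by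
    intro j k
    have h1 := congrFun (congrFun (mem_uLie.1 hX) j) k
    rw [sigMatrix_eq_diagonal, Matrix.mul_diagonal, Matrix.neg_apply, Matrix.diagonal_mul,
      Matrix.conjTranspose_apply] at h1
    linear_combination sigSign k * h1 - star (X k j) * sigSign_mul_self k
  have hdiag : ∀ j, X j j = (X j j).im * Complex.I := by
    intro j
    have h1 := hent j j
    rw [sigSign_mul_self, one_mul] at h1
    apply Complex.ext
    · have := congrArg Complex.re h1
      simp at this ⊢
      linarith
    · simp
  have hsum : X = (1 / 2 : ℝ) • ∑ j, ∑ k, (if j = k then (0 : Matrix _ _ ℂ) else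
      rootMat j k (X j k)) + ∑ j, (X j j).im • torusMat j j₀ := by
    have h1 : ∑ j, (X j j).im • torusMat j j₀ = ∑ j, Matrix.single j j (X j j) := by
      have h2 : ∀ j, (X j j).im • torusMat j j₀ =
          Matrix.single j j (X j j) - Matrix.singleAddMonoidHom j₀ j₀ (X j j) := by
        intro j
        rw [Matrix.singleAddMonoidHom_apply]
        conv_rhs => rw [hdiag j]
        rw [torusMat, smul_sub, Matrix.smul_single, Matrix.smul_single, Complex.real_smul]
      simp only [h2]
      rw [Finset.sum_sub_distrib, ← map_sum]
      change _ - Matrix.singleAddMonoidHom j₀ j₀ X.trace = _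
      rw [ht, map_zero, sub_zero]
    have h2 : ∀ j k, (if j = k then (0 : Matrix _ _ ℂ) else rootMat j k (X j k)) =
        (if j = k then 0 else Matrix.single j k (X j k)) +
          (if k = j then 0 else Matrix.single k j (X k j)) := by
      intro j k
      by_cases hjk : j = k
      · simp [hjk]
      · rw [if_neg hjk, if_neg hjk, if_neg (Ne.symm hjk), rootMat_apply, hent k j, sub_eq_add_neg,
          Matrix.single_neg]
        congr 2
        linear_combination (sigSign k * sigSign k * X k j) * sigSign_mul_self j +
          X k j * sigSign_mul_self k
    simp only [h2, Finset.sum_add_distrib]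
    rw [Finset.sum_comm (f := fun j k => if k = j then 0 else Matrix.single k j (X k j)), ← two_smul ℝ,
      smul_smul, h1, one_div_mul_cancel two_ne_zero, one_smul]
    refine Eq.trans ?_ Finset.sum_add_distrib
    conv_lhs => rw [Matrix.matrix_eq_sum_single X]
    refine Finset.sum_congr rfl fun j _ => ?_
    rw [← Finset.sum_erase_add _ _ (Finset.mem_univ j),
      ← Finset.sum_erase_add (a := j) (f := fun k => if j = k then 0 else Matrix.single j k (X j k)) _
        (Finset.mem_univ j), if_pos rfl, add_zero]
    congr 1
    refine Finset.sum_congr rfl fun k hk => ?_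
    rw [if_neg (Finset.ne_of_mem_erase hk).symm]
  rw [hsum]
  refine add_mem (K.smul_mem _ (sum_mem fun j _ => sum_mem fun k _ => ?_))
    (sum_mem fun j _ => K.smul_mem _ (hT j j₀))
  split_ifs with hjk
  · exact K.zero_mem
  · exact h j k hjk _

/-- `su(p,q)` is simple: an ideal containing a root matrix is everything. -/
theorem suLie_le_of_rootMat_mem_of_ne {K : Submodule ℝ (Matrix (Fin p ⊕ Fin q) (Fin p ⊕ Fin q) ℂ)}
    (hK : ∀ X ∈ suLie p q, ∀ Y ∈ suLie p q, Y ∈ K → X * Y - Y * X ∈ K) {j k : Fin p ⊕ Fin q}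
    (hjk : j ≠ k) {z : ℂ} (hz : z ≠ 0) (h : rootMat j k z ∈ K) : suLie p q ≤ K := by
  have hall : ∀ {j k : Fin p ⊕ Fin q}, j ≠ k → ∀ {z : ℂ}, z ≠ 0 → rootMat j k z ∈ K →
      ∀ w, rootMat j k w ∈ K := by
    intro j k hjk z hz h w
    have h1 := hK _ (torusMat_mem j k) _ (rootMat_mem hjk z) h
    rw [torusMat_rootMat_commutator hjk] at h1
    have h2 : w = (w / z).re • z + ((w / z).im / 2) • (2 * Complex.I * z) := by
      rw [Complex.real_smul, Complex.real_smul]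
      conv_lhs => rw [← div_mul_cancel₀ w hz, ← Complex.re_add_im (w / z)]
      push_cast
      ring
    rw [h2, map_add, map_smul, map_smul]
    exact add_mem (K.smul_mem _ h) (K.smul_mem _ h1)
  have hstep : ∀ {j k : Fin p ⊕ Fin q}, j ≠ k → (∀ w, rootMat j k w ∈ K) →
      ∀ {l}, j ≠ l → ∀ w, rootMat j l w ∈ K := by
    intro j k hjk h l hl w
    by_cases hkl : k = l
    · exact hkl ▸ h w
    · have h1 := hK _ (rootMat_mem hkl (-w)) _ (rootMat_mem hjk 1) (h 1)
      rw [← neg_sub, rootMat_rootMat_commutator hjk hl hkl, one_mul, map_neg, neg_neg] at h1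
      exact h1
  have hswap : ∀ {j k : Fin p ⊕ Fin q}, (∀ w, rootMat j k w ∈ K) → ∀ w, rootMat k j w ∈ K := by
    intro j k h w
    rw [rootMat_swap]
    exact h _
  refine suLie_le_of_rootMat_mem hK j fun a b hab => ?_
  have hj : ∀ {l}, j ≠ l → ∀ w, rootMat j l w ∈ K := hstep hjk (hall hjk hz h)
  by_cases ha : j = a
  · exact hj (ha ▸ hab) |> (ha ▸ ·)
  · exact hstep (Ne.symm ha) (hswap (hj ha)) hab

end Simplicity

/-! ### Orthogonal representations of `su(2,q)` -/

section Padding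

open Module

variable {q : ℕ}

/-- The inclusion of the coordinates of `ℂ^{2,2}` into those of `ℂ^{2,q}`. -/
def padIndex (hq : 2 ≤ q) : Fin 2 ⊕ Fin 2 → Fin 2 ⊕ Fin q := Sum.map id (Fin.castLE hq)

theorem padIndex_injective (hq : 2 ≤ q) : Function.Injective (padIndex hq) :=
  Function.Injective.sumMap Function.injective_id (Fin.castLE_injective hq)

theorem sigSign_padIndex (hq : 2 ≤ q) (j : Fin 2 ⊕ Fin 2) : sigSign (padIndex hq j) = sigSign j := by
  rcases j with j | j <;> rfl

/-- The matrix of the isometric inclusion of `ℂ^{2,2}` into `ℂ^{2,q}`. -/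
def padIncl (hq : 2 ≤ q) : Matrix (Fin 2 ⊕ Fin q) (Fin 2 ⊕ Fin 2) ℂ :=
  (1 : Matrix (Fin 2 ⊕ Fin q) (Fin 2 ⊕ Fin q) ℂ).submatrix id (padIndex hq)

theorem padIncl_transpose_mul (hq : 2 ≤ q) : (padIncl hq)ᵀ * padIncl hq = 1 := by
  rw [padIncl, Matrix.transpose_submatrix, Matrix.transpose_one,
    ← Matrix.submatrix_mul _ _ _ id _ Function.bijective_id, Matrix.one_mul,
    Matrix.submatrix_one _ (padIndex_injective hq)]

theorem padIncl_conjTranspose (hq : 2 ≤ q) : (padIncl hq)ᴴ = (padIncl hq)ᵀ := by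
  rw [padIncl, Matrix.transpose_submatrix, Matrix.conjTranspose_submatrix, Matrix.transpose_one,
    Matrix.conjTranspose_one]

theorem sigMatrix_mul_padIncl (hq : 2 ≤ q) :
    sigMatrix 2 q ℂ * padIncl hq = padIncl hq * sigMatrix 2 2 ℂ := by
  rw [sigMatrix_eq_diagonal, sigMatrix_eq_diagonal]
  ext i j
  rw [Matrix.mul_diagonal, Matrix.diagonal_mul]
  by_cases h : i = padIndex hq j
  · rw [h, sigSign_padIndex, mul_comm]
  · simp [padIncl, h]

theorem padIncl_transpose_mul_sigMatrix (hq : 2 ≤ q) :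
    (padIncl hq)ᵀ * sigMatrix 2 q ℂ = sigMatrix 2 2 ℂ * (padIncl hq)ᵀ := by
  have := congrArg Matrix.transpose (sigMatrix_mul_padIncl hq)
  rwa [Matrix.transpose_mul, Matrix.transpose_mul, sigMatrix_transpose, sigMatrix_transpose] at this

/-- Extension of a `4 × 4` matrix by zero. -/
noncomputable def padMat (hq : 2 ≤ q) : Matrix (Fin 2 ⊕ Fin 2) (Fin 2 ⊕ Fin 2) ℂ →ₗ[ℝ]
    Matrix (Fin 2 ⊕ Fin q) (Fin 2 ⊕ Fin q) ℂ where
  toFun X := padIncl hq * X * (padIncl hq)ᵀ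
  map_add' X Y := by rw [Matrix.mul_add, Matrix.add_mul]
  map_smul' c X := by rw [Matrix.mul_smul, Matrix.smul_mul, RingHom.id_apply]

theorem padMat_apply (hq : 2 ≤ q) (X : Matrix (Fin 2 ⊕ Fin 2) (Fin 2 ⊕ Fin 2) ℂ) :
    padMat hq X = padIncl hq * X * (padIncl hq)ᵀ := rfl

theorem padMat_mul (hq : 2 ≤ q) (X Y : Matrix (Fin 2 ⊕ Fin 2) (Fin 2 ⊕ Fin 2) ℂ) :
    padMat hq (X * Y) = padMat hq X * padMat hq Y := by
  simp only [padMat_apply]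
  calc padIncl hq * (X * Y) * (padIncl hq)ᵀ
      = padIncl hq * X * (1 : Matrix (Fin 2 ⊕ Fin 2) (Fin 2 ⊕ Fin 2) ℂ) * Y * (padIncl hq)ᵀ := by
        rw [Matrix.mul_one, Matrix.mul_assoc _ X]
    _ = padIncl hq * X * (padIncl hq)ᵀ * (padIncl hq * Y * (padIncl hq)ᵀ) := by
        rw [← padIncl_transpose_mul hq]; simp only [Matrix.mul_assoc]

theorem padMat_mem (hq : 2 ≤ q) {X : Matrix (Fin 2 ⊕ Fin 2) (Fin 2 ⊕ Fin 2) ℂ}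
    (hX : X ∈ suLie 2 2) : padMat hq X ∈ suLie 2 q := by
  obtain ⟨hX, ht⟩ := mem_suLie.1 hX
  refine mem_suLie.2 ⟨mem_uLie.2 ?_, ?_⟩
  · rw [padMat_apply, Matrix.conjTranspose_mul, Matrix.conjTranspose_mul,
      ← padIncl_conjTranspose, Matrix.conjTranspose_conjTranspose, padIncl_conjTranspose,
      Matrix.mul_assoc, Matrix.mul_assoc, padIncl_transpose_mul_sigMatrix, ← Matrix.mul_assoc Xᴴ,
      mem_uLie.1 hX, Matrix.neg_mul, Matrix.mul_neg, ← Matrix.mul_assoc, ← Matrix.mul_assoc,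
      ← sigMatrix_mul_padIncl]
    simp only [Matrix.mul_assoc]
  · rw [padMat_apply, Matrix.trace_mul_comm, ← Matrix.mul_assoc, padIncl_transpose_mul,
      Matrix.one_mul, ht]

theorem padMat_rootMat (hq : 2 ≤ q) (j k : Fin 2 ⊕ Fin 2) (z : ℂ) :
    padMat hq (rootMat j k z) = rootMat (padIndex hq j) (padIndex hq k) z := by
  have hs : ∀ (a b : Fin 2 ⊕ Fin 2) (w : ℂ), padIncl hq * Matrix.single a b w * (padIncl hq)ᵀ =
      Matrix.single (padIndex hq a) (padIndex hq b) w := by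
    intro a b w
    have h1 : ∀ (a : Fin 2 ⊕ Fin 2) (b : Fin 2 ⊕ Fin 2) (w : ℂ),
        padIncl hq * Matrix.single a b w = Matrix.single (padIndex hq a) b w := by
      intro a b w
      ext i j
      by_cases hj : j = b
      · subst hj
        rw [Matrix.mul_single_apply_same, padIncl, Matrix.submatrix_apply, Matrix.one_apply,
          Matrix.single_apply, ite_mul, one_mul, zero_mul]
        simp [eq_comm]
      · rw [Matrix.mul_single_apply_of_ne (hbj := hj), Matrix.single_apply,
          if_neg fun h => hj h.2.symm]
    have h2 : Matrix.single (padIndex hq a) b w * (padIncl hq)ᵀ =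
        Matrix.single (padIndex hq a) (padIndex hq b) w := by
      ext i j
      by_cases hi : i = padIndex hq a
      · subst hi
        rw [Matrix.single_mul_apply_same, padIncl, Matrix.transpose_apply, Matrix.submatrix_apply,
          Matrix.one_apply, Matrix.single_apply, mul_ite, mul_one, mul_zero]
        simp [eq_comm]
      · rw [Matrix.single_mul_apply_of_ne (h := hi), Matrix.single_apply,
          if_neg fun h => hi h.1.symm]
    rw [h1, h2]
  rw [padMat_apply, rootMat_apply, Matrix.mul_sub, Matrix.sub_mul, hs, hs, rootMat_apply,
    sigSign_padIndex, sigSign_padIndex]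

theorem padMat_self (X : Matrix (Fin 2 ⊕ Fin 2) (Fin 2 ⊕ Fin 2) ℂ) : padMat le_rfl X = X := by
  have h : padIncl (le_refl 2) = 1 := by
    have : padIndex (le_refl 2) = id := by
      funext j
      rcases j with j | j <;> rfl
    rw [padIncl, this, Matrix.submatrix_id_id]
  rw [padMat_apply, h, Matrix.transpose_one, Matrix.one_mul, Matrix.mul_one]

/-- The projection of `u(2,2)` to `su(2,2)` along the scalars. -/
noncomputable def tracelessPart : Matrix (Fin 2 ⊕ Fin 2) (Fin 2 ⊕ Fin 2) ℂ →ₗ[ℝ]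
    Matrix (Fin 2 ⊕ Fin 2) (Fin 2 ⊕ Fin 2) ℂ where
  toFun X := X - (X.trace / 4) • 1
  map_add' X Y := by
    rw [Matrix.trace_add, add_div, add_smul]
    abel
  map_smul' c X := by
    rw [Matrix.trace_smul, RingHom.id_apply, smul_sub, ← smul_assoc, smul_div_assoc]

theorem tracelessPart_apply (X : Matrix (Fin 2 ⊕ Fin 2) (Fin 2 ⊕ Fin 2) ℂ) :
    tracelessPart X = X - (X.trace / 4) • 1 := rfl

theorem tracelessPart_of_trace_eq_zero {X : Matrix (Fin 2 ⊕ Fin 2) (Fin 2 ⊕ Fin 2) ℂ}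
    (hX : X.trace = 0) : tracelessPart X = X := by
  rw [tracelessPart_apply, hX, zero_div, zero_smul, sub_zero]

theorem tracelessPart_mem {X : Matrix (Fin 2 ⊕ Fin 2) (Fin 2 ⊕ Fin 2) ℂ} (hX : X ∈ uLie 2 2) :
    tracelessPart X ∈ suLie 2 2 := by
  have htr : star X.trace = -X.trace := by
    have h1 : Xᴴ = -(sigMatrix 2 2 ℂ * X * sigMatrix 2 2 ℂ) := by
      rw [← Matrix.neg_mul, ← mem_uLie.1 hX, Matrix.mul_assoc, sigMatrix_mul_self, Matrix.mul_one]
    rw [← Matrix.trace_conjTranspose, h1, Matrix.trace_neg, Matrix.trace_mul_comm,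
      ← Matrix.mul_assoc, sigMatrix_mul_self, Matrix.one_mul]
  refine mem_suLie.2 ⟨sub_mem hX (mem_uLie.2 ?_), ?_⟩
  · rw [Matrix.conjTranspose_smul, Matrix.conjTranspose_one, star_div₀, htr, star_ofNat,
      Matrix.smul_mul, Matrix.mul_smul, Matrix.one_mul, Matrix.mul_one, neg_div, neg_smul]
  · rw [tracelessPart_apply, Matrix.trace_sub, Matrix.trace_smul, Matrix.trace_one]
    simp

variable {V : Type*} [AddCommGroup V] [Module ℝ V]

/-- A representation of `su(p,q)` by operators skew-adjoint for `β`. -/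
structure IsOrthogonalSURep {p q : ℕ} (β : LinearMap.BilinForm ℝ V)
    (D : Matrix (Fin p ⊕ Fin q) (Fin p ⊕ Fin q) ℂ →ₗ[ℝ] End ℝ V) : Prop where
  bracket : ∀ X ∈ suLie p q, ∀ Y ∈ suLie p q, D (X * Y - Y * X) = D X * D Y - D Y * D X
  skew : ∀ X ∈ suLie p q, ∀ v w, β (D X v) w = -β v (D X w)

variable {β : LinearMap.BilinForm ℝ V} {D : Matrix (Fin 2 ⊕ Fin q) (Fin 2 ⊕ Fin q) ℂ →ₗ[ℝ] End ℝ V}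

namespace IsOrthogonalSURep

/-- A representation of `su(2,q)` restricts to `su(2,2)`, and extends trivially to the scalars. -/
theorem restrict (hD : IsOrthogonalSURep β D) (hq : 2 ≤ q) :
    IsOrthogonalRep β (D ∘ₗ padMat hq ∘ₗ tracelessPart) where
  bracket X hX Y hY := by
    have h1 := hD.bracket _ (padMat_mem hq (tracelessPart_mem hX)) _
      (padMat_mem hq (tracelessPart_mem hY))
    rw [← padMat_mul, ← padMat_mul, ← map_sub] at h1
    refine Eq.trans ?_ h1
    change D (padMat hq _) = _
    rw [tracelessPart_of_trace_eq_zero (mem_suLie.1 (commutator_mem_suLie hX hY)).2]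
    congr 2
    simp only [tracelessPart_apply, Matrix.sub_mul, Matrix.mul_sub, Matrix.smul_mul, Matrix.mul_smul,
      Matrix.one_mul, Matrix.mul_one]
    module
  skew X hX := hD.skew _ (padMat_mem hq (tracelessPart_mem hX))
  scalar := by
    have : tracelessPart (Complex.I • 1) = 0 := by
      rw [tracelessPart_apply, Matrix.trace_smul, Matrix.trace_one]
      simp
    rw [LinearMap.comp_apply, LinearMap.comp_apply, this, map_zero, map_zero]

theorem commutator_mem_ker (hD : IsOrthogonalSURep β D) :
    ∀ X ∈ suLie 2 q, ∀ Y ∈ suLie 2 q, Y ∈ LinearMap.ker D → X * Y - Y * X ∈ LinearMap.ker D :=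
  fun X hX Y hY h => by
    rw [LinearMap.mem_ker] at h ⊢
    rw [hD.bracket X hX Y hY, h, mul_zero, zero_mul, sub_zero]

theorem lMat_one_eq : lMat 1 = rootMat (p := 2) (q := 2) (.inl 0) (.inr 0) 1 +
    rootMat (.inl 1) (.inr 1) 1 := by
  ext i j
  rcases i with i | i <;> rcases j with j | j <;> fin_cases i <;> fin_cases j <;>
    simp [lMat, rootMat_apply, sigSign] <;> norm_num

/-- A nontrivial representation of `su(2,q)` is nontrivial on the translations of `su(2,2)`, as
these generate an ideal containing the grading element `lMat 1`. -/
theorem eq_zero_of_eMat_one (hD : IsOrthogonalSURep β D) (hq : 2 ≤ q)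
    (h : (D ∘ₗ padMat hq ∘ₗ tracelessPart) (eMat 1) = 0) : ∀ X ∈ suLie 2 q, D X = 0 := by
  have h1 := (hD.restrict hq).bracket_ef Matrix.isHermitian_one Matrix.isHermitian_one
  rw [h, zero_mul, mul_zero, sub_zero, Matrix.one_mul, LinearMap.comp_apply, LinearMap.comp_apply,
    tracelessPart_of_trace_eq_zero (by simp [lMat, Matrix.trace]), lMat_one_eq, map_add,
    padMat_rootMat, padMat_rootMat] at h1
  have h2 := hD.commutator_mem_ker _ (torusMat_mem (padIndex hq (.inl 0)) (padIndex hq (.inr 0))) _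
    (add_mem (rootMat_mem ((padIndex_injective hq).ne (by simp)) 1)
      (rootMat_mem ((padIndex_injective hq).ne (by simp)) 1)) h1.symm
  rw [Matrix.mul_add, Matrix.add_mul, add_sub_add_comm,
    torusMat_rootMat_commutator ((padIndex_injective hq).ne (by simp)),
    torusMat_rootMat_commutator_of_disjoint ((padIndex_injective hq).ne (by simp))
      ((padIndex_injective hq).ne (by simp)) ((padIndex_injective hq).ne (by simp))
      ((padIndex_injective hq).ne (by simp)), add_zero] at h2
  exact suLie_le_of_rootMat_mem_of_ne hD.commutator_mem_ker
    ((padIndex_injective hq).ne (by simp)) (by simp) h2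

/-- For `q ≥ 3` there is an element of `su(2,q)` of weight one for the grading element of
`su(2,2)`. It acts by zero as all weights are even, and it generates `su(2,q)` as an ideal. -/
theorem eq_zero_of_three_le (hD : IsOrthogonalSURep β D) [FiniteDimensional ℝ V]
    (hβ : IsIndexTwoForm β) (hq : 3 ≤ q) : ∀ X ∈ suLie 2 q, D X = 0 := by
  have hq2 : 2 ≤ q := by lia
  have hR := hD.restrict hq2
  have hpi : ∀ j : Fin 2, padIndex hq2 (.inl j) = .inl j := fun j => rfl
  have hpr0 : padIndex hq2 (.inr 0) = .inr ⟨0, by lia⟩ := rfl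
  have hpr1 : padIndex hq2 (.inr 1) = .inr ⟨1, by lia⟩ := rfl
  set X : Matrix (Fin 2 ⊕ Fin q) (Fin 2 ⊕ Fin q) ℂ :=
    rootMat (.inl 0) (.inr ⟨2, hq⟩) 1 + rootMat (.inr ⟨0, by lia⟩) (.inr ⟨2, hq⟩) 1 with hXdef
  have hX : X ∈ suLie 2 q := add_mem (rootMat_mem (by simp) 1) (rootMat_mem (by simp) 1)
  have htr : (lMat 1).trace = 0 := by simp [lMat, Matrix.trace]
  have hH : (D ∘ₗ padMat hq2 ∘ₗ tracelessPart) (lMat 1) = D (padMat hq2 (lMat 1)) := by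
    rw [LinearMap.comp_apply, LinearMap.comp_apply, tracelessPart_of_trace_eq_zero htr]
  have hHX : padMat hq2 (lMat 1) * X - X * padMat hq2 (lMat 1) = X := by
    have h1 : (rootMat (.inl 0) (.inr ⟨0, by lia⟩) 1 : Matrix (Fin 2 ⊕ Fin q) (Fin 2 ⊕ Fin q) ℂ) =
        rootMat (.inr ⟨0, by lia⟩) (.inl 0) 1 := by
      rw [rootMat_swap]
      simp [sigSign]
    have h2 := rootMat_rootMat_commutator (p := 2) (q := q) (j := .inr ⟨0, by lia⟩) (k := .inl 0)
      (l := .inr ⟨2, hq⟩) (by simp) (by simp) (by simp) 1 1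
    have h3 := rootMat_rootMat_commutator (p := 2) (q := q) (k := .inr ⟨0, by lia⟩) (j := .inl 0)
      (l := .inr ⟨2, hq⟩) (by simp) (by simp) (by simp) 1 1
    have h4 := rootMat_rootMat_commutator_of_disjoint (p := 2) (q := q) (j := .inl 1)
      (k := .inr ⟨1, by lia⟩) (l := .inl 0) (m := .inr ⟨2, hq⟩) (by simp) (by simp) (by simp)
      (by simp) 1 1
    have h5 := rootMat_rootMat_commutator_of_disjoint (p := 2) (q := q) (j := .inl 1)
      (k := .inr ⟨1, by lia⟩) (l := .inr ⟨0, by lia⟩) (m := .inr ⟨2, hq⟩) (by simp) (by simp)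
      (by simp) (by simp) 1 1
    rw [← h1, mul_one] at h2
    rw [mul_one] at h3
    rw [lMat_one_eq, map_add, padMat_rootMat, padMat_rootMat, hpi, hpi, hpr0, hpr1, hXdef]
    have hexp : ∀ a b x y : Matrix (Fin 2 ⊕ Fin q) (Fin 2 ⊕ Fin q) ℂ,
        (a + b) * (x + y) - (x + y) * (a + b) =
          (a * y - y * a) + (a * x - x * a) + ((b * x - x * b) + (b * y - y * b)) := by
      intros
      noncomm_ring
    rw [hexp, h2, h3, h4, h5, add_zero, add_zero]
  have hw : ∀ v, D X v = 0 := by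
    have hshift : ∀ c : ℝ, ∀ v ∈ IsOrthogonalRep.weightSpace (D ∘ₗ padMat hq2 ∘ₗ tracelessPart) c,
        D X v ∈ IsOrthogonalRep.weightSpace (D ∘ₗ padMat hq2 ∘ₗ tracelessPart) (c + 1) := by
      intro c v hv
      refine mem_maxGenEigenspace_shift ?_ hv
      rw [hH, ← hD.bracket _ (padMat_mem hq2 (mem_suLie.2 ⟨lMat_mem 1, htr⟩)) _ hX, hHX, one_smul]
    have htop : ∀ v, v ∈ ⨆ c, IsOrthogonalRep.weightSpace (D ∘ₗ padMat hq2 ∘ₗ tracelessPart) c := by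
      rw [hR.iSup_weightSpace]
      exact fun v => Submodule.mem_top
    intro v
    have hle : ⨆ c, IsOrthogonalRep.weightSpace (D ∘ₗ padMat hq2 ∘ₗ tracelessPart) c ≤
        LinearMap.ker (D X) := by
      refine iSup_le fun c v hv => ?_
      by_cases hc : c = 0 ∨ c = 2 ∨ c = -2
      · have h1 := hshift c v hv
        rw [hR.weightSpace_eq_bot hβ] at h1
        · exact h1
        all_goals rcases hc with rfl | rfl | rfl <;> norm_num
      · rw [not_or, not_or] at hc
        rw [hR.weightSpace_eq_bot hβ hc.1 hc.2.1 hc.2.2, Submodule.mem_bot] at hv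
        rw [hv]
        exact zero_mem _
    exact hle (htop v)
  have h2 := hD.commutator_mem_ker _ (torusMat_mem (.inl 0) (.inl 1)) X hX (LinearMap.ext hw)
  rw [hXdef, Matrix.mul_add, Matrix.add_mul, add_sub_add_comm,
    torusMat_rootMat_commutator' (by simp) (by simp) (by simp),
    torusMat_rootMat_commutator_of_disjoint (by simp) (by simp) (by simp) (by simp), add_zero,
    mul_one] at h2
  exact suLie_le_of_rootMat_mem_of_ne hD.commutator_mem_ker (by simp) Complex.I_ne_zero h2

end IsOrthogonalSURep

end Padding

/-! ### The differential of a homomorphism to `SO(p,q)` -/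

section Bridge

open Module

variable {p q : ℕ}

/-- The standard form of signature `(p,q)`, as a bilinear form. -/
noncomputable def sigBilin (p q : ℕ) : LinearMap.BilinForm ℝ (Fin p ⊕ Fin q → ℝ) :=
  Matrix.toBilin' (sigMatrix p q ℝ)

theorem sigBilin_apply (v w : Fin p ⊕ Fin q → ℝ) : sigBilin p q v w = sigForm v w :=
  Matrix.toBilin'_apply' _ _ _

theorem sigForm_eq (v w : Fin p ⊕ Fin q → ℝ) :
    sigForm v w = ∑ i, v (.inl i) * w (.inl i) - ∑ i, v (.inr i) * w (.inr i) := by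
  rw [sigForm, sigMatrix, LieAlgebra.Orthogonal.indefiniteDiagonal]
  simp [dotProduct, Matrix.mulVec_diagonal, sub_eq_add_neg]

theorem isIndexTwoForm_sigBilin (n : ℕ) : IsIndexTwoForm (sigBilin 2 n) where
  symm v w := by
    rw [sigBilin_apply, sigBilin_apply, sigForm_eq, sigForm_eq]
    simp only [mul_comm]
  nondeg v h := by
    have h1 : sigMatrix 2 n ℝ *ᵥ (sigMatrix 2 n ℝ *ᵥ v) = v := by
      rw [Matrix.mulVec_mulVec, sigMatrix_mul_self, Matrix.one_mulVec]
    have h2 := h (sigMatrix 2 n ℝ *ᵥ v)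
    rw [sigBilin_apply, sigForm, h1] at h2
    exact dotProduct_self_eq_zero.1 h2
  index P hP := by
    let T : P →ₗ[ℝ] (Fin 2 → ℝ) := LinearMap.funLeft ℝ ℝ Sum.inl ∘ₗ P.subtype
    have hT : Function.Injective T := by
      rw [← LinearMap.ker_eq_bot, LinearMap.ker_eq_bot']
      intro v hv
      have h1 : ∀ i, (v : Fin 2 ⊕ Fin n → ℝ) (.inl i) = 0 := fun i => congrFun hv i
      have h2 := hP v v.2
      rw [sigBilin_apply, sigForm_eq] at h2
      simp only [h1, mul_zero, Finset.sum_const_zero, zero_sub] at h2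
      have h3 := (Finset.sum_eq_zero_iff_of_nonneg fun i _ =>
        mul_self_nonneg ((v : Fin 2 ⊕ Fin n → ℝ) (.inr i))).1
          (le_antisymm (by linarith) (Finset.sum_nonneg fun i _ => mul_self_nonneg _))
      refine Subtype.ext (funext fun i => ?_)
      rcases i with i | i
      · exact h1 i
      · exact mul_self_eq_zero.1 (h3 i (Finset.mem_univ i))
    have := LinearMap.finrank_le_finrank_of_injective hT
    simpa using this

/-- The underlying matrix of an element of `SO(p,q)`. -/
def soMat : SOpq p q →* Matrix (Fin p ⊕ Fin q) (Fin p ⊕ Fin q) ℝ where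
  toFun g := ((g : Matrix.SpecialLinearGroup (Fin p ⊕ Fin q) ℝ) :
    Matrix (Fin p ⊕ Fin q) (Fin p ⊕ Fin q) ℝ)
  map_one' := rfl
  map_mul' _ _ := rfl

theorem soAct_eq (g : SOpq p q) (v : Fin p ⊕ Fin q → ℝ) : soAct g v = soMat g *ᵥ v := rfl

theorem soMat_injective : Function.Injective (soMat : SOpq p q → _) := fun _ _ h =>
  Subtype.ext (Subtype.ext h)

theorem soMat_form (g : SOpq p q) : (soMat g)ᵀ * sigMatrix p q ℝ * soMat g = sigMatrix p q ℝ := g.2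

theorem soMat_isInducing : Topology.IsInducing (soMat : SOpq p q → _) :=
  (Topology.IsInducing.subtypeVal
    (t := {M : Matrix (Fin p ⊕ Fin q) (Fin p ⊕ Fin q) ℝ | M.det = 1})).comp
    Topology.IsInducing.subtypeVal

open scoped Matrix.Norms.Operator in
/-- An infinitesimal isometry is skew-adjoint. -/
theorem transpose_mul_sigMatrix_of_exp {A : Matrix (Fin p ⊕ Fin q) (Fin p ⊕ Fin q) ℝ}
    (hA : ∀ t : ℝ, (NormedSpace.exp (t • A))ᵀ * sigMatrix p q ℝ * NormedSpace.exp (t • A) =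
      sigMatrix p q ℝ) : Aᵀ * sigMatrix p q ℝ = -(sigMatrix p q ℝ * A) := by
  have hJ := sigMatrix_mul_self p q ℝ
  have h : sigMatrix p q ℝ * Aᵀ * sigMatrix p q ℝ = -A := by
    refine eq_of_exp_smul_eq fun t => ?_
    have h1 : NormedSpace.exp (t • Aᵀ) * sigMatrix p q ℝ = sigMatrix p q ℝ *
        NormedSpace.exp (t • (sigMatrix p q ℝ * Aᵀ * sigMatrix p q ℝ)) :=
      exp_mul_eq_mul_exp (𝕜 := ℝ) (by
        rw [mul_smul_comm, ← Matrix.mul_assoc, ← Matrix.mul_assoc, hJ, Matrix.one_mul,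
          smul_mul_assoc])
    have h2 := hA t
    rw [← Matrix.exp_transpose, Matrix.transpose_smul, h1] at h2
    have h3 : NormedSpace.exp (t • (sigMatrix p q ℝ * Aᵀ * sigMatrix p q ℝ)) *
        NormedSpace.exp (t • A) = 1 := by
      have := congrArg (sigMatrix p q ℝ * ·) h2
      simpa only [← Matrix.mul_assoc, hJ, Matrix.one_mul] using this
    have h4 := exp_mul_exp_neg (t • A)
    rw [← smul_neg] at h4
    exact left_inv_eq_right_inv h3 h4
  have h1 := congrArg (sigMatrix p q ℝ * ·) h
  simp only [← Matrix.mul_assoc, hJ, Matrix.one_mul, Matrix.mul_neg] at h1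
  exact h1

theorem isOrthogonalSURep_of_differential {m n : ℕ} {ρ : SUpq p q →* SOpq m n}
    {D : Matrix (Fin p ⊕ Fin q) (Fin p ⊕ Fin q) ℂ →ₗ[ℝ] Matrix (Fin m ⊕ Fin n) (Fin m ⊕ Fin n) ℝ}
    (hD : ∀ X : suLie p q, soMat (ρ (expSU X)) = NormedSpace.exp (D X))
    (hb : ∀ X ∈ suLie p q, ∀ Y ∈ suLie p q, D (X * Y - Y * X) = D X * D Y - D Y * D X) :
    IsOrthogonalSURep (sigBilin m n) (Matrix.toLin'.toLinearMap ∘ₗ D) where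
  bracket X hX Y hY := by
    rw [LinearMap.comp_apply, hb X hX Y hY]
    simp [Matrix.toLin'_mul, Module.End.mul_eq_comp]
  skew X hX v w := by
    have h1 : (D X)ᵀ * sigMatrix m n ℝ = -(sigMatrix m n ℝ * D X) := by
      refine transpose_mul_sigMatrix_of_exp fun t => ?_
      have h2 := hD (t • ⟨X, hX⟩)
      rw [Submodule.coe_smul, map_smul] at h2
      rw [← h2]
      exact soMat_form _
    simp only [LinearMap.comp_apply, LinearEquiv.coe_coe, Matrix.toLin'_apply, sigBilin_apply,
      sigForm]
    rw [Matrix.mulVec_mulVec, ← neg_neg (sigMatrix m n ℝ * D X), ← h1, Matrix.neg_mulVec,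
      dotProduct_neg, neg_neg, ← Matrix.mulVec_mulVec, Matrix.dotProduct_mulVec _ (D X)ᵀ,
      Matrix.vecMul_transpose]

theorem exists_orthogonal_differential {m n : ℕ} (ρ : SUpq p q →* SOpq m n) (hρ : Continuous ρ) :
    ∃ D : Matrix (Fin p ⊕ Fin q) (Fin p ⊕ Fin q) ℂ →ₗ[ℝ] Matrix (Fin m ⊕ Fin n) (Fin m ⊕ Fin n) ℝ,
      (∀ X : suLie p q, soMat (ρ (expSU X)) = NormedSpace.exp (D X)) ∧
      IsOrthogonalSURep (sigBilin m n) (Matrix.toLin'.toLinearMap ∘ₗ D) := by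
  obtain ⟨D, h1, h2⟩ := exists_differential (soMat.comp ρ) (soMat_isInducing.continuous.comp hρ)
  exact ⟨D, h1, isOrthogonalSURep_of_differential h1 h2⟩

theorem eq_one_of_differential_eq_zero {m n : ℕ} (i₀ : Fin p ⊕ Fin q) {ρ : SUpq p q →* SOpq m n}
    {D : Matrix (Fin p ⊕ Fin q) (Fin p ⊕ Fin q) ℂ →ₗ[ℝ] Matrix (Fin m ⊕ Fin n) (Fin m ⊕ Fin n) ℝ}
    (hD : ∀ X : suLie p q, soMat (ρ (expSU X)) = NormedSpace.exp (D X))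
    (h0 : ∀ X ∈ suLie p q, (Matrix.toLin'.toLinearMap ∘ₗ D) X = 0) : ρ = 1 := by
  refine MonoidHom.eq_of_eqOn_dense (closure_range_expSU i₀) ?_
  rintro _ ⟨X, rfl⟩
  refine soMat_injective ?_
  have h1 : D X = 0 := Matrix.toLin'.map_eq_zero_iff.1 (h0 X X.2)
  rw [hD, h1, MonoidHom.one_apply, map_one, NormedSpace.exp_zero]

theorem eq_two_of_ne_one {q n : ℕ} (hq : 2 ≤ q) (ρ : SUpq 2 q →* SOpq 2 n) (hρ : Continuous ρ)
    (hne : ρ ≠ 1) : q = 2 := by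
  by_contra h2
  obtain ⟨D, hD, hrep⟩ := exists_orthogonal_differential ρ hρ
  exact hne (eq_one_of_differential_eq_zero (.inl 0) hD
    (hrep.eq_zero_of_three_le (isIndexTwoForm_sigBilin n) (by lia)))

end Bridge

/-! ### The exceptional isomorphism `su(2,2) ≅ so(2,4)` -/

section Isogeny

/-- A vector `(a, z, w)` of `ℝ^{2,4} = ℂ × ℂ × ℂ`, as the alternating `4 × 4` matrix with entries
`a, z, w, -w̄, z̄, ā` above the diagonal. Its Pfaffian is `|a|² - |z|² - |w|²`. -/
noncomputable def altMat : (Fin 2 ⊕ Fin 4 → ℝ) →ₗ[ℝ] Matrix (Fin 2 ⊕ Fin 2) (Fin 2 ⊕ Fin 2) ℂ where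
  toFun v :=
    Matrix.fromBlocks
      !![0, ⟨v (.inl 0), v (.inl 1)⟩; -⟨v (.inl 0), v (.inl 1)⟩, 0]
      !![⟨v (.inr 0), v (.inr 1)⟩, ⟨v (.inr 2), v (.inr 3)⟩;
        ⟨-v (.inr 2), v (.inr 3)⟩, ⟨v (.inr 0), -v (.inr 1)⟩]
      !![-⟨v (.inr 0), v (.inr 1)⟩, -⟨-v (.inr 2), v (.inr 3)⟩;
        -⟨v (.inr 2), v (.inr 3)⟩, -⟨v (.inr 0), -v (.inr 1)⟩]
      !![0, ⟨v (.inl 0), -v (.inl 1)⟩; -⟨v (.inl 0), -v (.inl 1)⟩, 0]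
  map_add' v w := by
    ext i j
    rcases i with i | i <;> rcases j with j | j <;> fin_cases i <;> fin_cases j <;>
      apply Complex.ext <;> simp [add_comm]
  map_smul' c v := by
    ext i j
    rcases i with i | i <;> rcases j with j | j <;> fin_cases i <;> fin_cases j <;>
      apply Complex.ext <;> simp

theorem altMat_apply (v : Fin 2 ⊕ Fin 4 → ℝ) : altMat v = Matrix.fromBlocks
      !![0, ⟨v (.inl 0), v (.inl 1)⟩; -⟨v (.inl 0), v (.inl 1)⟩, 0]
      !![⟨v (.inr 0), v (.inr 1)⟩, ⟨v (.inr 2), v (.inr 3)⟩;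
        ⟨-v (.inr 2), v (.inr 3)⟩, ⟨v (.inr 0), -v (.inr 1)⟩]
      !![-⟨v (.inr 0), v (.inr 1)⟩, -⟨-v (.inr 2), v (.inr 3)⟩;
        -⟨v (.inr 2), v (.inr 3)⟩, -⟨v (.inr 0), -v (.inr 1)⟩]
      !![0, ⟨v (.inl 0), -v (.inl 1)⟩; -⟨v (.inl 0), -v (.inl 1)⟩, 0] := rfl

/-- The vector with a given alternating matrix. -/
noncomputable def altCoord (S : Matrix (Fin 2 ⊕ Fin 2) (Fin 2 ⊕ Fin 2) ℂ) : Fin 2 ⊕ Fin 4 → ℝ :=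
  Sum.elim ![(S (.inl 0) (.inl 1)).re, (S (.inl 0) (.inl 1)).im]
    ![(S (.inl 0) (.inr 0)).re, (S (.inl 0) (.inr 0)).im, (S (.inl 0) (.inr 1)).re,
      (S (.inl 0) (.inr 1)).im]

theorem altCoord_altMat (v : Fin 2 ⊕ Fin 4 → ℝ) : altCoord (altMat v) = v := by
  funext i
  rcases i with i | i <;> fin_cases i <;> simp [altCoord, altMat_apply]

theorem altMat_injective : Function.Injective altMat :=
  Function.LeftInverse.injective altCoord_altMat

theorem continuous_altCoord : Continuous altCoord := by
  refine continuous_pi fun i => ?_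
  rcases i with i | i <;> fin_cases i <;> simp only [altCoord] <;> dsimp <;> fun_prop

/-- The element of `su(2,2)` acting on alternating matrices by `S ↦ X S + S Xᵀ` as the element `Y` of
`so(2,4)` acts on vectors. -/
noncomputable def soToSu (Y : Matrix (Fin 2 ⊕ Fin 4) (Fin 2 ⊕ Fin 4) ℝ) :
    Matrix (Fin 2 ⊕ Fin 2) (Fin 2 ⊕ Fin 2) ℂ :=
  let p := fun k => Y (.inl 0) (.inr k)
  let q := fun k => Y (.inl 1) (.inr k)
  let e := fun k => Y (.inr 0) (.inr k)
  let f := fun k => Y (.inr 1) (.inr k)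
  let α := (Y (.inl 1) (.inl 0) + Y (.inr 1) (.inr 0) + Y (.inr 3) (.inr 2)) / 2
  Matrix.fromBlocks
    !![⟨0, α⟩, ⟨(-e 2 + f 3) / 2, (-f 2 - e 3) / 2⟩;
      ⟨-(-e 2 + f 3) / 2, (-f 2 - e 3) / 2⟩, ⟨0, Y (.inl 1) (.inl 0) - α⟩]
    !![⟨(p 2 - q 3) / 2, (q 2 + p 3) / 2⟩, ⟨(-p 0 + q 1) / 2, (-q 0 - p 1) / 2⟩;
      ⟨(p 0 + q 1) / 2, (q 0 - p 1) / 2⟩, ⟨(p 2 + q 3) / 2, (q 2 - p 3) / 2⟩]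
    !![⟨(p 2 - q 3) / 2, -(q 2 + p 3) / 2⟩, ⟨(p 0 + q 1) / 2, -(q 0 - p 1) / 2⟩;
      ⟨(-p 0 + q 1) / 2, -(-q 0 - p 1) / 2⟩, ⟨(p 2 + q 3) / 2, -(q 2 - p 3) / 2⟩]
    !![⟨0, Y (.inr 1) (.inr 0) - α⟩, ⟨(e 2 + f 3) / 2, (f 2 - e 3) / 2⟩;
      ⟨-(e 2 + f 3) / 2, (f 2 - e 3) / 2⟩, ⟨0, Y (.inr 3) (.inr 2) - α⟩]

theorem soToSu_mem (Y : Matrix (Fin 2 ⊕ Fin 4) (Fin 2 ⊕ Fin 4) ℝ) : soToSu Y ∈ suLie 2 2 := by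
  refine mem_suLie.2 ⟨mem_uLie.2 ?_, ?_⟩
  · rw [sigMatrix_eq_fromBlocks]
    ext i j
    rcases i with i | i <;> rcases j with j | j <;> fin_cases i <;> fin_cases j <;>
      apply Complex.ext <;>
        simp [soToSu, Matrix.fromBlocks_multiply, Matrix.fromBlocks_conjTranspose] <;> ring
  · apply Complex.ext <;> simp [soToSu, Matrix.trace]
    ring

theorem altMat_transpose (v : Fin 2 ⊕ Fin 4 → ℝ) : (altMat v)ᵀ = -altMat v := by
  ext i j
  rcases i with i | i <;> rcases j with j | j <;> fin_cases i <;> fin_cases j <;>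
    simp [altMat_apply]

set_option maxHeartbeats 1000000 in
theorem soToSu_equivariant {Y : Matrix (Fin 2 ⊕ Fin 4) (Fin 2 ⊕ Fin 4) ℝ}
    (hY : Yᵀ * sigMatrix 2 4 ℝ = -(sigMatrix 2 4 ℝ * Y)) (v : Fin 2 ⊕ Fin 4 → ℝ) :
    soToSu Y * altMat v + altMat v * (soToSu Y)ᵀ = altMat (Y *ᵥ v) := by
  have hent : ∀ i j, Y j i * (Sum.elim 1 (-1) : Fin 2 ⊕ Fin 4 → ℝ) j =
      -((Sum.elim 1 (-1) : Fin 2 ⊕ Fin 4 → ℝ) i * Y i j) := by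
    intro i j
    have := congrFun (congrFun hY i) j
    rw [sigMatrix, LieAlgebra.Orthogonal.indefiniteDiagonal, Matrix.mul_diagonal, Matrix.neg_apply,
      Matrix.diagonal_mul] at this
    rcases i with i | i <;> rcases j with j | j <;> simpa using this
  have hl : ∀ i j, Y (.inl j) (.inl i) = -Y (.inl i) (.inl j) := fun i j => by
    simpa using hent (.inl i) (.inl j)
  have hr : ∀ i j, Y (.inr j) (.inr i) = -Y (.inr i) (.inr j) := fun i j => by
    simpa [neg_eq_iff_eq_neg] using hent (.inr i) (.inr j)
  have hlr : ∀ i j, Y (.inr j) (.inl i) = Y (.inl i) (.inr j) := fun i j => by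
    simpa using hent (.inl i) (.inr j)
  have hl0 : ∀ i, Y (.inl i) (.inl i) = 0 := fun i => by linarith [hl i i]
  have hr0 : ∀ i, Y (.inr i) (.inr i) = 0 := fun i => by linarith [hr i i]
  have hmul : ∀ i, (Y *ᵥ v) i = Y i (.inl 0) * v (.inl 0) + Y i (.inl 1) * v (.inl 1) +
      (Y i (.inr 0) * v (.inr 0) + Y i (.inr 1) * v (.inr 1) + Y i (.inr 2) * v (.inr 2) +
        Y i (.inr 3) * v (.inr 3)) := by
    intro i
    simp [Matrix.mulVec, dotProduct, Fin.sum_univ_four]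
  have hT : altMat v * (soToSu Y)ᵀ = -(soToSu Y * altMat v)ᵀ := by
    rw [Matrix.transpose_mul, altMat_transpose, Matrix.neg_mul, neg_neg]
  rw [hT, ← sub_eq_add_neg, altMat_apply, altMat_apply, soToSu, Matrix.fromBlocks_multiply,
    Matrix.fromBlocks_transpose, sub_eq_add_neg, Matrix.fromBlocks_neg, Matrix.fromBlocks_add,
    Matrix.fromBlocks_inj]
  simp only [Matrix.mul_fin_two]
  refine ⟨?_, ?_, ?_, ?_⟩ <;> ext i j <;> fin_cases i <;> fin_cases j <;> apply Complex.ext <;>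
    simp [hmul, hlr, hl0, hr0, hl 0 1, hr 0 1, hr 2 3, hr 0 2, hr 0 3, hr 1 2, hr 1 3] <;> ring

theorem exists_soToSu_eq {X : Matrix (Fin 2 ⊕ Fin 2) (Fin 2 ⊕ Fin 2) ℂ} (hX : X ∈ suLie 2 2) :
    ∃ Y : Matrix (Fin 2 ⊕ Fin 4) (Fin 2 ⊕ Fin 4) ℝ,
      Yᵀ * sigMatrix 2 4 ℝ = -(sigMatrix 2 4 ℝ * Y) ∧ soToSu Y = X := by
  obtain ⟨hX, ht⟩ := mem_suLie.1 hX
  obtain ⟨A, B, C, D, rfl⟩ : ∃ A B C D, X = Matrix.fromBlocks A B C D :=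
    ⟨_, _, _, _, (Matrix.fromBlocks_toBlocks X).symm⟩
  rw [mem_uLie, sigMatrix_eq_fromBlocks, Matrix.fromBlocks_conjTranspose,
    Matrix.fromBlocks_multiply, Matrix.fromBlocks_multiply, Matrix.fromBlocks_neg,
    Matrix.fromBlocks_inj] at hX
  simp only [Matrix.mul_one, Matrix.mul_zero, Matrix.one_mul, Matrix.zero_mul, add_zero, zero_add,
    Matrix.mul_neg, Matrix.neg_mul, neg_neg, neg_inj] at hX
  obtain ⟨hA, -, hC, hD⟩ := hX
  have hA' := fun i j => congrFun (congrFun hA i) j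
  have hD' := fun i j => congrFun (congrFun hD i) j
  subst hC
  have hA00 := hA' 0 0
  have hA11 := hA' 1 1
  have hA01 := hA' 1 0
  have hD00 := hD' 0 0
  have hD11 := hD' 1 1
  have hD01 := hD' 1 0
  simp [Complex.ext_iff] at hA00 hA11 hA01 hD00 hD11 hD01
  simp [Matrix.trace, Complex.ext_iff] at ht
  refine ⟨Matrix.fromBlocks !![0, -(A 0 0 + A 1 1).im; (A 0 0 + A 1 1).im, 0]
    !![(B 1 0 - B 0 1).re, -(B 1 0 + B 0 1).im, (B 0 0 + B 1 1).re, -(B 1 1 - B 0 0).im;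
      (B 1 0 - B 0 1).im, (B 1 0 + B 0 1).re, (B 0 0 + B 1 1).im, (B 1 1 - B 0 0).re]
    !![(B 1 0 - B 0 1).re, (B 1 0 - B 0 1).im; -(B 1 0 + B 0 1).im, (B 1 0 + B 0 1).re;
      (B 0 0 + B 1 1).re, (B 0 0 + B 1 1).im; -(B 1 1 - B 0 0).im, (B 1 1 - B 0 0).re]
    !![0, -(A 0 0 + D 0 0).im, (D 0 1 - A 0 1).re, -(D 0 1 + A 0 1).im;
      (A 0 0 + D 0 0).im, 0, (D 0 1 - A 0 1).im, (D 0 1 + A 0 1).re;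
      -(D 0 1 - A 0 1).re, -(D 0 1 - A 0 1).im, 0, -(A 0 0 + D 1 1).im;
      (D 0 1 + A 0 1).im, -(D 0 1 + A 0 1).re, (A 0 0 + D 1 1).im, 0], ?_, ?_⟩
  · rw [sigMatrix_eq_fromBlocks, Matrix.fromBlocks_transpose, Matrix.fromBlocks_multiply,
      Matrix.fromBlocks_multiply, Matrix.fromBlocks_neg, Matrix.fromBlocks_inj]
    simp only [Matrix.mul_one, Matrix.mul_zero, Matrix.one_mul, Matrix.zero_mul, add_zero, zero_add,
      Matrix.mul_neg, Matrix.neg_mul, neg_neg, neg_inj]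
    refine ⟨?_, ?_, ?_, ?_⟩ <;> ext i j <;> fin_cases i <;> fin_cases j <;> simp
  · rw [soToSu, Matrix.fromBlocks_inj]
    refine ⟨?_, ?_, ?_, ?_⟩ <;> ext i j <;> fin_cases i <;> fin_cases j <;>
      apply Complex.ext <;> simp <;> linarith

end Isogeny

/-! ### The isogeny `SU(2,2) → SO(2,4)` -/

section Isogeny

section Calculus

open scoped Matrix.Norms.Operator
open Filter Topology

/-- Infinitesimal equivariance of `altMat` integrates to equivariance. -/
theorem exp_mul_altMat_mul_exp {X : Matrix (Fin 2 ⊕ Fin 2) (Fin 2 ⊕ Fin 2) ℂ}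
    {Y : Matrix (Fin 2 ⊕ Fin 4) (Fin 2 ⊕ Fin 4) ℝ}
    (h : ∀ v, X * altMat v + altMat v * Xᵀ = altMat (Y *ᵥ v)) (v : Fin 2 ⊕ Fin 4 → ℝ) :
    NormedSpace.exp X * altMat v * (NormedSpace.exp X)ᵀ = altMat (NormedSpace.exp Y *ᵥ v) := by
  let L : Matrix (Fin 2 ⊕ Fin 4) (Fin 2 ⊕ Fin 4) ℝ →ₗ[ℝ]
      Matrix (Fin 2 ⊕ Fin 2) (Fin 2 ⊕ Fin 2) ℂ :=
    altMat ∘ₗ (Matrix.mulVecBilin ℝ ℝ).flip v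
  have hL : ∀ M, L M = altMat (M *ᵥ v) := fun M => rfl
  have hc : Continuous L := L.continuous_of_finiteDimensional
  have hd : ∀ t : ℝ, HasDerivAt (fun t : ℝ => NormedSpace.exp (t • (-X)) *
      L (NormedSpace.exp (t • Y)) * NormedSpace.exp (t • (-Xᵀ))) 0 t := by
    intro t
    have h1 := hasDerivAt_exp_smul_const (𝕂 := ℝ) (-X) t
    have h2 : HasDerivAt (fun t : ℝ => L (NormedSpace.exp (t • Y)))
        (L (Y * NormedSpace.exp (t • Y))) t :=
      ((⟨L, hc⟩ : _ →L[ℝ] Matrix (Fin 2 ⊕ Fin 2) (Fin 2 ⊕ Fin 2) ℂ).hasFDerivAt).comp_hasDerivAt t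
        (hasDerivAt_exp_smul_const' (𝕂 := ℝ) Y t)
    have h3 := hasDerivAt_exp_smul_const' (𝕂 := ℝ) (-Xᵀ) t
    refine ((h1.mul h2).mul h3).congr_deriv ?_
    have h4 : L (Y * NormedSpace.exp (t • Y)) = X * L (NormedSpace.exp (t • Y)) +
        L (NormedSpace.exp (t • Y)) * Xᵀ := by
      rw [hL, hL, h, Matrix.mulVec_mulVec]
    simp only [Pi.mul_apply]
    rw [h4]
    noncomm_ring
  have hconst := is_const_of_deriv_eq_zero (fun t => (hd t).differentiableAt)
    (fun t => (hd t).deriv) 1 0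
  simp only [one_smul, zero_smul, NormedSpace.exp_zero, one_mul, mul_one, hL,
    Matrix.one_mulVec] at hconst
  have h1 := exp_mul_exp_neg X
  have h2 := exp_mul_exp_neg (-Xᵀ)
  rw [neg_neg] at h2
  rw [← hconst, ← Matrix.exp_transpose]
  have hcancel : ∀ E E' M F F' : Matrix (Fin 2 ⊕ Fin 2) (Fin 2 ⊕ Fin 2) ℂ,
      E * E' = 1 → F' * F = 1 → E * (E' * M * F') * F = M := by
    intro E E' M F F' hE hF
    calc _ = (E * E') * M * (F' * F) := by noncomm_ring
      _ = M := by rw [hE, hF, one_mul, mul_one]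
  exact hcancel _ _ _ _ _ h1 h2

/-- The elements of `SO(p,q)` near `1` are exponentials of skew-adjoint matrices: their small
logarithms are skew-adjoint as small logarithms are unique. -/
theorem eventually_exists_soMat_eq_exp (p q : ℕ) : ∀ᶠ h : SOpq p q in 𝓝 1,
    ∃ Y : Matrix (Fin p ⊕ Fin q) (Fin p ⊕ Fin q) ℝ,
      Yᵀ * sigMatrix p q ℝ = -(sigMatrix p q ℝ * Y) ∧ soMat h = NormedSpace.exp Y := by
  have he : HasStrictFDerivAt (NormedSpace.exp : Matrix (Fin p ⊕ Fin q) (Fin p ⊕ Fin q) ℝ → _)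
      ((ContinuousLinearEquiv.refl ℝ (Matrix (Fin p ⊕ Fin q) (Fin p ⊕ Fin q) ℝ) :
        Matrix (Fin p ⊕ Fin q) (Fin p ⊕ Fin q) ℝ ≃L[ℝ] _) :
        Matrix (Fin p ⊕ Fin q) (Fin p ⊕ Fin q) ℝ →L[ℝ] _) 0 :=
    hasStrictFDerivAt_exp_zero
  set lg := he.localInverse NormedSpace.exp _ 0
  have hleft : ∀ᶠ Y in 𝓝 (0 : Matrix (Fin p ⊕ Fin q) (Fin p ⊕ Fin q) ℝ),
      lg (NormedSpace.exp Y) = Y := he.eventually_left_inverse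
  have hJ := sigMatrix_mul_self p q ℝ
  have hcont : Tendsto (fun Y : Matrix (Fin p ⊕ Fin q) (Fin p ⊕ Fin q) ℝ =>
      sigMatrix p q ℝ * Yᵀ * sigMatrix p q ℝ) (𝓝 0) (𝓝 0) := by
    have h1 : Continuous (fun Y : Matrix (Fin p ⊕ Fin q) (Fin p ⊕ Fin q) ℝ =>
      sigMatrix p q ℝ * Yᵀ * sigMatrix p q ℝ) := by fun_prop
    have h2 := h1.tendsto 0
    simpa using h2
  have hneg : Tendsto (fun Y : Matrix (Fin p ⊕ Fin q) (Fin p ⊕ Fin q) ℝ => -Y) (𝓝 0) (𝓝 0) := by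
    have h2 := (continuous_neg (G := Matrix (Fin p ⊕ Fin q) (Fin p ⊕ Fin q) ℝ)).tendsto 0
    simpa using h2
  have hmap : map NormedSpace.exp (𝓝 (0 : Matrix (Fin p ⊕ Fin q) (Fin p ⊕ Fin q) ℝ)) = 𝓝 1 :=
    he.map_nhds_eq_of_equiv.trans (by rw [NormedSpace.exp_zero]; rfl)
  have hS : ∀ᶠ M in 𝓝 (1 : Matrix (Fin p ⊕ Fin q) (Fin p ⊕ Fin q) ℝ), ∃ Y,
      M = NormedSpace.exp Y ∧ lg (NormedSpace.exp (-Y)) = -Y ∧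
        lg (NormedSpace.exp (sigMatrix p q ℝ * Yᵀ * sigMatrix p q ℝ)) =
          sigMatrix p q ℝ * Yᵀ * sigMatrix p q ℝ := by
    rw [← hmap, eventually_map]
    filter_upwards [hneg.eventually hleft, hcont.eventually hleft] with Y h1 h2
    exact ⟨Y, rfl, h1, h2⟩
  have hso : Tendsto (soMat : SOpq p q → _) (𝓝 1) (𝓝 1) := by
    have := soMat_isInducing.continuous.tendsto (1 : SOpq p q)
    rwa [map_one] at this
  filter_upwards [hso.eventually hS] with h hh
  obtain ⟨Y, hY, h1, h2⟩ := hh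
  refine ⟨Y, ?_, hY⟩
  have h3 : NormedSpace.exp Yᵀ * sigMatrix p q ℝ = sigMatrix p q ℝ *
      NormedSpace.exp (sigMatrix p q ℝ * Yᵀ * sigMatrix p q ℝ) :=
    exp_mul_eq_mul_exp (𝕜 := ℝ) (by
      rw [← Matrix.mul_assoc, ← Matrix.mul_assoc, hJ, Matrix.one_mul])
  have h4 := soMat_form h
  rw [hY, ← Matrix.exp_transpose, h3] at h4
  have h5 : NormedSpace.exp (sigMatrix p q ℝ * Yᵀ * sigMatrix p q ℝ) = NormedSpace.exp (-Y) := by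
    have h6 := congrArg (sigMatrix p q ℝ * ·) h4
    simp only [← Matrix.mul_assoc, hJ, Matrix.one_mul] at h6
    exact left_inv_eq_right_inv h6 (exp_mul_exp_neg Y)
  have h6 : sigMatrix p q ℝ * Yᵀ * sigMatrix p q ℝ = -Y := by rw [← h2, h5, h1]
  have h7 := congrArg (sigMatrix p q ℝ * ·) h6
  simp only [← Matrix.mul_assoc, hJ, Matrix.one_mul, Matrix.mul_neg] at h7
  exact h7

/-- Conversely the exponential of a skew-adjoint matrix lies in `SO(p,q)`. Its determinant is
one: it is the square of `det (exp (Y / 2))`, which is `±1` as `exp (Y / 2)` preserves the form. -/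
theorem exists_soMat_eq_exp {p q : ℕ} {Y : Matrix (Fin p ⊕ Fin q) (Fin p ⊕ Fin q) ℝ}
    (hY : Yᵀ * sigMatrix p q ℝ = -(sigMatrix p q ℝ * Y)) :
    ∃ h : SOpq p q, soMat h = NormedSpace.exp Y := by
  have hform : ∀ t : ℝ, (NormedSpace.exp (t • Y))ᵀ * sigMatrix p q ℝ * NormedSpace.exp (t • Y) =
      sigMatrix p q ℝ := by
    intro t
    rw [← Matrix.exp_transpose, exp_mul_eq_mul_exp (𝕜 := ℝ) (B := -(t • Y)) (by
      rw [Matrix.transpose_smul, smul_mul_assoc, hY, Matrix.mul_neg, mul_smul_comm, smul_neg]),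
      Matrix.mul_assoc]
    have h := exp_mul_exp_neg (-(t • Y))
    rw [neg_neg] at h
    exact (congrArg (sigMatrix p q ℝ * ·) h).trans (Matrix.mul_one _)
  have hdet : (NormedSpace.exp Y).det = 1 := by
    have h1 : NormedSpace.exp Y = NormedSpace.exp ((1 / 2 : ℝ) • Y) *
        NormedSpace.exp ((1 / 2 : ℝ) • Y) := by
      refine Eq.trans ?_ (exp_add_smul Y (1 / 2) (1 / 2))
      norm_num
      rfl
    have h2 := congrArg Matrix.det (hform (1 / 2))
    have h3 : (sigMatrix p q ℝ).det ≠ 0 := by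
      have := congrArg Matrix.det (sigMatrix_mul_self p q ℝ)
      rw [Matrix.det_mul, Matrix.det_one] at this
      exact left_ne_zero_of_mul (this.trans_ne one_ne_zero)
    rw [Matrix.det_mul, Matrix.det_mul, Matrix.det_transpose] at h2
    rw [h1, Matrix.det_mul]
    refine mul_right_cancel₀ h3 ?_
    linear_combination h2
  have h1 := hform 1
  rw [one_smul] at h1
  exact ⟨⟨⟨NormedSpace.exp Y, hdet⟩, h1⟩, rfl⟩

end Calculus

/-- The action of `SU(2,2)` on alternating matrices is by elements of `SO(2,4)`. -/
theorem exists_altMat_action (g : SUpq 2 2) : ∃ h : SOpq 2 4,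
    ∀ v, suMat g * altMat v * (suMat g)ᵀ = altMat (soMat h *ᵥ v) := by
  have hg : g ∈ Subgroup.closure (Set.range (expSU : suLie 2 2 → SUpq 2 2)) := by
    rw [closure_range_expSU (.inl 0)]
    exact Subgroup.mem_top g
  induction hg using Subgroup.closure_induction with
  | mem g hg =>
    obtain ⟨X, rfl⟩ := hg
    obtain ⟨Y, hY, hX⟩ := exists_soToSu_eq X.2
    obtain ⟨h, hh⟩ := exists_soMat_eq_exp hY
    refine ⟨h, fun v => ?_⟩
    rw [hh, suMat_expSU, ← hX]
    exact exp_mul_altMat_mul_exp (soToSu_equivariant hY) v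
  | one => exact ⟨1, fun v => by simp [suMat_one]⟩
  | mul g₁ g₂ _ _ h₁ h₂ =>
    obtain ⟨h₁, hh₁⟩ := h₁
    obtain ⟨h₂, hh₂⟩ := h₂
    refine ⟨h₁ * h₂, fun v => ?_⟩
    rw [map_mul, ← Matrix.mulVec_mulVec, ← hh₁, ← hh₂, suMat_mul, Matrix.transpose_mul]
    simp only [Matrix.mul_assoc]
  | inv g _ h =>
    obtain ⟨h, hh⟩ := h
    refine ⟨h⁻¹, fun v => ?_⟩
    have h1 := hh (soMat h⁻¹ *ᵥ v)
    rw [Matrix.mulVec_mulVec, ← map_mul, mul_inv_cancel, map_one, Matrix.one_mulVec] at h1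
    have h2 : (suMat g)ᵀ * (suMat g⁻¹)ᵀ = 1 := by
      rw [← Matrix.transpose_mul, suMat_inv_mul, Matrix.transpose_one]
    rw [← h1]
    calc _ = (suMat g⁻¹ * suMat g) * altMat (soMat h⁻¹ *ᵥ v) * ((suMat g)ᵀ * (suMat g⁻¹)ᵀ) := by
          simp only [Matrix.mul_assoc]
      _ = _ := by rw [suMat_inv_mul, h2, Matrix.one_mul, Matrix.mul_one]

theorem soMat_eq_of_altMat {h h' : SOpq 2 4}
    (H : ∀ v, altMat (soMat h *ᵥ v) = altMat (soMat h' *ᵥ v)) :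
    h = h' :=
  soMat_injective (Matrix.mulVec_injective (funext fun v => altMat_injective (H v)))

/-- The homomorphism `SU(2,2) → SO(2,4)` given by the action of `SU(2,2)` on alternating matrices. -/
noncomputable def altHom : SUpq 2 2 →* SOpq 2 4 where
  toFun g := (exists_altMat_action g).choose
  map_one' := soMat_eq_of_altMat fun v => by
    rw [← (exists_altMat_action 1).choose_spec]
    simp [suMat_one]
  map_mul' g₁ g₂ := soMat_eq_of_altMat fun v => by
    rw [← (exists_altMat_action (g₁ * g₂)).choose_spec, map_mul, ← Matrix.mulVec_mulVec,
      ← (exists_altMat_action g₁).choose_spec, ← (exists_altMat_action g₂).choose_spec, suMat_mul,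
      Matrix.transpose_mul]
    simp only [Matrix.mul_assoc]

theorem altMat_altHom (g : SUpq 2 2) (v : Fin 2 ⊕ Fin 4 → ℝ) :
    altMat (soMat (altHom g) *ᵥ v) = suMat g * altMat v * (suMat g)ᵀ :=
  ((exists_altMat_action g).choose_spec v).symm

theorem continuous_altHom : Continuous altHom := by
  rw [soMat_isInducing.continuous_iff]
  refine continuous_matrix fun i j => ?_
  have h : ∀ g, soMat (altHom g) i j =
      altCoord (suMat g * altMat (Pi.single j 1) * (suMat g)ᵀ) i := by
    intro g
    rw [← altMat_altHom, altCoord_altMat, Matrix.mulVec_single_one]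
    rfl
  simp only [Function.comp_apply, h]
  have hs : Continuous (suMat : SUpq 2 2 → _) := suMat_isInducing.continuous
  exact (continuous_apply i).comp (continuous_altCoord.comp (by fun_prop))

theorem altHom_expSU {Y : Matrix (Fin 2 ⊕ Fin 4) (Fin 2 ⊕ Fin 4) ℝ}
    (hY : Yᵀ * sigMatrix 2 4 ℝ = -(sigMatrix 2 4 ℝ * Y)) :
    soMat (altHom (expSU ⟨soToSu Y, soToSu_mem Y⟩)) = NormedSpace.exp Y := by
  refine Matrix.mulVec_injective (funext fun v => altMat_injective ?_)
  rw [altMat_altHom, suMat_expSU, exp_mul_altMat_mul_exp (soToSu_equivariant hY)]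

theorem range_altHom : Set.range altHom = connectedComponent (1 : SOpq 2 4) := by
  refine Set.Subset.antisymm ?_ ?_
  · have h1 : altHom.range ≤ Subgroup.connectedComponentOfOne (SOpq 2 4) := by
      rw [MonoidHom.range_eq_map, ← closure_range_expSU (.inl 0), MonoidHom.map_closure,
        Subgroup.closure_le]
      rintro _ ⟨_, ⟨X, rfl⟩, rfl⟩
      have h2 : IsPreconnected (Set.range fun t : ℝ => altHom (expSU (t • X))) :=
        isPreconnected_range (continuous_altHom.comp (continuous_expSU_smul X))
      exact h2.subset_connectedComponent (x := 1) ⟨0, by simp [expSU_zero]⟩ ⟨1, by simp⟩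
    exact h1
  · have h1 : IsOpen (altHom.range : Set (SOpq 2 4)) := by
      refine Subgroup.isOpen_of_mem_nhds _ (g := 1) ?_
      filter_upwards [eventually_exists_soMat_eq_exp 2 4] with h hh
      obtain ⟨Y, hY, hh⟩ := hh
      exact ⟨_, soMat_injective ((altHom_expSU hY).trans hh.symm)⟩
    exact IsClopen.connectedComponent_subset ⟨Subgroup.isClosed_of_isOpen _ h1, h1⟩
      (one_mem altHom.range)

end Isogeny

section Isogeny

/-- The kernel consists of scalars: `g` fixes all alternating matrices `S` of the real form if and
only if `g S = S J ḡ J`, a system of linear equations in the entries of `g` and `ḡ`. -/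
theorem exists_suMat_eq_smul_one {g : SUpq 2 2} (hg : altHom g = 1) :
    ∃ c : ℝ, suMat g = (c : ℂ) • 1 := by
  have hS : ∀ v, suMat g * altMat v =
      altMat v * (sigMatrix 2 2 ℂ * (suMat g).map star * sigMatrix 2 2 ℂ) := by
    intro v
    have h1 : suMat g * altMat v * (suMat g)ᵀ = altMat v := by
      rw [← altMat_altHom, hg, map_one, Matrix.one_mulVec]
    have h2 : (suMat g)ᵀ * (sigMatrix 2 2 ℂ * (suMat g).map star * sigMatrix 2 2 ℂ) = 1 := by
      have h3 := congrArg Matrix.transpose (suMat_form g)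
      rw [Matrix.transpose_mul, Matrix.transpose_mul, sigMatrix_transpose] at h3
      have h4 : ((suMat g)ᴴ)ᵀ = (suMat g).map star := rfl
      rw [h4] at h3
      rw [← Matrix.mul_assoc, h3, sigMatrix_mul_self]
    calc suMat g * altMat v = suMat g * altMat v * ((suMat g)ᵀ *
          (sigMatrix 2 2 ℂ * (suMat g).map star * sigMatrix 2 2 ℂ)) := by rw [h2, Matrix.mul_one]
      _ = _ := by rw [← Matrix.mul_assoc, h1]
  obtain ⟨A, B, C, D, hABCD⟩ : ∃ A B C D, suMat g = Matrix.fromBlocks A B C D :=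
    ⟨_, _, _, _, (Matrix.fromBlocks_toBlocks _).symm⟩
  rw [hABCD] at hS ⊢
  simp only [sigMatrix_eq_fromBlocks, Matrix.fromBlocks_map, Matrix.fromBlocks_multiply, altMat_apply,
    Matrix.mul_one, Matrix.one_mul, Matrix.mul_zero, Matrix.zero_mul, add_zero, zero_add,
    Matrix.mul_neg, Matrix.neg_mul, neg_neg, Matrix.fromBlocks_inj] at hS
  have e1 : (⟨1, 0⟩ : ℂ) = 1 := rfl
  have eI : (⟨0, 1⟩ : ℂ) = Complex.I := rfl
  have eI' : (⟨0, -1⟩ : ℂ) = -Complex.I := by simp [Complex.ext_iff]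
  have e0 : (⟨0, 0⟩ : ℂ) = 0 := rfl
  -- The first two basis vectors give `B = C = 0`; together with the others, they make `A` and `D`
  -- the same real scalar.
  have h0 := hS (Sum.elim ![1, 0] 0)
  have h1 := hS (Sum.elim ![0, 1] 0)
  have h2 := hS (Sum.elim 0 ![1, 0, 0, 0])
  have h3 := hS (Sum.elim 0 ![0, 1, 0, 0])
  have h4 := hS (Sum.elim 0 ![0, 0, 1, 0])
  simp [← Matrix.ext_iff, Fin.forall_fin_two, Matrix.mul_apply, Matrix.vecMul, dotProduct,
    Fin.sum_univ_two, e1, eI, e0, eI'] at h0 h1 h2 h3 h4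
  have hz : ∀ {x y : ℂ}, x = y → x = -y → x = 0 := fun h h' => by linear_combination (h + h') / 2
  have hI : ∀ {x y : ℂ}, x * Complex.I = Complex.I * y → x = y := fun h =>
    mul_right_cancel₀ Complex.I_ne_zero (h.trans (mul_comm _ _))
  have hI' : ∀ {x y : ℂ}, x * Complex.I = -(Complex.I * y) → x = -y := fun h =>
    hI (by rw [h, mul_neg])
  have hc : ∀ {x y : ℂ}, x = (starRingEnd ℂ) y → x = 0 → y = 0 := fun h h' => by
    rwa [h, map_eq_zero] at h'
  obtain ⟨⟨⟨hA01, hA00⟩, hA11, hA10⟩, ⟨⟨hB01, hB00⟩, -, hB10⟩, ⟨⟨hC01, hC00⟩, -, hC10⟩, -⟩ := h0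
  obtain ⟨-, ⟨⟨hB01', hB00'⟩, -, hB10'⟩, ⟨⟨hC01', hC00'⟩, -, hC10'⟩, -⟩ := h1
  obtain ⟨-, ⟨⟨hAD00, hAD01⟩, hAD10, hAD11⟩, ⟨⟨hDA00, hDA01⟩, hDA10, hDA11⟩, -⟩ := h2
  obtain ⟨-, ⟨⟨-, hAD01'⟩, hAD10', -⟩, -⟩ := h3
  obtain ⟨-, -, ⟨-, hDA, -⟩, -⟩ := h4
  have zB01 : B 0 1 = 0 := hz hB01 (hI' hB01')
  have zB10 : B 1 0 = 0 := hc hB01 zB01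
  have zB00 : B 0 0 = 0 := hz (hI hB00') hB00
  have zB11 : B 1 1 = 0 := hc (hI hB00') zB00
  have zC01 : C 0 1 = 0 := hz hC01 (hI' (neg_eq_iff_eq_neg.1 hC01'))
  have zC10 : C 1 0 = 0 := hc hC01 zC01
  have zC00 : C 0 0 = 0 := hz (hI hC00') hC00
  have zC11 : C 1 1 = 0 := hc (hI hC00') zC00
  have zA01 : A 0 1 = 0 := hz hAD01 (hI' (neg_eq_iff_eq_neg.1 hAD01'))
  have zA10 : A 1 0 = 0 := hz hAD10 (hI' hAD10')
  have zD01 : D 0 1 = 0 := hc hAD01 zA01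
  have zD10 : D 1 0 = 0 := hc hAD10 zA10
  have hA : A 0 0 = A 1 1 := hA00.trans (hDA11.symm.trans (hDA.trans hA11.symm))
  have hre : ((A 0 0).re : ℂ) = A 0 0 := Complex.conj_eq_iff_re.1 (hA11.symm.trans hA.symm)
  have hD00 : D 0 0 = A 0 0 := by rw [hDA00, ← hA11, hA]
  have hD11 : D 1 1 = A 0 0 := by rw [hDA11, ← hA00]
  refine ⟨(A 0 0).re, ?_⟩
  rw [hre, ← Matrix.fromBlocks_one, Matrix.fromBlocks_smul, Matrix.fromBlocks_inj]
  refine ⟨?_, ?_, ?_, ?_⟩ <;> ext i j <;> fin_cases i <;> fin_cases j <;>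
    simp [zA01, zA10, zB00, zB01, zB10, zB11, zC00, zC01, zC10, zC11, zD01, zD10, hA, hD00, hD11]

theorem finite_ker_altHom : Finite altHom.ker := by
  have h : ∀ g : altHom.ker, suMat (g : SUpq 2 2) = 1 ∨ suMat (g : SUpq 2 2) = -1 := by
    intro g
    obtain ⟨c, hc⟩ := exists_suMat_eq_smul_one (MonoidHom.mem_ker.1 g.2)
    have h1 := suMat_form (g : SUpq 2 2)
    have h2 := congrFun (congrFun h1 (.inl 0)) (.inl 0)
    rw [hc, sigMatrix_eq_fromBlocks] at h2
    simp at h2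
    have h3 : c * c = 1 := by exact_mod_cast h2
    rcases mul_self_eq_one_iff.1 h3 with rfl | rfl
    · left
      rw [hc, Complex.ofReal_one, one_smul]
    · right
      rw [hc, Complex.ofReal_neg, Complex.ofReal_one, neg_smul, one_smul]
  refine Set.finite_coe_iff.2 (Set.Finite.of_finite_image (f := suMat) (Set.Finite.subset
    (Set.toFinite {1, -1}) ?_) suMat_injective.injOn)
  rintro _ ⟨g, hg, rfl⟩
  exact h ⟨g, hg⟩

theorem isIsogeny_altHom : IsIsogeny altHom :=
  ⟨continuous_altHom, finite_ker_altHom, range_altHom⟩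

/-- The scalar `i` in `SU(2,2)` acts as `-1` on alternating matrices. -/
theorem altHom_ne_one : altHom ≠ 1 := by
  intro h
  let g : SUpq 2 2 := ⟨⟨Complex.I • 1, by
    rw [Matrix.det_smul, Matrix.det_one, mul_one]
    simp⟩, by
    change (Complex.I • (1 : Matrix (Fin 2 ⊕ Fin 2) (Fin 2 ⊕ Fin 2) ℂ))ᴴ * sigMatrix 2 2 ℂ *
      (Complex.I • 1) = sigMatrix 2 2 ℂ
    simp [smul_smul]⟩
  obtain ⟨c, hc⟩ := exists_suMat_eq_smul_one (g := g) (by rw [h]; rfl)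
  have h1 := congrArg Complex.im (congrFun (congrFun hc (.inl 0)) (.inl 0))
  have h2 : suMat g = Complex.I • 1 := rfl
  rw [h2] at h1
  simp at h1

end Isogeny

/-! ### Homomorphisms from `SU(2,2)` to `SO(2,n)` -/

section Classification

theorem ne_one_of_comesFrom {n : ℕ} {ρ : SUpq 2 2 →* SOpq 2 n} (h : ComesFrom altHom ρ) :
    ρ ≠ 1 := by
  rintro rfl
  obtain ⟨ι, hι, h⟩ := h
  have hinj : ∀ v, ι v = 0 → v = 0 := by
    intro v hv
    refine (isIndexTwoForm_sigBilin 4).nondeg v fun w => ?_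
    rw [sigBilin_apply, ← hι, hv]
    simp [sigForm]
  refine altHom_ne_one (MonoidHom.ext fun g => soMat_injective ?_)
  refine Matrix.mulVec_injective (funext fun v => ?_)
  have h1 := (h g).1 v
  rw [soAct_eq, soAct_eq, MonoidHom.one_apply, map_one, Matrix.one_mulVec] at h1
  rw [MonoidHom.one_apply, map_one, Matrix.one_mulVec, ← sub_eq_zero]
  refine hinj _ ?_
  rw [map_sub, ← h1, sub_self]

/-- A homomorphism agreeing infinitesimally with `φ` along an isometric embedding comes from `φ`. -/
theorem comesFrom_of_differential {p q m n : ℕ} (i₀ : Fin p ⊕ Fin q) {φ : SUpq p q →* SOpq 2 m}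
    {ρ : SUpq p q →* SOpq 2 n}
    {D' : Matrix (Fin p ⊕ Fin q) (Fin p ⊕ Fin q) ℂ → Matrix (Fin 2 ⊕ Fin m) (Fin 2 ⊕ Fin m) ℝ}
    {D : Matrix (Fin p ⊕ Fin q) (Fin p ⊕ Fin q) ℂ → Matrix (Fin 2 ⊕ Fin n) (Fin 2 ⊕ Fin n) ℝ}
    (hφ : ∀ X : suLie p q, soMat (φ (expSU X)) = NormedSpace.exp (D' X))
    (hρ : ∀ X : suLie p q, soMat (ρ (expSU X)) = NormedSpace.exp (D X))
    (ι : (Fin 2 ⊕ Fin m → ℝ) →ₗ[ℝ] (Fin 2 ⊕ Fin n → ℝ))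
    (hι : ∀ v w, sigForm (ι v) (ι w) = sigForm v w)
    (h : ∀ X ∈ suLie p q, (∀ v, D X *ᵥ ι v = ι (D' X *ᵥ v)) ∧
      ∀ w, (∀ v, sigForm (ι v) w = 0) → D X *ᵥ w = 0) : ComesFrom φ ρ := by
  refine ⟨ι, hι, fun g => ?_⟩
  have hg : g ∈ Subgroup.closure (Set.range (expSU : suLie p q → SUpq p q)) := by
    rw [closure_range_expSU i₀]
    exact Subgroup.mem_top g
  simp only [soAct_eq]
  induction hg using Subgroup.closure_induction with
  | mem g hg =>
    obtain ⟨X, rfl⟩ := hg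
    rw [hφ, hρ]
    exact ⟨exp_mulVec_linearMap ι (h X X.2).1,
      fun w hw => exp_mulVec_of_mulVec_eq_zero ((h X X.2).2 w hw)⟩
  | one => simp
  | mul g₁ g₂ _ _ h₁ h₂ =>
    refine ⟨fun v => ?_, fun w hw => ?_⟩
    · rw [map_mul, map_mul, map_mul, map_mul, ← Matrix.mulVec_mulVec, h₂.1, h₁.1,
        Matrix.mulVec_mulVec]
    · rw [map_mul, map_mul, ← Matrix.mulVec_mulVec, h₂.2 w hw, h₁.2 w hw]
  | inv g _ h =>
    have hinv : ∀ {k : ℕ} (a : SOpq 2 k) v, soMat a⁻¹ *ᵥ (soMat a *ᵥ v) = v := fun a v => by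
      rw [Matrix.mulVec_mulVec, ← map_mul, inv_mul_cancel, map_one, Matrix.one_mulVec]
    have hinv' : ∀ {k : ℕ} (a : SOpq 2 k) v, soMat a *ᵥ (soMat a⁻¹ *ᵥ v) = v := fun a v => by
      rw [Matrix.mulVec_mulVec, ← map_mul, mul_inv_cancel, map_one, Matrix.one_mulVec]
    refine ⟨fun v => ?_, fun w hw => ?_⟩
    · rw [map_inv φ, map_inv ρ]
      conv_lhs => rw [← hinv' (φ g) v, ← h.1, hinv]
    · rw [map_inv ρ]
      conv_lhs => rw [← h.2 w hw, hinv]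

/-- The differential of a nontrivial homomorphism, as a representation of `u(2,2)`, is not zero on
the translation `eMat 1`: otherwise it would vanish on `su(2,2)`, whose exponentials generate. -/
theorem eMat_one_ne_zero {n : ℕ} {ρ : SUpq 2 2 →* SOpq 2 n} (hne : ρ ≠ 1)
    {D : Matrix (Fin 2 ⊕ Fin 2) (Fin 2 ⊕ Fin 2) ℂ →ₗ[ℝ] Matrix (Fin 2 ⊕ Fin n) (Fin 2 ⊕ Fin n) ℝ}
    (hD : ∀ X : suLie 2 2, soMat (ρ (expSU X)) = NormedSpace.exp (D X))
    (hrep : IsOrthogonalSURep (sigBilin 2 n) (Matrix.toLin'.toLinearMap ∘ₗ D)) :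
    ((Matrix.toLin'.toLinearMap ∘ₗ D) ∘ₗ padMat le_rfl ∘ₗ tracelessPart) (eMat 1) ≠ 0 := fun h =>
  hne (eq_one_of_differential_eq_zero (.inl 0) hD (hrep.eq_zero_of_eMat_one le_rfl h))

theorem comesFrom_of_ne_one {n : ℕ} {ρ : SUpq 2 2 →* SOpq 2 n} (hρ : Continuous ρ) (hne : ρ ≠ 1) :
    ComesFrom altHom ρ := by
  obtain ⟨D, hD, hrep⟩ := exists_orthogonal_differential ρ hρ
  obtain ⟨D', hD', hrep'⟩ := exists_orthogonal_differential altHom continuous_altHom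
  obtain ⟨ι, hι, h⟩ := exists_equivariant_isometry (hrep.restrict le_rfl) (isIndexTwoForm_sigBilin n)
    (eMat_one_ne_zero hne hD hrep) (hrep'.restrict le_rfl) (isIndexTwoForm_sigBilin 4)
    (eMat_one_ne_zero altHom_ne_one hD' hrep') (by simp)
  simp only [sigBilin_apply] at hι h
  refine comesFrom_of_differential (.inl 0) hD' hD ι hι fun X hX => ?_
  have h1 := h X hX
  simp only [LinearMap.comp_apply, tracelessPart_of_trace_eq_zero (mem_suLie.1 hX).2, padMat_self,
    LinearEquiv.coe_coe, Matrix.toLin'_apply] at h1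
  exact h1

end Classification

theorem mainTheorem6 :
    ∃ φ : SUpq 2 2 →* SOpq 2 4, IsIsogeny φ ∧
      (∀ (q n : ℕ), 2 ≤ q → ∀ ρ : SUpq 2 q →* SOpq 2 n, Continuous ρ → ρ ≠ 1 → q = 2) ∧
      (∀ (n : ℕ) (ρ : SUpq 2 2 →* SOpq 2 n), Continuous ρ → (ρ ≠ 1 ↔ ComesFrom φ ρ)) :=
  ⟨altHom, isIsogeny_altHom, fun _ _ hq ρ hρ hne => eq_two_of_ne_one hq ρ hρ hne,
    fun _ _ hρ => ⟨comesFrom_of_ne_one hρ, ne_one_of_comesFrom⟩⟩
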